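/- **Conventions.** A *double category* is a pseudo double category: objects and tight arrows $f\colon A\to B$ form a category, loose arrows $m$ from $A$ to $B$ and cells form a category, and loose composition $\odot$ (written in diagrammatic order) is associative and unital, with units $\mathrm{id}_A$, up to coherent invertible globular cells. $\mathbf{Dbl}$ is the strict 2-category of double categories, pseudo double functors and tight transformations, with its finite products. A *conjoint* of a tight arrow $f\colon A\to B$ is a loose arrow $f^{<}$ from $B$ to $A$ with a cell $\mathrm{id}_A\to f^{<}$ having boundaries $(f,1_A)$ and a cell $f^{<}\to \mathrm{id}_B$ having boundaries $(1_B,f)$, satisfying the two zigzag identities. A cell $\varphi\colon m\to n$ with left boundary $f$ and right boundary $g$ is a *conjoint commuter* if $f$ and $g$ have conjoints and the transposed globular cell $f^{<}\odot m\to n\odot g^{<}$ is invertible. A tight arrow $f$ is called a conjoint commuter if its identity cell $\mathrm{id}_f\colon \mathrm{id}_A\to\mathrm{id}_B$ is one. The 2-category $\mathbf{Dbl}_\bullet$ of *pointed double categories* has as objects the pairs $(D,d)$ of a double category and an object $d$ of it; as 1-cells $(D,d)\to(E,e)$ the pseudo double functors $F\colon D\to E$ with a tight isomorphism $F(d)\cong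 e$, taken in the direction $F(d)\to e$, that is a conjoint commuter; and as 2-cells the tight transformations $\tau\colon F\Rightarrow G$ such that $\tau_d$ commutes with the isomorphisms to $e$. It has finite products, preserved by the forgetful 2-functor $(D,d)\mapsto D$ to $\mathbf{Dbl}$. Let $K$ be a 2-category with finite products. A *symmetric monoidal object* of $K$ is a symmetric pseudomonoid in $K$; two of them are *equivalent* if they are equivalent in the 2-category of symmetric monoidal objects, (strong) pseudo-morphisms and monoidal 2-cells. A *cartesian object* of $K$ is an object $X$ with a right adjoint $X\times X\to X$ of the diagonal and a right adjoint $1\to X$ of the map $X\to 1$; two of them are *equivalent* if they are equivalent by 1-cells whose canonical comparisons with the two right adjoints are invertible. In $\mathbf{Dbl}$ these are the *symmetric monoidal* and the *cartesian double categories*; each determines a unit object, denoted by $1$. **Lemma (Symmetric monoidal and cartesian objects of $\mathbf{Dbl}_\bullet$).** 1. A symmetric monoidal object of $\mathbf{Dbl}_\bullet$ is, up to equivalence, the same thing as a symmetric monoidal double category whose canonical isomorphism $1\otimes 1\to 1$ is a conjoint commuter. Precisely: every symmetric monoidal object of $\mathbf{Dbl}_\bullet$ is equivalent to one whose point is the monoidal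 unit $1$ with the identity as the comparison from $1$ to the point; and forgetting the point is a bijection from the symmetric monoidal objects of $\mathbf{Dbl}_\bullet$ of this latter kind onto the symmetric monoidal double categories whose canonical isomorphism $1\otimes 1\to 1$ is a conjoint commuter. 2. A cartesian object of $\mathbf{Dbl}_\bullet$ is, up to equivalence, the same thing as a cartesian double category whose unique arrow $1\times 1\to 1$ (an isomorphism) is a conjoint commuter. Precisely: every cartesian object of $\mathbf{Dbl}_\bullet$ is equivalent to one whose point is the terminal object $1$ with the identity as the comparison from $1$ to the point; and forgetting the point is a bijection from the cartesian objects of $\mathbf{Dbl}_\bullet$ of this latter kind onto the cartesian double categories whose unique arrow $1\times 1\to 1$ is a conjoint commuter. -/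

import Mathlib

open CategoryTheory Bicategory

universe v u

/-- A loose arrow `arr : dom ⇸ cod`, bundled with its end points. -/
structure LooseArrow {T : Type u} (L : T → T → Type u) : Type u where
  {dom : T}
  {cod : T}
  arr : L dom cod

/-- A (pseudo-)double category: a category of objects and tight arrows, a category of loose arrows
and cells, and a loose composition which is unital and associative up to coherent globular
isomorphism. A morphism `φ : ⟨m⟩ ⟶ ⟨n⟩` of loose arrows is a cell with top `m`, bottom `n`, and tight
left and right boundaries `left φ` and `right φ`. -/
structure DoubleCategory : Type (max (u + 1) (v + 1)) where
  Obj : Type u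
  [tight : Category.{v} Obj]
  Loose : Obj → Obj → Type u
  [cells : Category.{v} (LooseArrow Loose)]
  left : ∀ {m n : LooseArrow Loose}, (m ⟶ n) → (m.dom ⟶ n.dom)
  right : ∀ {m n : LooseArrow Loose}, (m ⟶ n) → (m.cod ⟶ n.cod)
  left_id : ∀ m : LooseArrow Loose, left (𝟙 m) = 𝟙 m.dom
  right_id : ∀ m : LooseArrow Loose, right (𝟙 m) = 𝟙 m.cod
  left_comp : ∀ {m n p : LooseArrow Loose} (φ : m ⟶ n) (ψ : n ⟶ p),
    left (φ ≫ ψ) = left φ ≫ left ψ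
  right_comp : ∀ {m n p : LooseArrow Loose} (φ : m ⟶ n) (ψ : n ⟶ p),
    right (φ ≫ ψ) = right φ ≫ right ψ
  /-- the loose identity of an object -/
  unit : ∀ A : Obj, Loose A A
  /-- the identity cell on a tight arrow -/
  unitCell : ∀ {A B : Obj}, (A ⟶ B) →
    (LooseArrow.mk (L := Loose) (unit A) ⟶ LooseArrow.mk (unit B))
  left_unitCell : ∀ {A B : Obj} (f : A ⟶ B), left (unitCell f) = f
  right_unitCell : ∀ {A B : Obj} (f : A ⟶ B), right (unitCell f) = f
  unitCell_id : ∀ A : Obj, unitCell (𝟙 A) = 𝟙 _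
  unitCell_comp : ∀ {A B C : Obj} (f : A ⟶ B) (g : B ⟶ C),
    unitCell (f ≫ g) = unitCell f ≫ unitCell g
  /-- loose composition, in diagrammatic order -/
  comp : ∀ {A B C : Obj}, Loose A B → Loose B C → Loose A C
  /-- loose composition of cells along a common tight boundary -/
  hcomp : ∀ {A B C A' B' C' : Obj} {m : Loose A B} {n : Loose B C} {m' : Loose A' B'}
    {n' : Loose B' C'} (φ : LooseArrow.mk m ⟶ LooseArrow.mk m')
    (ψ : LooseArrow.mk n ⟶ LooseArrow.mk n'), right φ = left ψ →
    (LooseArrow.mk (comp m n) ⟶ LooseArrow.mk (comp m' n'))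
  left_hcomp : ∀ {A B C A' B' C' : Obj} {m : Loose A B} {n : Loose B C} {m' : Loose A' B'}
    {n' : Loose B' C'} (φ : LooseArrow.mk m ⟶ LooseArrow.mk m')
    (ψ : LooseArrow.mk n ⟶ LooseArrow.mk n') (h : right φ = left ψ),
    left (hcomp φ ψ h) = left φ
  right_hcomp : ∀ {A B C A' B' C' : Obj} {m : Loose A B} {n : Loose B C} {m' : Loose A' B'}
    {n' : Loose B' C'} (φ : LooseArrow.mk m ⟶ LooseArrow.mk m')
    (ψ : LooseArrow.mk n ⟶ LooseArrow.mk n') (h : right φ = left ψ),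
    right (hcomp φ ψ h) = right ψ
  hcomp_id : ∀ {A B C : Obj} (m : Loose A B) (n : Loose B C),
    hcomp (𝟙 (LooseArrow.mk m)) (𝟙 (LooseArrow.mk n))
      ((right_id (LooseArrow.mk m)).trans (left_id (LooseArrow.mk n)).symm) = 𝟙 _
  hcomp_comp : ∀ {A B C A' B' C' A'' B'' C'' : Obj} {m : Loose A B} {n : Loose B C}
    {m' : Loose A' B'} {n' : Loose B' C'} {m'' : Loose A'' B''} {n'' : Loose B'' C''}
    (φ : LooseArrow.mk m ⟶ LooseArrow.mk m') (ψ : LooseArrow.mk n ⟶ LooseArrow.mk n')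
    (h : right φ = left ψ)
    (φ' : LooseArrow.mk m' ⟶ LooseArrow.mk m'') (ψ' : LooseArrow.mk n' ⟶ LooseArrow.mk n'')
    (h' : right φ' = left ψ'),
    hcomp (φ ≫ φ') (ψ ≫ ψ') (by rw [right_comp, left_comp, h, h']) =
      hcomp φ ψ h ≫ hcomp φ' ψ' h'
  assoc : ∀ {A B C D : Obj} (m : Loose A B) (n : Loose B C) (p : Loose C D),
    LooseArrow.mk (comp (comp m n) p) ≅ LooseArrow.mk (comp m (comp n p))
  leftUnitor : ∀ {A B : Obj} (m : Loose A B), LooseArrow.mk (comp (unit A) m) ≅ LooseArrow.mk m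
  rightUnitor : ∀ {A B : Obj} (m : Loose A B), LooseArrow.mk (comp m (unit B)) ≅ LooseArrow.mk m
  left_assoc : ∀ {A B C D : Obj} (m : Loose A B) (n : Loose B C) (p : Loose C D),
    left (assoc m n p).hom = 𝟙 A
  right_assoc : ∀ {A B C D : Obj} (m : Loose A B) (n : Loose B C) (p : Loose C D),
    right (assoc m n p).hom = 𝟙 D
  left_leftUnitor : ∀ {A B : Obj} (m : Loose A B), left (leftUnitor m).hom = 𝟙 A
  right_leftUnitor : ∀ {A B : Obj} (m : Loose A B), right (leftUnitor m).hom = 𝟙 B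
  left_rightUnitor : ∀ {A B : Obj} (m : Loose A B), left (rightUnitor m).hom = 𝟙 A
  right_rightUnitor : ∀ {A B : Obj} (m : Loose A B), right (rightUnitor m).hom = 𝟙 B
  assoc_naturality : ∀ {A B C D A' B' C' D' : Obj} {m : Loose A B} {n : Loose B C}
    {p : Loose C D} {m' : Loose A' B'} {n' : Loose B' C'} {p' : Loose C' D'}
    (φ : LooseArrow.mk m ⟶ LooseArrow.mk m') (ψ : LooseArrow.mk n ⟶ LooseArrow.mk n')
    (χ : LooseArrow.mk p ⟶ LooseArrow.mk p') (h : right φ = left ψ) (h' : right ψ = left χ),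
    hcomp (hcomp φ ψ h) χ ((right_hcomp φ ψ h).trans h') ≫ (assoc m' n' p').hom =
      (assoc m n p).hom ≫ hcomp φ (hcomp ψ χ h') (h.trans (left_hcomp ψ χ h').symm)
  leftUnitor_naturality : ∀ {A B A' B' : Obj} {m : Loose A B} {m' : Loose A' B'}
    (φ : LooseArrow.mk m ⟶ LooseArrow.mk m'),
    hcomp (unitCell (left φ)) φ (right_unitCell (left φ)) ≫ (leftUnitor m').hom =
      (leftUnitor m).hom ≫ φ
  rightUnitor_naturality : ∀ {A B A' B' : Obj} {m : Loose A B} {m' : Loose A' B'}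
    (φ : LooseArrow.mk m ⟶ LooseArrow.mk m'),
    hcomp φ (unitCell (right φ)) (left_unitCell (right φ)).symm ≫ (rightUnitor m').hom =
      (rightUnitor m).hom ≫ φ
  pentagon : ∀ {A B C D E : Obj} (m : Loose A B) (n : Loose B C) (p : Loose C D) (q : Loose D E),
    hcomp (assoc m n p).hom (𝟙 (LooseArrow.mk q))
        ((right_assoc m n p).trans (left_id (LooseArrow.mk q)).symm) ≫
      (assoc m (comp n p) q).hom ≫
      hcomp (𝟙 (LooseArrow.mk m)) (assoc n p q).hom
        ((right_id (LooseArrow.mk m)).trans (left_assoc n p q).symm) =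
      (assoc (comp m n) p q).hom ≫ (assoc m n (comp p q)).hom
  triangle : ∀ {A B C : Obj} (m : Loose A B) (n : Loose B C),
    (assoc m (unit B) n).hom ≫
      hcomp (𝟙 (LooseArrow.mk m)) (leftUnitor n).hom
        ((right_id (LooseArrow.mk m)).trans (left_leftUnitor n).symm) =
      hcomp (rightUnitor m).hom (𝟙 (LooseArrow.mk n))
        ((right_rightUnitor m).trans (left_id (LooseArrow.mk n)).symm)

namespace DoubleCategory

attribute [instance] tight cells
attribute [simp] left_id right_id left_comp right_comp left_unitCell right_unitCell unitCell_id
  left_hcomp right_hcomp hcomp_id left_assoc right_assoc left_leftUnitor right_leftUnitor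
  left_rightUnitor right_rightUnitor

/-- The category of loose arrows and cells. -/
abbrev Arrows (D : DoubleCategory.{v, u}) : Type u := LooseArrow D.Loose

/-- A loose arrow as an object of the category of loose arrows and cells. -/
abbrev arrow (D : DoubleCategory.{v, u}) {A B : D.Obj} (m : D.Loose A B) : D.Arrows :=
  LooseArrow.mk m

/-- A conjoint of a tight arrow `f : A ⟶ B`: a loose arrow `B ⇸ A` with unit and counit cells. -/
structure Conjoint (D : DoubleCategory.{v, u}) {A B : D.Obj} (f : A ⟶ B) where
  loose : D.Loose B A
  unit : D.arrow (D.unit A) ⟶ D.arrow loose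
  counit : D.arrow loose ⟶ D.arrow (D.unit B)
  left_unit : D.left unit = f
  right_unit : D.right unit = 𝟙 A
  left_counit : D.left counit = 𝟙 B
  right_counit : D.right counit = f
  unit_counit : unit ≫ counit = D.unitCell f
  counit_unit : D.hcomp counit unit (right_counit.trans left_unit.symm) ≫
    (D.leftUnitor loose).hom = (D.rightUnitor loose).hom

/-- The conjoint transpose of a cell with top `m : A ⇸ B`, bottom `n : C ⇸ E`, left `f : A ⟶ C` and
right `g : B ⟶ E`: the globular cell `f^< ⊙ m ⟶ n ⊙ g^<` from `C` to `B`. -/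
def conjointTranspose (D : DoubleCategory.{v, u}) {A B C E : D.Obj} {m : D.Loose A B}
    {n : D.Loose C E} (φ : D.arrow m ⟶ D.arrow n)
    (f : D.Conjoint (A := A) (B := C) (D.left φ)) (g : D.Conjoint (A := B) (B := E) (D.right φ)) :
    D.arrow (D.comp f.loose m) ⟶ D.arrow (D.comp n g.loose) :=
  (D.rightUnitor (D.comp f.loose m)).inv ≫
    D.hcomp (D.hcomp f.counit φ f.right_counit) g.unit
      ((D.right_hcomp _ _ _).trans g.left_unit.symm) ≫
    D.hcomp (D.leftUnitor n).hom (𝟙 (D.arrow g.loose)) (by simp)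

/-- A cell is a conjoint commuter if its left and right boundaries have conjoints and its conjoint
transpose is an isomorphism. -/
def IsConjointCommuter (D : DoubleCategory.{v, u}) {A B C E : D.Obj} {m : D.Loose A B}
    {n : D.Loose C E} (φ : D.arrow m ⟶ D.arrow n) : Prop :=
  ∃ (f : D.Conjoint (A := A) (B := C) (D.left φ)) (g : D.Conjoint (A := B) (B := E) (D.right φ)),
    IsIso (D.conjointTranspose φ f g)

end DoubleCategory

/-- A pseudo double functor. -/
structure DoubleFunctor (D E : DoubleCategory.{v, u}) where
  tight : D.Obj ⥤ E.Obj
  loose : ∀ {A B : D.Obj}, D.Loose A B → E.Loose (tight.obj A) (tight.obj B)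
  cell : ∀ {m n : D.Arrows}, (m ⟶ n) → (E.arrow (loose m.arr) ⟶ E.arrow (loose n.arr))
  left_cell : ∀ {m n : D.Arrows} (φ : m ⟶ n), E.left (cell φ) = tight.map (D.left φ)
  right_cell : ∀ {m n : D.Arrows} (φ : m ⟶ n), E.right (cell φ) = tight.map (D.right φ)
  cell_id : ∀ m : D.Arrows, cell (𝟙 m) = 𝟙 _
  cell_comp : ∀ {m n p : D.Arrows} (φ : m ⟶ n) (ψ : n ⟶ p), cell (φ ≫ ψ) = cell φ ≫ cell ψ
  mapComp : ∀ {A B C : D.Obj} (m : D.Loose A B) (n : D.Loose B C),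
    E.arrow (E.comp (loose m) (loose n)) ≅ E.arrow (loose (D.comp m n))
  mapUnit : ∀ A : D.Obj, E.arrow (E.unit (tight.obj A)) ≅ E.arrow (loose (D.unit A))
  left_mapComp : ∀ {A B C : D.Obj} (m : D.Loose A B) (n : D.Loose B C),
    E.left (mapComp m n).hom = 𝟙 (tight.obj A)
  right_mapComp : ∀ {A B C : D.Obj} (m : D.Loose A B) (n : D.Loose B C),
    E.right (mapComp m n).hom = 𝟙 (tight.obj C)
  left_mapUnit : ∀ A : D.Obj, E.left (mapUnit A).hom = 𝟙 (tight.obj A)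
  right_mapUnit : ∀ A : D.Obj, E.right (mapUnit A).hom = 𝟙 (tight.obj A)
  mapComp_naturality : ∀ {A B C A' B' C' : D.Obj} {m : D.Loose A B} {n : D.Loose B C}
    {m' : D.Loose A' B'} {n' : D.Loose B' C'} (φ : D.arrow m ⟶ D.arrow m')
    (ψ : D.arrow n ⟶ D.arrow n') (h : D.right φ = D.left ψ),
    E.hcomp (cell φ) (cell ψ) (by rw [right_cell, left_cell]; exact congrArg tight.map h) ≫
      (mapComp m' n').hom = (mapComp m n).hom ≫ cell (D.hcomp φ ψ h)
  mapUnit_naturality : ∀ {A B : D.Obj} (f : A ⟶ B),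
    E.unitCell (tight.map f) ≫ (mapUnit B).hom = (mapUnit A).hom ≫ cell (D.unitCell f)
  map_assoc : ∀ {A B C X : D.Obj} (m : D.Loose A B) (n : D.Loose B C) (p : D.Loose C X),
    E.hcomp (mapComp m n).hom (𝟙 (E.arrow (loose p)))
        ((right_mapComp m n).trans (E.left_id (E.arrow (loose p))).symm) ≫
      (mapComp (D.comp m n) p).hom ≫ cell (D.assoc m n p).hom =
    (E.assoc (loose m) (loose n) (loose p)).hom ≫
      E.hcomp (𝟙 (E.arrow (loose m))) (mapComp n p).hom
        ((E.right_id (E.arrow (loose m))).trans (left_mapComp n p).symm) ≫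
      (mapComp m (D.comp n p)).hom
  map_leftUnitor : ∀ {A B : D.Obj} (m : D.Loose A B),
    E.hcomp (mapUnit A).hom (𝟙 (E.arrow (loose m)))
        ((right_mapUnit A).trans (E.left_id (E.arrow (loose m))).symm) ≫
      (mapComp (D.unit A) m).hom ≫ cell (D.leftUnitor m).hom = (E.leftUnitor (loose m)).hom
  map_rightUnitor : ∀ {A B : D.Obj} (m : D.Loose A B),
    E.hcomp (𝟙 (E.arrow (loose m))) (mapUnit B).hom
        ((E.right_id (E.arrow (loose m))).trans (left_mapUnit B).symm) ≫
      (mapComp m (D.unit B)).hom ≫ cell (D.rightUnitor m).hom = (E.rightUnitor (loose m)).hom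

/-- A tight transformation between pseudo double functors. -/
structure TightTransformation {D E : DoubleCategory.{v, u}} (F G : DoubleFunctor D E) where
  app : ∀ A : D.Obj, F.tight.obj A ⟶ G.tight.obj A
  cell : ∀ m : D.Arrows, E.arrow (F.loose m.arr) ⟶ E.arrow (G.loose m.arr)
  left_cell : ∀ m : D.Arrows, E.left (cell m) = app m.dom
  right_cell : ∀ m : D.Arrows, E.right (cell m) = app m.cod
  app_naturality : ∀ {A B : D.Obj} (f : A ⟶ B), F.tight.map f ≫ app B = app A ≫ G.tight.map f
  cell_naturality : ∀ {m n : D.Arrows} (φ : m ⟶ n), F.cell φ ≫ cell n = cell m ≫ G.cell φ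
  cell_comp : ∀ {A B C : D.Obj} (m : D.Loose A B) (n : D.Loose B C),
    (F.mapComp m n).hom ≫ cell (D.arrow (D.comp m n)) =
      E.hcomp (cell (D.arrow m)) (cell (D.arrow n)) ((right_cell (D.arrow m)).trans (left_cell (D.arrow n)).symm) ≫
        (G.mapComp m n).hom
  cell_unit : ∀ A : D.Obj,
    (F.mapUnit A).hom ≫ cell (D.arrow (D.unit A)) = E.unitCell (app A) ≫ (G.mapUnit A).hom

attribute [simp] DoubleFunctor.left_cell DoubleFunctor.right_cell DoubleFunctor.cell_id
  DoubleFunctor.left_mapComp DoubleFunctor.right_mapComp DoubleFunctor.left_mapUnit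
  DoubleFunctor.right_mapUnit TightTransformation.left_cell TightTransformation.right_cell

namespace DoubleCategory

variable (D : DoubleCategory.{v, u})

theorem comp_hcomp_id {A A' A'' B C : D.Obj} {m : D.Loose A B} {m' : D.Loose A' B}
    {m'' : D.Loose A'' B} {n : D.Loose B C} (φ : D.arrow m ⟶ D.arrow m')
    (ψ : D.arrow m' ⟶ D.arrow m'') (h : D.right φ = 𝟙 B) (h' : D.right ψ = 𝟙 B)
    (h'' : D.right (φ ≫ ψ) = D.left (𝟙 (D.arrow n))) :
    D.hcomp (φ ≫ ψ) (𝟙 (D.arrow n)) h'' =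
      D.hcomp φ (𝟙 (D.arrow n)) (h.trans (D.left_id (D.arrow n)).symm) ≫
        D.hcomp ψ (𝟙 (D.arrow n)) (h'.trans (D.left_id (D.arrow n)).symm) := by
  rw [← D.hcomp_comp]
  congr 1
  exact (Category.comp_id _).symm

theorem id_hcomp_comp {A B C C' C'' : D.Obj} {m : D.Loose A B} {n : D.Loose B C}
    {n' : D.Loose B C'} {n'' : D.Loose B C''} (φ : D.arrow n ⟶ D.arrow n')
    (ψ : D.arrow n' ⟶ D.arrow n'') (h : D.left φ = 𝟙 B) (h' : D.left ψ = 𝟙 B)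
    (h'' : D.right (𝟙 (D.arrow m)) = D.left (φ ≫ ψ)) :
    D.hcomp (𝟙 (D.arrow m)) (φ ≫ ψ) h'' =
      D.hcomp (𝟙 (D.arrow m)) φ ((D.right_id (D.arrow m)).trans h.symm) ≫
        D.hcomp (𝟙 (D.arrow m)) ψ ((D.right_id (D.arrow m)).trans h'.symm) := by
  rw [← D.hcomp_comp]
  congr 1
  exact (Category.comp_id _).symm

end DoubleCategory

namespace TightTransformation

variable {D E : DoubleCategory.{v, u}} {F G H : DoubleFunctor D E}

@[ext]
theorem ext' {s t : TightTransformation F G} (h : s.app = t.app) (h' : s.cell = t.cell) :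
    s = t := by
  cases s; cases t; cases h; cases h'; rfl

/-- The identity transformation. -/
def id (F : DoubleFunctor D E) : TightTransformation F F where
  app A := 𝟙 (F.tight.obj A)
  cell m := 𝟙 (E.arrow (F.loose m.arr))
  left_cell m := E.left_id _
  right_cell m := E.right_id _
  app_naturality f := by rw [Category.comp_id, Category.id_comp]
  cell_naturality φ := by rw [Category.comp_id, Category.id_comp]
  cell_comp m n := by rw [Category.comp_id]; erw [E.hcomp_id]; rw [Category.id_comp]
  cell_unit A := by rw [Category.comp_id, E.unitCell_id, Category.id_comp]

/-- The composite of transformations. -/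
def comp (s : TightTransformation F G) (t : TightTransformation G H) :
    TightTransformation F H where
  app A := s.app A ≫ t.app A
  cell m := s.cell m ≫ t.cell m
  left_cell m := by simp
  right_cell m := by simp
  app_naturality f := by
    rw [← Category.assoc, s.app_naturality, Category.assoc, t.app_naturality, Category.assoc]
  cell_naturality φ := by
    rw [← Category.assoc, s.cell_naturality, Category.assoc, t.cell_naturality, Category.assoc]
  cell_comp m n := by
    rw [E.hcomp_comp _ _ ((s.right_cell (D.arrow m)).trans (s.left_cell (D.arrow n)).symm)
      _ _ ((t.right_cell (D.arrow m)).trans (t.left_cell (D.arrow n)).symm), ← Category.assoc,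
      s.cell_comp, Category.assoc, t.cell_comp, Category.assoc]
  cell_unit A := by
    rw [E.unitCell_comp, ← Category.assoc, s.cell_unit, Category.assoc, t.cell_unit,
      Category.assoc]

end TightTransformation

namespace DoubleFunctor

/-- The identity double functor. -/
abbrev id (D : DoubleCategory.{v, u}) : DoubleFunctor D D where
  tight := 𝟭 D.Obj
  loose m := m
  cell φ := φ
  left_cell φ := rfl
  right_cell φ := rfl
  cell_id m := rfl
  cell_comp φ ψ := rfl
  mapComp m n := Iso.refl _
  mapUnit A := Iso.refl _
  left_mapComp m n := D.left_id _
  right_mapComp m n := D.right_id _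
  left_mapUnit A := D.left_id _
  right_mapUnit A := D.right_id _
  mapComp_naturality φ ψ h := (Category.comp_id _).trans (Category.id_comp _).symm
  mapUnit_naturality f := (Category.comp_id _).trans (Category.id_comp _).symm
  map_assoc m n p := by simp
  map_leftUnitor m := by simp
  map_rightUnitor m := by simp

theorem mapComp_id_right {D E : DoubleCategory.{v, u}} (F : DoubleFunctor D E)
    {A A' B C : D.Obj} {m : D.Loose A B} {m' : D.Loose A' B} (n : D.Loose B C)
    (φ : D.arrow m ⟶ D.arrow m') (h : D.right φ = D.left (𝟙 (D.arrow n)))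
    (h' : E.right (F.cell φ) = E.left (𝟙 (E.arrow (F.loose n)))) {z : E.Arrows}
    (ζ : E.arrow (F.loose (D.comp m' n)) ⟶ z) :
    E.hcomp (F.cell φ) (𝟙 (E.arrow (F.loose n))) h' ≫ (F.mapComp m' n).hom ≫ ζ =
      (F.mapComp m n).hom ≫ F.cell (D.hcomp φ (𝟙 (D.arrow n)) h) ≫ ζ := by
  rw [← Category.assoc, ← Category.assoc, ← F.mapComp_naturality]
  congr 3
  exact (F.cell_id (D.arrow n)).symm

theorem mapComp_id_left {D E : DoubleCategory.{v, u}} (F : DoubleFunctor D E)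
    {A B C C' : D.Obj} (m : D.Loose A B) {n : D.Loose B C} {n' : D.Loose B C'}
    (φ : D.arrow n ⟶ D.arrow n') (h : D.right (𝟙 (D.arrow m)) = D.left φ)
    (h' : E.right (𝟙 (E.arrow (F.loose m))) = E.left (F.cell φ)) {z : E.Arrows}
    (ζ : E.arrow (F.loose (D.comp m n')) ⟶ z) :
    E.hcomp (𝟙 (E.arrow (F.loose m))) (F.cell φ) h' ≫ (F.mapComp m n').hom ≫ ζ =
      (F.mapComp m n).hom ≫ F.cell (D.hcomp (𝟙 (D.arrow m)) φ h) ≫ ζ := by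
  rw [← Category.assoc, ← Category.assoc, ← F.mapComp_naturality]
  congr 3
  exact (F.cell_id (D.arrow m)).symm

/-- The composite of pseudo double functors. -/
abbrev comp {D E X : DoubleCategory.{v, u}} (F : DoubleFunctor D E) (G : DoubleFunctor E X) :
    DoubleFunctor D X where
  tight := F.tight ⋙ G.tight
  loose m := G.loose (F.loose m)
  cell φ := G.cell (F.cell φ)
  left_cell φ := by rw [G.left_cell, F.left_cell]; rfl
  right_cell φ := by rw [G.right_cell, F.right_cell]; rfl
  cell_id m := by rw [F.cell_id, G.cell_id]
  cell_comp φ ψ := by rw [F.cell_comp, G.cell_comp]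
  mapComp m n :=
    { hom := (G.mapComp (F.loose m) (F.loose n)).hom ≫ G.cell (F.mapComp m n).hom
      inv := G.cell (F.mapComp m n).inv ≫ (G.mapComp (F.loose m) (F.loose n)).inv
      hom_inv_id := by
        rw [Category.assoc, ← Category.assoc (G.cell _), ← G.cell_comp]; simp
      inv_hom_id := by
        rw [Category.assoc]; simp [← G.cell_comp] }
  mapUnit A :=
    { hom := (G.mapUnit (F.tight.obj A)).hom ≫ G.cell (F.mapUnit A).hom
      inv := G.cell (F.mapUnit A).inv ≫ (G.mapUnit (F.tight.obj A)).inv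
      hom_inv_id := by
        rw [Category.assoc, ← Category.assoc (G.cell _), ← G.cell_comp]; simp
      inv_hom_id := by
        rw [Category.assoc]; simp [← G.cell_comp] }
  left_mapComp m n := by simp
  right_mapComp m n := by simp
  left_mapUnit A := by simp
  right_mapUnit A := by simp
  mapComp_naturality φ ψ h := by
    rw [← Category.assoc, G.mapComp_naturality _ _ (by
      rw [F.right_cell, F.left_cell]; exact congrArg F.tight.map h), Category.assoc,
      ← G.cell_comp, F.mapComp_naturality _ _ h, G.cell_comp, Category.assoc]
  mapUnit_naturality f := by
    rw [← Category.assoc, Functor.comp_map, G.mapUnit_naturality, Category.assoc,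
      ← G.cell_comp, F.mapUnit_naturality, G.cell_comp, Category.assoc]
  map_assoc m n p := by
    rw [X.comp_hcomp_id _ _ (by simp) (by simp), X.id_hcomp_comp _ _ (by simp) (by simp)]
    simp only [Category.assoc]
    rw [G.mapComp_id_right _ _ (by simp),
      G.mapComp_id_left _ _ (by simp)]
    rw [← G.cell_comp, ← G.cell_comp, ← G.cell_comp, F.map_assoc]
    simp only [G.cell_comp, ← Category.assoc]
    congr 2
    simp only [Category.assoc]
    exact G.map_assoc _ _ _
  map_leftUnitor m := by
    rw [X.comp_hcomp_id _ _ (by simp) (by simp)]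
    simp only [Category.assoc]
    rw [G.mapComp_id_right _ _ (by simp)]
    rw [← G.cell_comp, ← G.cell_comp, F.map_leftUnitor]
    exact G.map_leftUnitor _
  map_rightUnitor m := by
    rw [X.id_hcomp_comp _ _ (by simp) (by simp)]
    simp only [Category.assoc]
    rw [G.mapComp_id_left _ _ (by simp)]
    rw [← G.cell_comp, ← G.cell_comp, F.map_rightUnitor]
    exact G.map_rightUnitor _

end DoubleFunctor

namespace TightTransformation

variable {D E X : DoubleCategory.{v, u}}

/-- Whiskering a transformation by a double functor applied first. -/
def whiskerLeft (F : DoubleFunctor D E) {G H : DoubleFunctor E X} (t : TightTransformation G H) :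
    TightTransformation (F.comp G) (F.comp H) where
  app A := t.app (F.tight.obj A)
  cell m := t.cell (E.arrow (F.loose m.arr))
  left_cell m := t.left_cell _
  right_cell m := t.right_cell _
  app_naturality f := t.app_naturality _
  cell_naturality φ := t.cell_naturality _
  cell_comp m n := by
    simp only [DoubleFunctor.comp, Category.assoc]
    rw [t.cell_naturality, ← Category.assoc, t.cell_comp, Category.assoc]
  cell_unit A := by
    simp only [DoubleFunctor.comp, Category.assoc]
    rw [t.cell_naturality, ← Category.assoc, t.cell_unit, Category.assoc]

/-- Whiskering a transformation by a double functor applied last. -/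
def whiskerRight {F G : DoubleFunctor D E} (t : TightTransformation F G) (H : DoubleFunctor E X) :
    TightTransformation (F.comp H) (G.comp H) where
  app A := H.tight.map (t.app A)
  cell m := H.cell (t.cell m)
  left_cell m := by rw [H.left_cell, t.left_cell]
  right_cell m := by rw [H.right_cell, t.right_cell]
  app_naturality f := by
    simp only [DoubleFunctor.comp, Functor.comp_map, ← H.tight.map_comp]
    rw [t.app_naturality]
  cell_naturality φ := by
    simp only [DoubleFunctor.comp, ← H.cell_comp]
    rw [t.cell_naturality]
  cell_comp m n := by
    simp only [DoubleFunctor.comp, Category.assoc]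
    rw [← H.cell_comp, t.cell_comp, H.cell_comp, ← Category.assoc, ← Category.assoc,
      H.mapComp_naturality]
  cell_unit A := by
    simp only [DoubleFunctor.comp, Category.assoc]
    rw [← H.cell_comp, t.cell_unit, H.cell_comp, ← Category.assoc, ← Category.assoc,
      H.mapUnit_naturality]

end TightTransformation

instance DoubleFunctor.category (D E : DoubleCategory.{v, u}) : Category (DoubleFunctor D E) where
  Hom F G := TightTransformation F G
  id F := TightTransformation.id F
  comp s t := s.comp t
  id_comp _ := TightTransformation.ext' (funext fun _ => Category.id_comp _)
    (funext fun _ => Category.id_comp _)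
  comp_id _ := TightTransformation.ext' (funext fun _ => Category.comp_id _)
    (funext fun _ => Category.comp_id _)
  assoc _ _ _ := TightTransformation.ext' (funext fun _ => Category.assoc _ _ _)
    (funext fun _ => Category.assoc _ _ _)

namespace DoubleFunctor

variable {D E X Y : DoubleCategory.{v, u}}

theorem ext_mapIso {F G : DoubleFunctor D E} (h₁ : F.tight = G.tight)
    (h₂ : HEq (@F.loose) (@G.loose)) (h₃ : HEq (@F.cell) (@G.cell))
    (h₄ : HEq (@F.mapComp) (@G.mapComp)) (h₅ : HEq (@F.mapUnit) (@G.mapUnit)) : F = G := by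
  cases F; cases G; cases h₁; cases h₂; cases h₃; cases h₄; cases h₅; rfl

theorem id_comp' (F : DoubleFunctor D E) : (id D).comp F = F :=
  ext_mapIso rfl HEq.rfl HEq.rfl
    (heq_of_eq (by funext A B C m n; ext; dsimp; rw [F.cell_id]; exact Category.comp_id _))
    (heq_of_eq (by funext A; ext; dsimp; rw [F.cell_id]; exact Category.comp_id _))

theorem comp_id' (F : DoubleFunctor D E) : F.comp (id E) = F :=
  ext_mapIso rfl HEq.rfl HEq.rfl
    (heq_of_eq (by funext A B C m n; ext; exact Category.id_comp _))
    (heq_of_eq (by funext A; ext; exact Category.id_comp _))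

theorem comp_assoc' (F : DoubleFunctor D E) (G : DoubleFunctor E X) (H : DoubleFunctor X Y) :
    (F.comp G).comp H = F.comp (G.comp H) :=
  ext_mapIso rfl HEq.rfl HEq.rfl
    (heq_of_eq (by
      funext A B C m n; ext; dsimp; rw [H.cell_comp, Category.assoc]))
    (heq_of_eq (by funext A; ext; dsimp; rw [H.cell_comp, Category.assoc]))

/-- The components of the transformation given by an equality of double functors. -/
theorem eqToHom_app {F G : DoubleFunctor D E} (h : F = G) (A : D.Obj) :
    (eqToHom h : F ⟶ G).app A = eqToHom (by rw [h]) := by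
  cases h; rfl

theorem eqToHom_cell {F G : DoubleFunctor D E} (h : F = G) (m : D.Arrows) :
    (eqToHom h : F ⟶ G).cell m = eqToHom (by rw [h]) := by
  cases h; rfl

end DoubleFunctor

namespace TightTransformation

variable {D E : DoubleCategory.{v, u}} {F G H K : DoubleFunctor D E}

theorem whiskerLeft_eqToHom {X : DoubleCategory.{v, u}} (F : DoubleFunctor D E)
    {G H : DoubleFunctor E X} (h : G = H) :
    whiskerLeft F (eqToHom h) = eqToHom (congrArg F.comp h) := by
  cases h; rfl

theorem whiskerRight_eqToHom {X : DoubleCategory.{v, u}} {F G : DoubleFunctor D E} (h : F = G)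
    (H : DoubleFunctor E X) :
    whiskerRight (eqToHom h) H = eqToHom (congrArg (fun K => K.comp H) h) := by
  cases h
  exact ext' (funext fun A => H.tight.map_id _) (funext fun m => H.cell_id _)

theorem eqToHom_conj {F' G' : DoubleFunctor D E} (h : F = F') (k : G' = G) (s : F ⟶ G) (t : F' ⟶ G')
    (h₁ : ∀ A, HEq (s.app A) (t.app A)) (h₂ : ∀ m, HEq (s.cell m) (t.cell m)) :
    s = eqToHom h ≫ t ≫ eqToHom k := by
  cases h; cases k
  rw [eqToHom_refl, eqToHom_refl, Category.id_comp, Category.comp_id]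
  exact ext' (funext fun A => eq_of_heq (h₁ A)) (funext fun m => eq_of_heq (h₂ m))

end TightTransformation

namespace DoubleCategory

/-- The strict 2-category of double categories, pseudo double functors and tight
transformations. -/
instance bicategory : Bicategory.{max u v, max u v} DoubleCategory.{v, u} where
  Hom D E := DoubleFunctor D E
  id D := DoubleFunctor.id D
  comp F G := F.comp G
  homCategory D E := DoubleFunctor.category D E
  whiskerLeft F _ _ t := TightTransformation.whiskerLeft F t
  whiskerRight t H := TightTransformation.whiskerRight t H
  associator F G H := eqToIso (DoubleFunctor.comp_assoc' F G H)
  leftUnitor F := eqToIso (DoubleFunctor.id_comp' F)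
  rightUnitor F := eqToIso (DoubleFunctor.comp_id' F)
  whiskerLeft_id F G := rfl
  whiskerLeft_comp F _ _ _ s t := rfl
  id_whiskerLeft t :=
    TightTransformation.eqToHom_conj (DoubleFunctor.id_comp' _) ((DoubleFunctor.id_comp' _).symm) _ _
      (fun _ => HEq.rfl) (fun _ => HEq.rfl)
  comp_whiskerLeft F G _ _ t :=
    TightTransformation.eqToHom_conj (DoubleFunctor.comp_assoc' F G _) ((DoubleFunctor.comp_assoc' F G _).symm) _ _
      (fun _ => HEq.rfl) (fun _ => HEq.rfl)
  id_whiskerRight F G := TightTransformation.ext'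
    (funext fun A => G.tight.map_id _) (funext fun m => G.cell_id _)
  comp_whiskerRight s t G := TightTransformation.ext'
    (funext fun A => G.tight.map_comp _ _) (funext fun m => G.cell_comp _ _)
  whiskerRight_id t :=
    TightTransformation.eqToHom_conj (DoubleFunctor.comp_id' _) ((DoubleFunctor.comp_id' _).symm) _ _
      (fun _ => HEq.rfl) (fun _ => HEq.rfl)
  whiskerRight_comp t G H :=
    TightTransformation.eqToHom_conj ((DoubleFunctor.comp_assoc' _ G H).symm) (DoubleFunctor.comp_assoc' _ G H) _ _
      (fun _ => HEq.rfl) (fun _ => HEq.rfl)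
  whisker_assoc F _ _ t H :=
    TightTransformation.eqToHom_conj (DoubleFunctor.comp_assoc' F _ H) ((DoubleFunctor.comp_assoc' F _ H).symm) _ _
      (fun _ => HEq.rfl) (fun _ => HEq.rfl)
  whisker_exchange s t := TightTransformation.ext'
    (funext fun A => (t.app_naturality _).symm) (funext fun m => (t.cell_naturality _).symm)
  pentagon F G H K := by
    refine Eq.trans (congrArg₂ (fun s t => s ≫
        eqToHom (DoubleFunctor.comp_assoc' F (DoubleFunctor.comp G H) K) ≫ t)
      (TightTransformation.whiskerRight_eqToHom (DoubleFunctor.comp_assoc' F G H) K)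
      (TightTransformation.whiskerLeft_eqToHom F (DoubleFunctor.comp_assoc' G H K))) ?_
    simp
  triangle F G := by
    refine Eq.trans (congrArg (fun t =>
        eqToHom (DoubleFunctor.comp_assoc' F (DoubleFunctor.id _) G) ≫ t)
      (TightTransformation.whiskerLeft_eqToHom F (DoubleFunctor.id_comp' G))) ?_
    refine Eq.trans ?_
      (TightTransformation.whiskerRight_eqToHom (DoubleFunctor.comp_id' F) G).symm
    simp

instance strict : Bicategory.Strict DoubleCategory.{v, u} where
  id_comp {D E} F := DoubleFunctor.id_comp' (D := D) (E := E) F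
  comp_id {D E} F := DoubleFunctor.comp_id' (D := D) (E := E) F
  assoc {D E X Y} F G H := DoubleFunctor.comp_assoc' (D := D) (E := E) (X := X) (Y := Y) F G H
  leftUnitor_eqToIso _ := rfl
  rightUnitor_eqToIso _ := rfl
  associator_eqToIso _ _ _ := rfl

end DoubleCategory

universe w₁ v₁ u₁

/-- A strict 2-category with chosen finite 2-categorical products: postcomposition with the
projections is an isomorphism of categories from `Hom(Z, A × B)` to `Hom(Z, A) × Hom(Z, B)`, and
`Hom(Z, 1)` has exactly one object and one morphism. -/
class CartesianTwoCategory (K : Type u₁) [Bicategory.{w₁, v₁} K] [Bicategory.Strict K] where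
  one : K
  toOne : ∀ Z : K, Z ⟶ one
  toOne_unique : ∀ {Z : K} (f : Z ⟶ one), f = toOne Z
  toOne_ext : ∀ {Z : K} {f g : Z ⟶ one} (s t : f ⟶ g), s = t
  prod : K → K → K
  fst : ∀ A B : K, prod A B ⟶ A
  snd : ∀ A B : K, prod A B ⟶ B
  lift : ∀ {Z A B : K}, (Z ⟶ A) → (Z ⟶ B) → (Z ⟶ prod A B)
  lift_fst : ∀ {Z A B : K} (f : Z ⟶ A) (g : Z ⟶ B), lift f g ≫ fst A B = f
  lift_snd : ∀ {Z A B : K} (f : Z ⟶ A) (g : Z ⟶ B), lift f g ≫ snd A B = g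
  lift_unique : ∀ {Z A B : K} (h : Z ⟶ prod A B), h = lift (h ≫ fst A B) (h ≫ snd A B)
  lift₂ : ∀ {Z A B : K} {f f' : Z ⟶ A} {g g' : Z ⟶ B}, (f ⟶ f') → (g ⟶ g') →
    (lift f g ⟶ lift f' g')
  lift₂_fst : ∀ {Z A B : K} {f f' : Z ⟶ A} {g g' : Z ⟶ B} (s : f ⟶ f') (t : g ⟶ g'),
    lift₂ s t ▷ fst A B = eqToHom (lift_fst f g) ≫ s ≫ eqToHom (lift_fst f' g').symm
  lift₂_snd : ∀ {Z A B : K} {f f' : Z ⟶ A} {g g' : Z ⟶ B} (s : f ⟶ f') (t : g ⟶ g'),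
    lift₂ s t ▷ snd A B = eqToHom (lift_snd f g) ≫ t ≫ eqToHom (lift_snd f' g').symm
  lift_ext : ∀ {Z A B : K} {h h' : Z ⟶ prod A B} (s t : h ⟶ h'),
    s ▷ fst A B = t ▷ fst A B → s ▷ snd A B = t ▷ snd A B → s = t

namespace CartesianTwoCategory

variable {K : Type u₁} [Bicategory.{w₁, v₁} K] [Bicategory.Strict K] [CartesianTwoCategory K]

theorem comp_lift {Y Z A B : K} (w : Y ⟶ Z) (f : Z ⟶ A) (g : Z ⟶ B) :
    w ≫ lift f g = lift (w ≫ f) (w ≫ g) := by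
  rw [lift_unique (w ≫ lift f g), Bicategory.Strict.assoc, Bicategory.Strict.assoc, lift_fst,
    lift_snd]

/-- The product `f ⊙ g` of two generalized elements of an object with a multiplication. -/
abbrev mulMap {X : K} (mul : prod X X ⟶ X) {Z : K} (f g : Z ⟶ X) : Z ⟶ X := lift f g ≫ mul

/-- The product of 2-cells between generalized elements. -/
abbrev mulMap₂ {X : K} (mul : prod X X ⟶ X) {Z : K} {f f' g g' : Z ⟶ X} (s : f ⟶ f')
    (t : g ⟶ g') : mulMap mul f g ⟶ mulMap mul f' g' := lift₂ s t ▷ mul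

theorem comp_mulMap {X : K} (mul : prod X X ⟶ X) {Y Z : K} (w : Y ⟶ Z) (f g : Z ⟶ X) :
    w ≫ mulMap mul f g = mulMap mul (w ≫ f) (w ≫ g) := by
  rw [mulMap, ← Bicategory.Strict.assoc, comp_lift]

/-- The unit as a generalized element. -/
abbrev oneMap {X : K} (unit : (one : K) ⟶ X) (Z : K) : Z ⟶ X := toOne Z ≫ unit

theorem comp_oneMap {X : K} (unit : (one : K) ⟶ X) {Y Z : K} (w : Y ⟶ Z) :
    w ≫ oneMap unit Z = oneMap unit Y := by
  rw [oneMap, ← Bicategory.Strict.assoc, toOne_unique (w ≫ toOne Z)]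

/-- The first projection from `X × (X × X)`. -/
abbrev proj₁ (X : K) : prod X (prod X X) ⟶ X := fst X (prod X X)
/-- The second projection from `X × (X × X)`. -/
abbrev proj₂ (X : K) : prod X (prod X X) ⟶ X := snd X (prod X X) ≫ fst X X
/-- The third projection from `X × (X × X)`. -/
abbrev proj₃ (X : K) : prod X (prod X X) ⟶ X := snd X (prod X X) ≫ snd X X

theorem lift_lift_proj₁ {X Z : K} (f g h : Z ⟶ X) : lift f (lift g h) ≫ proj₁ X = f :=
  lift_fst _ _

theorem lift_lift_proj₂ {X Z : K} (f g h : Z ⟶ X) : lift f (lift g h) ≫ proj₂ X = g := by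
  rw [proj₂, ← Bicategory.Strict.assoc, lift_snd, lift_fst]

theorem lift_lift_proj₃ {X Z : K} (f g h : Z ⟶ X) : lift f (lift g h) ≫ proj₃ X = h := by
  rw [proj₃, ← Bicategory.Strict.assoc, lift_snd, lift_snd]

/-- The first projection from `X × (X × (X × X))`. -/
abbrev quad₁ (X : K) : prod X (prod X (prod X X)) ⟶ X := fst X (prod X (prod X X))
/-- The second projection from `X × (X × (X × X))`. -/
abbrev quad₂ (X : K) : prod X (prod X (prod X X)) ⟶ X := snd X (prod X (prod X X)) ≫ proj₁ X
/-- The third projection from `X × (X × (X × X))`. -/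
abbrev quad₃ (X : K) : prod X (prod X (prod X X)) ⟶ X := snd X (prod X (prod X X)) ≫ proj₂ X
/-- The fourth projection from `X × (X × (X × X))`. -/
abbrev quad₄ (X : K) : prod X (prod X (prod X X)) ⟶ X := snd X (prod X (prod X X)) ≫ proj₃ X

section At

variable {X : K} {mul : prod X X ⟶ X} {unit : (one : K) ⟶ X}

/-- The associator at generalized elements `f`, `g`, `h`. -/
def assocAt (assoc : mulMap mul (mulMap mul (proj₁ X) (proj₂ X)) (proj₃ X) ≅
      mulMap mul (proj₁ X) (mulMap mul (proj₂ X) (proj₃ X))) {Z : K} (f g h : Z ⟶ X) :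
    mulMap mul (mulMap mul f g) h ⟶ mulMap mul f (mulMap mul g h) :=
  eqToHom (by simp only [comp_mulMap, lift_lift_proj₁, lift_lift_proj₂, lift_lift_proj₃]) ≫
    lift f (lift g h) ◁ assoc.hom ≫
    eqToHom (by simp only [comp_mulMap, lift_lift_proj₁, lift_lift_proj₂, lift_lift_proj₃])

/-- The left unitor at a generalized element `f`. -/
def leftUnitorAt (leftUnitor : mulMap mul (oneMap unit X) (𝟙 X) ≅ 𝟙 X) {Z : K} (f : Z ⟶ X) :
    mulMap mul (oneMap unit Z) f ⟶ f :=
  eqToHom (by simp only [comp_mulMap, comp_oneMap, Bicategory.Strict.comp_id]) ≫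
    f ◁ leftUnitor.hom ≫ eqToHom (Bicategory.Strict.comp_id f)

/-- The right unitor at a generalized element `f`. -/
def rightUnitorAt (rightUnitor : mulMap mul (𝟙 X) (oneMap unit X) ≅ 𝟙 X) {Z : K} (f : Z ⟶ X) :
    mulMap mul f (oneMap unit Z) ⟶ f :=
  eqToHom (by simp only [comp_mulMap, comp_oneMap, Bicategory.Strict.comp_id]) ≫
    f ◁ rightUnitor.hom ≫ eqToHom (Bicategory.Strict.comp_id f)

/-- The braiding at generalized elements `f`, `g`. -/
def braidingAt (braiding : mulMap mul (fst X X) (snd X X) ≅ mulMap mul (snd X X) (fst X X))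
    {Z : K} (f g : Z ⟶ X) : mulMap mul f g ⟶ mulMap mul g f :=
  eqToHom (by simp only [comp_mulMap, lift_fst, lift_snd]) ≫
    lift f g ◁ braiding.hom ≫ eqToHom (by simp only [comp_mulMap, lift_fst, lift_snd])

end At

end CartesianTwoCategory

open CartesianTwoCategory

/-- A symmetric monoidal object (symmetric pseudo-monoid) of a cartesian 2-category. The structure
2-cells and their coherence laws live over the powers of the object, whose projections play the role
of variables. -/
structure SymmetricMonoidalObject (K : Type u₁) [Bicategory.{w₁, v₁} K] [Bicategory.Strict K]
    [CartesianTwoCategory K] where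
  obj : K
  mul : prod obj obj ⟶ obj
  unit : (one : K) ⟶ obj
  assoc : mulMap mul (mulMap mul (proj₁ obj) (proj₂ obj)) (proj₃ obj) ≅
    mulMap mul (proj₁ obj) (mulMap mul (proj₂ obj) (proj₃ obj))
  leftUnitor : mulMap mul (oneMap unit obj) (𝟙 obj) ≅ 𝟙 obj
  rightUnitor : mulMap mul (𝟙 obj) (oneMap unit obj) ≅ 𝟙 obj
  braiding : mulMap mul (fst obj obj) (snd obj obj) ≅ mulMap mul (snd obj obj) (fst obj obj)
  pentagon :
    mulMap₂ mul (assocAt assoc (quad₁ obj) (quad₂ obj) (quad₃ obj)) (𝟙 (quad₄ obj)) ≫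
        assocAt assoc (quad₁ obj) (mulMap mul (quad₂ obj) (quad₃ obj)) (quad₄ obj) ≫
        mulMap₂ mul (𝟙 (quad₁ obj)) (assocAt assoc (quad₂ obj) (quad₃ obj) (quad₄ obj)) =
      assocAt assoc (mulMap mul (quad₁ obj) (quad₂ obj)) (quad₃ obj) (quad₄ obj) ≫
        assocAt assoc (quad₁ obj) (quad₂ obj) (mulMap mul (quad₃ obj) (quad₄ obj))
  triangle :
    assocAt assoc (fst obj obj) (oneMap unit (prod obj obj)) (snd obj obj) ≫
        mulMap₂ mul (𝟙 (fst obj obj)) (leftUnitorAt leftUnitor (snd obj obj)) =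
      mulMap₂ mul (rightUnitorAt rightUnitor (fst obj obj)) (𝟙 (snd obj obj))
  hexagon :
    assocAt assoc (proj₁ obj) (proj₂ obj) (proj₃ obj) ≫
        braidingAt braiding (proj₁ obj) (mulMap mul (proj₂ obj) (proj₃ obj)) ≫
        assocAt assoc (proj₂ obj) (proj₃ obj) (proj₁ obj) =
      mulMap₂ mul (braidingAt braiding (proj₁ obj) (proj₂ obj)) (𝟙 (proj₃ obj)) ≫
        assocAt assoc (proj₂ obj) (proj₁ obj) (proj₃ obj) ≫
        mulMap₂ mul (𝟙 (proj₂ obj)) (braidingAt braiding (proj₁ obj) (proj₃ obj))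
  symmetry :
    braidingAt braiding (fst obj obj) (snd obj obj) ≫
      braidingAt braiding (snd obj obj) (fst obj obj) = 𝟙 (mulMap mul (fst obj obj) (snd obj obj))

namespace SymmetricMonoidalObject

variable {K : Type u₁} [Bicategory.{w₁, v₁} K] [Bicategory.Strict K] [CartesianTwoCategory K]

/-- A 1-cell between the underlying objects together with invertible comparison 2-cells for the
multiplications and the units. -/
structure PreHom (X Y : SymmetricMonoidalObject K) where
  map : X.obj ⟶ Y.obj
  mapMul : mulMap Y.mul (fst X.obj X.obj ≫ map) (snd X.obj X.obj ≫ map) ≅ X.mul ≫ map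
  mapUnit : Y.unit ≅ X.unit ≫ map

namespace PreHom

variable {X Y W : SymmetricMonoidalObject K}

/-- The comparison 2-cell for the multiplications at generalized elements `a`, `b`. -/
def mapMulAt (F : PreHom X Y) {Z : K} (a b : Z ⟶ X.obj) :
    mulMap Y.mul (a ≫ F.map) (b ≫ F.map) ⟶ mulMap X.mul a b ≫ F.map :=
  eqToHom (by rw [comp_mulMap, ← Bicategory.Strict.assoc, ← Bicategory.Strict.assoc, lift_fst,
      lift_snd]) ≫
    lift a b ◁ F.mapMul.hom ≫ eqToHom (Bicategory.Strict.assoc _ _ _).symm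

/-- The comparison 2-cell for the units as generalized elements. -/
def mapUnitAt (F : PreHom X Y) (Z : K) : oneMap Y.unit Z ⟶ oneMap X.unit Z ≫ F.map :=
  toOne Z ◁ F.mapUnit.hom ≫ eqToHom (Bicategory.Strict.assoc _ _ _).symm

/-- The identity. -/
def id (X : SymmetricMonoidalObject K) : PreHom X X where
  map := 𝟙 X.obj
  mapMul := eqToIso (by
    rw [Bicategory.Strict.comp_id, Bicategory.Strict.comp_id, Bicategory.Strict.comp_id, mulMap,
      show lift (fst X.obj X.obj) (snd X.obj X.obj) = 𝟙 _ by
        rw [lift_unique (𝟙 (prod X.obj X.obj)), Bicategory.Strict.id_comp,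
          Bicategory.Strict.id_comp], Bicategory.Strict.id_comp])
  mapUnit := eqToIso (Bicategory.Strict.comp_id _).symm

/-- The composite, whose comparison 2-cells are pasted from those of the factors. -/
def comp (F : PreHom X Y) (G : PreHom Y W) : PreHom X W where
  map := F.map ≫ G.map
  mapMul :=
    eqToIso (by rw [comp_mulMap]; simp only [← Bicategory.Strict.assoc, lift_fst, lift_snd]) ≪≫
      whiskerLeftIso (lift (fst X.obj X.obj ≫ F.map) (snd X.obj X.obj ≫ F.map)) G.mapMul ≪≫
      eqToIso (Bicategory.Strict.assoc _ _ _).symm ≪≫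
      whiskerRightIso F.mapMul G.map ≪≫ eqToIso (Bicategory.Strict.assoc _ _ _)
  mapUnit := G.mapUnit ≪≫ whiskerRightIso F.mapUnit G.map ≪≫
    eqToIso (Bicategory.Strict.assoc _ _ _)

/-- The coherence laws of a pseudo-morphism of symmetric monoidal objects. -/
structure IsPseudoMorphism (F : PreHom X Y) : Prop where
  map_assoc :
    mulMap₂ Y.mul (F.mapMulAt (proj₁ X.obj) (proj₂ X.obj)) (𝟙 (proj₃ X.obj ≫ F.map)) ≫
        F.mapMulAt (mulMap X.mul (proj₁ X.obj) (proj₂ X.obj)) (proj₃ X.obj) ≫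
        assocAt X.assoc (proj₁ X.obj) (proj₂ X.obj) (proj₃ X.obj) ▷ F.map =
      assocAt Y.assoc (proj₁ X.obj ≫ F.map) (proj₂ X.obj ≫ F.map) (proj₃ X.obj ≫ F.map) ≫
        mulMap₂ Y.mul (𝟙 (proj₁ X.obj ≫ F.map)) (F.mapMulAt (proj₂ X.obj) (proj₃ X.obj)) ≫
        F.mapMulAt (proj₁ X.obj) (mulMap X.mul (proj₂ X.obj) (proj₃ X.obj))
  map_leftUnitor :
    mulMap₂ Y.mul (F.mapUnitAt X.obj) (𝟙 (𝟙 X.obj ≫ F.map)) ≫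
        F.mapMulAt (oneMap X.unit X.obj) (𝟙 X.obj) ≫ X.leftUnitor.hom ▷ F.map =
      leftUnitorAt Y.leftUnitor (𝟙 X.obj ≫ F.map)
  map_rightUnitor :
    mulMap₂ Y.mul (𝟙 (𝟙 X.obj ≫ F.map)) (F.mapUnitAt X.obj) ≫
        F.mapMulAt (𝟙 X.obj) (oneMap X.unit X.obj) ≫ X.rightUnitor.hom ▷ F.map =
      rightUnitorAt Y.rightUnitor (𝟙 X.obj ≫ F.map)
  map_braiding :
    F.mapMulAt (fst X.obj X.obj) (snd X.obj X.obj) ≫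
        braidingAt X.braiding (fst X.obj X.obj) (snd X.obj X.obj) ▷ F.map =
      braidingAt Y.braiding (fst X.obj X.obj ≫ F.map) (snd X.obj X.obj ≫ F.map) ≫
        F.mapMulAt (snd X.obj X.obj) (fst X.obj X.obj)

/-- A 2-cell between the underlying 1-cells is monoidal if it commutes with the comparison
2-cells. -/
structure IsMonoidal {F G : PreHom X Y} (s : F.map ⟶ G.map) : Prop where
  mul :
    F.mapMulAt (fst X.obj X.obj) (snd X.obj X.obj) ≫
        mulMap X.mul (fst X.obj X.obj) (snd X.obj X.obj) ◁ s =
      mulMap₂ Y.mul (fst X.obj X.obj ◁ s) (snd X.obj X.obj ◁ s) ≫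
        G.mapMulAt (fst X.obj X.obj) (snd X.obj X.obj)
  unit : F.mapUnit.hom ≫ X.unit ◁ s = G.mapUnit.hom

end PreHom

/-- Two symmetric monoidal objects are equivalent if there are pseudo-morphisms in both directions
whose composites are isomorphic to the identities through monoidal 2-cells. -/
def Equivalent (X Y : SymmetricMonoidalObject K) : Prop :=
  ∃ (F : PreHom X Y) (G : PreHom Y X) (s : F.map ≫ G.map ≅ 𝟙 X.obj) (t : G.map ≫ F.map ≅ 𝟙 Y.obj),
    F.IsPseudoMorphism ∧ G.IsPseudoMorphism ∧
      PreHom.IsMonoidal (F := F.comp G) (G := PreHom.id X) s.hom ∧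
      PreHom.IsMonoidal (F := G.comp F) (G := PreHom.id Y) t.hom

end SymmetricMonoidalObject

/-- A cartesian object of a cartesian 2-category: an object with a multiplication right adjoint to
the diagonal and a unit right adjoint to the map to the terminal object. -/
structure CartesianObject (K : Type u₁) [Bicategory.{w₁, v₁} K] [Bicategory.Strict K]
    [CartesianTwoCategory K] where
  obj : K
  mul : prod obj obj ⟶ obj
  unit : (one : K) ⟶ obj
  mulAdj : lift (𝟙 obj) (𝟙 obj) ⊣ mul
  unitAdj : toOne obj ⊣ unit

namespace CartesianObject

variable {K : Type u₁} [Bicategory.{w₁, v₁} K] [Bicategory.Strict K] [CartesianTwoCategory K]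

/-- The canonical comparison 2-cell from the image of products to products of images. -/
def mulComparison {X Y : CartesianObject K} (f : X.obj ⟶ Y.obj) :
    X.mul ≫ f ⟶ lift (fst X.obj X.obj ≫ f) (snd X.obj X.obj ≫ f) ≫ Y.mul :=
  mateEquiv X.mulAdj Y.mulAdj (eqToHom (by
    rw [comp_lift, comp_lift, Bicategory.Strict.comp_id, ← Bicategory.Strict.assoc,
      ← Bicategory.Strict.assoc, lift_fst, lift_snd, Bicategory.Strict.id_comp]))

/-- The canonical comparison 2-cell from the image of the unit to the unit. -/
def unitComparison {X Y : CartesianObject K} (f : X.obj ⟶ Y.obj) :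
    X.unit ≫ f ⟶ 𝟙 (one : K) ≫ Y.unit :=
  mateEquiv X.unitAdj Y.unitAdj (eqToHom (by
    rw [toOne_unique (f ≫ toOne Y.obj), Bicategory.Strict.comp_id]))

/-- A 1-cell is a morphism of cartesian objects if its canonical comparison 2-cells are
invertible. -/
def IsCartesian {X Y : CartesianObject K} (f : X.obj ⟶ Y.obj) : Prop :=
  IsIso (mulComparison f) ∧ IsIso (unitComparison f)

/-- Two cartesian objects are equivalent if there are morphisms of cartesian objects in both
directions whose composites are isomorphic to the identities. -/
def Equivalent (X Y : CartesianObject K) : Prop :=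
  ∃ (f : X.obj ⟶ Y.obj) (g : Y.obj ⟶ X.obj), IsCartesian f ∧ IsCartesian g ∧
    Nonempty (f ≫ g ≅ 𝟙 X.obj) ∧ Nonempty (g ≫ f ≅ 𝟙 Y.obj)

end CartesianObject

namespace DoubleCategory

/-- The loose arrows of the terminal double category. -/
abbrev TerminalLoose (_ _ : PUnit.{u + 1}) : Type u := PUnit.{u + 1}

/-- The category of loose arrows and cells of the terminal double category. -/
instance terminalCells : Category.{v} (LooseArrow TerminalLoose.{u}) where
  Hom _ _ := PUnit.{v + 1}
  id _ := ⟨⟩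
  comp _ _ := ⟨⟩

/-- The terminal double category. -/
def terminal : DoubleCategory.{v, u} where
  Obj := PUnit.{u + 1}
  tight := { Hom := fun _ _ => PUnit.{v + 1}, id := fun _ => ⟨⟩, comp := fun _ _ => ⟨⟩ }
  Loose := TerminalLoose.{u}
  cells := terminalCells.{v, u}
  left _ := ⟨⟩
  right _ := ⟨⟩
  left_id _ := rfl
  right_id _ := rfl
  left_comp _ _ := rfl
  right_comp _ _ := rfl
  unit _ := ⟨⟩
  unitCell _ := ⟨⟩
  left_unitCell _ := rfl
  right_unitCell _ := rfl
  unitCell_id _ := rfl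
  unitCell_comp _ _ := rfl
  comp _ _ := ⟨⟩
  hcomp _ _ _ := ⟨⟩
  left_hcomp _ _ _ := rfl
  right_hcomp _ _ _ := rfl
  hcomp_id _ _ := rfl
  hcomp_comp _ _ _ _ _ _ := rfl
  assoc _ _ _ := ⟨⟨⟩, ⟨⟩, rfl, rfl⟩
  leftUnitor _ := ⟨⟨⟩, ⟨⟩, rfl, rfl⟩
  rightUnitor _ := ⟨⟨⟩, ⟨⟩, rfl, rfl⟩
  left_assoc _ _ _ := rfl
  right_assoc _ _ _ := rfl
  left_leftUnitor _ := rfl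
  right_leftUnitor _ := rfl
  left_rightUnitor _ := rfl
  right_rightUnitor _ := rfl
  assoc_naturality _ _ _ _ _ := rfl
  leftUnitor_naturality _ := rfl
  rightUnitor_naturality _ := rfl
  pentagon _ _ _ _ := rfl
  triangle _ _ := rfl

section Product

variable (D E : DoubleCategory.{v, u})

/-- The loose arrows of a product of double categories. -/
abbrev ProdLoose (A B : D.Obj × E.Obj) : Type u := D.Loose A.1 B.1 × E.Loose A.2 B.2

/-- The first component of a loose arrow of the product. -/
abbrev prodFst (m : LooseArrow (ProdLoose D E)) : D.Arrows := LooseArrow.mk m.arr.1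

/-- The second component of a loose arrow of the product. -/
abbrev prodSnd (m : LooseArrow (ProdLoose D E)) : E.Arrows := LooseArrow.mk m.arr.2

/-- The category of loose arrows and cells of the product. -/
instance prodCells : Category.{v} (LooseArrow (ProdLoose D E)) where
  Hom m n := (prodFst D E m ⟶ prodFst D E n) × (prodSnd D E m ⟶ prodSnd D E n)
  id m := (𝟙 _, 𝟙 _)
  comp φ ψ := (φ.1 ≫ ψ.1, φ.2 ≫ ψ.2)

/-- The product of two double categories, with everything defined componentwise. -/
def product : DoubleCategory.{v, u} where
  Obj := D.Obj × E.Obj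
  tight := CategoryTheory.prod' D.Obj E.Obj
  Loose := ProdLoose D E
  cells := prodCells D E
  left φ := (D.left φ.1, E.left φ.2)
  right φ := (D.right φ.1, E.right φ.2)
  left_id _ := Prod.ext (D.left_id _) (E.left_id _)
  right_id _ := Prod.ext (D.right_id _) (E.right_id _)
  left_comp _ _ := Prod.ext (D.left_comp _ _) (E.left_comp _ _)
  right_comp _ _ := Prod.ext (D.right_comp _ _) (E.right_comp _ _)
  unit A := (D.unit A.1, E.unit A.2)
  unitCell f := (D.unitCell f.1, E.unitCell f.2)
  left_unitCell _ := Prod.ext (D.left_unitCell _) (E.left_unitCell _)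
  right_unitCell _ := Prod.ext (D.right_unitCell _) (E.right_unitCell _)
  unitCell_id _ := Prod.ext (D.unitCell_id _) (E.unitCell_id _)
  unitCell_comp _ _ := Prod.ext (D.unitCell_comp _ _) (E.unitCell_comp _ _)
  comp m n := (D.comp m.1 n.1, E.comp m.2 n.2)
  hcomp φ ψ h := (D.hcomp φ.1 ψ.1 (congrArg Prod.fst h), E.hcomp φ.2 ψ.2 (congrArg Prod.snd h))
  left_hcomp _ _ _ := Prod.ext (D.left_hcomp _ _ _) (E.left_hcomp _ _ _)
  right_hcomp _ _ _ := Prod.ext (D.right_hcomp _ _ _) (E.right_hcomp _ _ _)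
  hcomp_id _ _ := Prod.ext (D.hcomp_id _ _) (E.hcomp_id _ _)
  hcomp_comp _ _ _ _ _ _ := Prod.ext (D.hcomp_comp _ _ _ _ _ _) (E.hcomp_comp _ _ _ _ _ _)
  assoc m n p :=
    { hom := ((D.assoc m.1 n.1 p.1).hom, (E.assoc m.2 n.2 p.2).hom)
      inv := ((D.assoc m.1 n.1 p.1).inv, (E.assoc m.2 n.2 p.2).inv)
      hom_inv_id := Prod.ext (D.assoc m.1 n.1 p.1).hom_inv_id (E.assoc m.2 n.2 p.2).hom_inv_id
      inv_hom_id := Prod.ext (D.assoc m.1 n.1 p.1).inv_hom_id (E.assoc m.2 n.2 p.2).inv_hom_id }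
  leftUnitor m :=
    { hom := ((D.leftUnitor m.1).hom, (E.leftUnitor m.2).hom)
      inv := ((D.leftUnitor m.1).inv, (E.leftUnitor m.2).inv)
      hom_inv_id := Prod.ext (D.leftUnitor m.1).hom_inv_id (E.leftUnitor m.2).hom_inv_id
      inv_hom_id := Prod.ext (D.leftUnitor m.1).inv_hom_id (E.leftUnitor m.2).inv_hom_id }
  rightUnitor m :=
    { hom := ((D.rightUnitor m.1).hom, (E.rightUnitor m.2).hom)
      inv := ((D.rightUnitor m.1).inv, (E.rightUnitor m.2).inv)
      hom_inv_id := Prod.ext (D.rightUnitor m.1).hom_inv_id (E.rightUnitor m.2).hom_inv_id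
      inv_hom_id := Prod.ext (D.rightUnitor m.1).inv_hom_id (E.rightUnitor m.2).inv_hom_id }
  left_assoc _ _ _ := Prod.ext (D.left_assoc _ _ _) (E.left_assoc _ _ _)
  right_assoc _ _ _ := Prod.ext (D.right_assoc _ _ _) (E.right_assoc _ _ _)
  left_leftUnitor _ := Prod.ext (D.left_leftUnitor _) (E.left_leftUnitor _)
  right_leftUnitor _ := Prod.ext (D.right_leftUnitor _) (E.right_leftUnitor _)
  left_rightUnitor _ := Prod.ext (D.left_rightUnitor _) (E.left_rightUnitor _)
  right_rightUnitor _ := Prod.ext (D.right_rightUnitor _) (E.right_rightUnitor _)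
  assoc_naturality _ _ _ h h' := Prod.ext
    (D.assoc_naturality _ _ _ (congrArg Prod.fst h) (congrArg Prod.fst h'))
    (E.assoc_naturality _ _ _ (congrArg Prod.snd h) (congrArg Prod.snd h'))
  leftUnitor_naturality _ := Prod.ext (D.leftUnitor_naturality _) (E.leftUnitor_naturality _)
  rightUnitor_naturality _ := Prod.ext (D.rightUnitor_naturality _) (E.rightUnitor_naturality _)
  pentagon _ _ _ _ := Prod.ext (D.pentagon _ _ _ _) (E.pentagon _ _ _ _)
  triangle _ _ := Prod.ext (D.triangle _ _) (E.triangle _ _)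

end Product

end DoubleCategory

namespace DoubleFunctor

open DoubleCategory

variable {D E X : DoubleCategory.{v, u}}

/-- The double functor to the terminal double category. -/
def toTerminal (D : DoubleCategory.{v, u}) : DoubleFunctor D terminal.{v, u} where
  tight := { obj := fun _ => ⟨⟩, map := fun _ => ⟨⟩ }
  loose _ := ⟨⟩
  cell _ := ⟨⟩
  left_cell _ := rfl
  right_cell _ := rfl
  cell_id _ := rfl
  cell_comp _ _ := rfl
  mapComp _ _ := Iso.refl _
  mapUnit _ := Iso.refl _
  left_mapComp _ _ := rfl
  right_mapComp _ _ := rfl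
  left_mapUnit _ := rfl
  right_mapUnit _ := rfl
  mapComp_naturality _ _ _ := rfl
  mapUnit_naturality _ := rfl
  map_assoc _ _ _ := rfl
  map_leftUnitor _ := rfl
  map_rightUnitor _ := rfl

/-- The first projection from a product. -/
def fst (D E : DoubleCategory.{v, u}) : DoubleFunctor (D.product E) D where
  tight := { obj := fun A => A.1, map := fun f => f.1 }
  loose m := m.1
  cell φ := φ.1
  left_cell _ := rfl
  right_cell _ := rfl
  cell_id _ := rfl
  cell_comp _ _ := rfl
  mapComp _ _ := Iso.refl _
  mapUnit _ := Iso.refl _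
  left_mapComp _ _ := D.left_id _
  right_mapComp _ _ := D.right_id _
  left_mapUnit _ := D.left_id _
  right_mapUnit _ := D.right_id _
  mapComp_naturality _ _ _ := (Category.comp_id _).trans (Category.id_comp _).symm
  mapUnit_naturality _ := (Category.comp_id _).trans (Category.id_comp _).symm
  map_assoc m n p := (DoubleFunctor.id D).map_assoc m.1 n.1 p.1
  map_leftUnitor m := (DoubleFunctor.id D).map_leftUnitor m.1
  map_rightUnitor m := (DoubleFunctor.id D).map_rightUnitor m.1

/-- The second projection from a product. -/
def snd (D E : DoubleCategory.{v, u}) : DoubleFunctor (D.product E) E where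
  tight := { obj := fun A => A.2, map := fun f => f.2 }
  loose m := m.2
  cell φ := φ.2
  left_cell _ := rfl
  right_cell _ := rfl
  cell_id _ := rfl
  cell_comp _ _ := rfl
  mapComp _ _ := Iso.refl _
  mapUnit _ := Iso.refl _
  left_mapComp _ _ := E.left_id _
  right_mapComp _ _ := E.right_id _
  left_mapUnit _ := E.left_id _
  right_mapUnit _ := E.right_id _
  mapComp_naturality _ _ _ := (Category.comp_id _).trans (Category.id_comp _).symm
  mapUnit_naturality _ := (Category.comp_id _).trans (Category.id_comp _).symm
  map_assoc m n p := (DoubleFunctor.id E).map_assoc m.2 n.2 p.2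
  map_leftUnitor m := (DoubleFunctor.id E).map_leftUnitor m.2
  map_rightUnitor m := (DoubleFunctor.id E).map_rightUnitor m.2

/-- The double functor into a product with given components. -/
def lift (F : DoubleFunctor X D) (G : DoubleFunctor X E) : DoubleFunctor X (D.product E) where
  tight :=
    { obj := fun A => (F.tight.obj A, G.tight.obj A)
      map := fun f => (F.tight.map f, G.tight.map f)
      map_id := fun _ => Prod.ext (F.tight.map_id _) (G.tight.map_id _)
      map_comp := fun _ _ => Prod.ext (F.tight.map_comp _ _) (G.tight.map_comp _ _) }
  loose m := (F.loose m, G.loose m)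
  cell φ := (F.cell φ, G.cell φ)
  left_cell _ := Prod.ext (F.left_cell _) (G.left_cell _)
  right_cell _ := Prod.ext (F.right_cell _) (G.right_cell _)
  cell_id _ := Prod.ext (F.cell_id _) (G.cell_id _)
  cell_comp _ _ := Prod.ext (F.cell_comp _ _) (G.cell_comp _ _)
  mapComp m n :=
    { hom := ((F.mapComp m n).hom, (G.mapComp m n).hom)
      inv := ((F.mapComp m n).inv, (G.mapComp m n).inv)
      hom_inv_id := Prod.ext (F.mapComp m n).hom_inv_id (G.mapComp m n).hom_inv_id
      inv_hom_id := Prod.ext (F.mapComp m n).inv_hom_id (G.mapComp m n).inv_hom_id }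
  mapUnit A :=
    { hom := ((F.mapUnit A).hom, (G.mapUnit A).hom)
      inv := ((F.mapUnit A).inv, (G.mapUnit A).inv)
      hom_inv_id := Prod.ext (F.mapUnit A).hom_inv_id (G.mapUnit A).hom_inv_id
      inv_hom_id := Prod.ext (F.mapUnit A).inv_hom_id (G.mapUnit A).inv_hom_id }
  left_mapComp _ _ := Prod.ext (F.left_mapComp _ _) (G.left_mapComp _ _)
  right_mapComp _ _ := Prod.ext (F.right_mapComp _ _) (G.right_mapComp _ _)
  left_mapUnit _ := Prod.ext (F.left_mapUnit _) (G.left_mapUnit _)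
  right_mapUnit _ := Prod.ext (F.right_mapUnit _) (G.right_mapUnit _)
  mapComp_naturality _ _ h :=
    Prod.ext (F.mapComp_naturality _ _ h) (G.mapComp_naturality _ _ h)
  mapUnit_naturality _ := Prod.ext (F.mapUnit_naturality _) (G.mapUnit_naturality _)
  map_assoc _ _ _ := Prod.ext (F.map_assoc _ _ _) (G.map_assoc _ _ _)
  map_leftUnitor _ := Prod.ext (F.map_leftUnitor _) (G.map_leftUnitor _)
  map_rightUnitor _ := Prod.ext (F.map_rightUnitor _) (G.map_rightUnitor _)

/-- The transformation into a product with given components. -/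
def lift₂ {F F' : DoubleFunctor X D} {G G' : DoubleFunctor X E} (s : TightTransformation F F')
    (t : TightTransformation G G') : TightTransformation (lift F G) (lift F' G') where
  app A := (s.app A, t.app A)
  cell m := (s.cell m, t.cell m)
  left_cell _ := Prod.ext (s.left_cell _) (t.left_cell _)
  right_cell _ := Prod.ext (s.right_cell _) (t.right_cell _)
  app_naturality _ := Prod.ext (s.app_naturality _) (t.app_naturality _)
  cell_naturality _ := Prod.ext (s.cell_naturality _) (t.cell_naturality _)
  cell_comp _ _ := Prod.ext (s.cell_comp _ _) (t.cell_comp _ _)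
  cell_unit _ := Prod.ext (s.cell_unit _) (t.cell_unit _)

theorem lift_fst (F : DoubleFunctor X D) (G : DoubleFunctor X E) : (lift F G).comp (fst D E) = F :=
  ext_mapIso rfl HEq.rfl HEq.rfl
    (heq_of_eq (by funext A B C m n; ext; exact Category.id_comp _))
    (heq_of_eq (by funext A; ext; exact Category.id_comp _))

theorem lift_snd (F : DoubleFunctor X D) (G : DoubleFunctor X E) : (lift F G).comp (snd D E) = G :=
  ext_mapIso rfl HEq.rfl HEq.rfl
    (heq_of_eq (by funext A B C m n; ext; exact Category.id_comp _))
    (heq_of_eq (by funext A; ext; exact Category.id_comp _))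

theorem lift_unique (H : DoubleFunctor X (D.product E)) :
    H = lift (H.comp (fst D E)) (H.comp (snd D E)) :=
  ext_mapIso rfl HEq.rfl HEq.rfl
    (heq_of_eq (by
      funext A B C m n; ext
      exact Prod.ext (Category.id_comp _).symm (Category.id_comp _).symm))
    (heq_of_eq (by funext A; ext; exact Prod.ext (Category.id_comp _).symm (Category.id_comp _).symm))

end DoubleFunctor

/-- The cartesian structure of the 2-category of double categories. -/
instance DoubleCategory.cartesian : CartesianTwoCategory DoubleCategory.{v, u} where
  one := DoubleCategory.terminal
  toOne D := DoubleFunctor.toTerminal D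
  toOne_unique _ := rfl
  toOne_ext _ _ := TightTransformation.ext' (funext fun _ => rfl) (funext fun _ => rfl)
  prod D E := D.product E
  fst D E := DoubleFunctor.fst D E
  snd D E := DoubleFunctor.snd D E
  lift F G := DoubleFunctor.lift F G
  lift_fst F G := DoubleFunctor.lift_fst F G
  lift_snd F G := DoubleFunctor.lift_snd F G
  lift_unique H := DoubleFunctor.lift_unique H
  lift₂ s t := DoubleFunctor.lift₂ s t
  lift₂_fst _ _ := TightTransformation.eqToHom_conj (DoubleFunctor.lift_fst _ _)
    (DoubleFunctor.lift_fst _ _).symm _ _ (fun _ => HEq.rfl) (fun _ => HEq.rfl)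
  lift₂_snd _ _ := TightTransformation.eqToHom_conj (DoubleFunctor.lift_snd _ _)
    (DoubleFunctor.lift_snd _ _).symm _ _ (fun _ => HEq.rfl) (fun _ => HEq.rfl)
  lift_ext _ _ h h' := TightTransformation.ext'
    (funext fun A => Prod.ext (congrFun (congrArg TightTransformation.app h) A)
      (congrFun (congrArg TightTransformation.app h') A))
    (funext fun m => Prod.ext (congrFun (congrArg TightTransformation.cell h) m)
      (congrFun (congrArg TightTransformation.cell h') m))

namespace DoubleCategory

variable (D : DoubleCategory.{v, u})

theorem hcomp_congr {A B C A' B' C' : D.Obj} {m : D.Loose A B} {n : D.Loose B C}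
    {m' : D.Loose A' B'} {n' : D.Loose B' C'} {φ φ' : D.arrow m ⟶ D.arrow m'}
    {ψ ψ' : D.arrow n ⟶ D.arrow n'} (e : φ = φ') (e' : ψ = ψ') (h : D.right φ = D.left ψ) :
    D.hcomp φ ψ h = D.hcomp φ' ψ' (e ▸ e' ▸ h) := by
  subst e e'; rfl

theorem right_inv_eq_left_inv {A B C A' B' C' : D.Obj} {m : D.Loose A B} {n : D.Loose B C}
    {m' : D.Loose A' B'} {n' : D.Loose B' C'} (φ : D.arrow m ≅ D.arrow m')
    (ψ : D.arrow n ≅ D.arrow n') (h : D.right φ.hom = D.left ψ.hom) :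
    D.right φ.inv = D.left ψ.inv := by
  have h₁ : D.right φ.inv ≫ D.right φ.hom = 𝟙 _ := by
    rw [← D.right_comp, φ.inv_hom_id, D.right_id]
  have h₂ : D.left ψ.hom ≫ D.left ψ.inv = 𝟙 _ := by
    rw [← D.left_comp, ψ.hom_inv_id, D.left_id]
  calc D.right φ.inv = D.right φ.inv ≫ (D.left ψ.hom ≫ D.left ψ.inv) := by
        rw [h₂]; exact (Category.comp_id _).symm
    _ = (D.right φ.inv ≫ D.right φ.hom) ≫ D.left ψ.inv := by
        rw [h]; exact (Category.assoc _ _ _).symm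
    _ = D.left ψ.inv := by rw [h₁]; exact Category.id_comp _

/-- The loose composite of two invertible cells. -/
def hcompIso {A B C A' B' C' : D.Obj} {m : D.Loose A B} {n : D.Loose B C}
    {m' : D.Loose A' B'} {n' : D.Loose B' C'} (φ : D.arrow m ≅ D.arrow m')
    (ψ : D.arrow n ≅ D.arrow n') (h : D.right φ.hom = D.left ψ.hom) :
    D.arrow (D.comp m n) ≅ D.arrow (D.comp m' n') where
  hom := D.hcomp φ.hom ψ.hom h
  inv := D.hcomp φ.inv ψ.inv (D.right_inv_eq_left_inv φ ψ h)
  hom_inv_id := by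
    rw [← D.hcomp_comp, ← D.hcomp_id]
    exact D.hcomp_congr φ.hom_inv_id ψ.hom_inv_id _
  inv_hom_id := by
    rw [← D.hcomp_comp, ← D.hcomp_id]
    exact D.hcomp_congr φ.inv_hom_id ψ.inv_hom_id _

theorem unit_hcomp_cancel {A B C : D.Obj} {m : D.Loose A B} {n : D.Loose A C}
    {φ ψ : D.arrow m ⟶ D.arrow n} (hφ : D.left φ = 𝟙 A) (hψ : D.left ψ = 𝟙 A)
    (h : D.hcomp (𝟙 (D.arrow (D.unit A))) φ ((D.right_id (D.arrow (D.unit A))).trans hφ.symm) =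
      D.hcomp (𝟙 (D.arrow (D.unit A))) ψ ((D.right_id (D.arrow (D.unit A))).trans hψ.symm)) :
    φ = ψ := by
  have key : ∀ (χ : D.arrow m ⟶ D.arrow n) (hχ : D.left χ = 𝟙 A),
      D.hcomp (𝟙 (D.arrow (D.unit A))) χ ((D.right_id (D.arrow (D.unit A))).trans hχ.symm) ≫
        (D.leftUnitor n).hom = (D.leftUnitor m).hom ≫ χ := fun χ hχ => by
    rw [← D.leftUnitor_naturality χ]
    congr 1
    exact D.hcomp_congr (by
      rw [show D.left χ = 𝟙 A from hχ]; exact (D.unitCell_id A).symm) rfl _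
  have := key φ hφ
  rw [h, key ψ hψ] at this
  exact ((cancel_epi _).1 this).symm

theorem hcomp_unit_cancel {A B C : D.Obj} {m : D.Loose A C} {n : D.Loose B C}
    {φ ψ : D.arrow m ⟶ D.arrow n} (hφ : D.right φ = 𝟙 C) (hψ : D.right ψ = 𝟙 C)
    (h : D.hcomp φ (𝟙 (D.arrow (D.unit C))) (hφ.trans (D.left_id (D.arrow (D.unit C))).symm) =
      D.hcomp ψ (𝟙 (D.arrow (D.unit C))) (hψ.trans (D.left_id (D.arrow (D.unit C))).symm)) :
    φ = ψ := by
  have key : ∀ (χ : D.arrow m ⟶ D.arrow n) (hχ : D.right χ = 𝟙 C),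
      D.hcomp χ (𝟙 (D.arrow (D.unit C))) (hχ.trans (D.left_id (D.arrow (D.unit C))).symm) ≫
        (D.rightUnitor n).hom = (D.rightUnitor m).hom ≫ χ := fun χ hχ => by
    rw [← D.rightUnitor_naturality χ]
    congr 1
    exact D.hcomp_congr rfl (by
      rw [show D.right χ = 𝟙 C from hχ]; exact (D.unitCell_id C).symm) _
  have := key φ hφ
  rw [h, key ψ hψ] at this
  exact ((cancel_epi _).1 this).symm

theorem assoc_leftUnitor {A B C : D.Obj} (m : D.Loose A B) (n : D.Loose B C) :
    (D.assoc (D.unit A) m n).hom ≫ (D.leftUnitor (D.comp m n)).hom =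
      D.hcomp (D.leftUnitor m).hom (𝟙 (D.arrow n))
        ((D.right_leftUnitor m).trans (D.left_id (D.arrow n)).symm) := by
  refine D.unit_hcomp_cancel (by simp) (by simp) ?_
  rw [D.id_hcomp_comp _ _ (by simp) (by simp)]
  have : IsIso (D.hcomp (D.assoc (D.unit A) (D.unit A) m).hom (𝟙 (D.arrow n)) (by simp)) :=
    (D.hcompIso (D.assoc (D.unit A) (D.unit A) m) (Iso.refl (D.arrow n)) (by simp)).isIso_hom
  rw [← cancel_epi (D.assoc (D.unit A) (D.comp (D.unit A) m) n).hom,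
    ← cancel_epi (D.hcomp (D.assoc (D.unit A) (D.unit A) m).hom (𝟙 (D.arrow n)) (by simp))]
  have h₁ := D.pentagon (D.unit A) (D.unit A) m n
  have h₂ := D.triangle (D.unit A) (D.comp m n)
  have h₃ := D.assoc_naturality (D.rightUnitor (D.unit A)).hom (𝟙 (D.arrow m)) (𝟙 (D.arrow n))
    (by simp) (by simp)
  have h₄ := D.triangle (D.unit A) m
  have h₅ := D.assoc_naturality (𝟙 (D.arrow (D.unit A))) (D.leftUnitor m).hom (𝟙 (D.arrow n))
    (by simp) (by simp)
  calc _ = (D.assoc (D.comp (D.unit A) (D.unit A)) m n).hom ≫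
        (D.assoc (D.unit A) (D.unit A) (D.comp m n)).hom ≫
        D.hcomp (𝟙 (D.arrow (D.unit A))) (D.leftUnitor (D.comp m n)).hom (by simp) := by
        simp only [← Category.assoc] at h₁ ⊢
        rw [h₁]
    _ = (D.assoc (D.comp (D.unit A) (D.unit A)) m n).hom ≫
        D.hcomp (D.rightUnitor (D.unit A)).hom (D.hcomp (𝟙 (D.arrow m)) (𝟙 (D.arrow n)) (by simp))
          (by simp) := by
        rw [h₂]; congr 1; exact D.hcomp_congr rfl (D.hcomp_id m n).symm _
    _ = D.hcomp (D.hcomp (D.rightUnitor (D.unit A)).hom (𝟙 (D.arrow m)) (by simp))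
          (𝟙 (D.arrow n)) (by simp) ≫ (D.assoc (D.unit A) m n).hom := h₃.symm
    _ = D.hcomp ((D.assoc (D.unit A) (D.unit A) m).hom ≫
          D.hcomp (𝟙 (D.arrow (D.unit A))) (D.leftUnitor m).hom (by simp))
          (𝟙 (D.arrow n)) (by simp) ≫ (D.assoc (D.unit A) m n).hom := by
        congr 1; exact D.hcomp_congr h₄.symm rfl _
    _ = _ := by
        rw [D.comp_hcomp_id _ _ (by simp) (by simp), Category.assoc, h₅]

theorem leftUnitor_unit (A : D.Obj) :
    (D.leftUnitor (D.unit A)).hom = (D.rightUnitor (D.unit A)).hom := by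
  refine D.hcomp_unit_cancel (by simp) (by simp) ?_
  rw [← D.assoc_leftUnitor, ← D.triangle]
  congr 1
  rw [← cancel_mono (D.leftUnitor (D.unit A)).hom, ← D.leftUnitor_naturality]
  congr 1
  exact D.hcomp_congr (by simp) rfl _

/-- A tight arrow `f : A ⟶ B` along which the loose identity of `B` can be lifted to an invertible
cell with identity left boundary. -/
def HasLift {A B : D.Obj} (f : A ⟶ B) : Prop :=
  ∃ (m : D.Loose B A) (c : D.arrow m ≅ D.arrow (D.unit B)),
    D.left c.hom = 𝟙 B ∧ D.right c.hom = f

variable {D}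

theorem HasLift.exists_conjoint {A B : D.Obj} {f : A ⟶ B} [IsIso f] (h : D.HasLift f) :
    ∃ c : D.Conjoint f, IsIso c.unit ∧ IsIso c.counit := by
  obtain ⟨m, c, h₁, h₂⟩ := h
  have h₃ : D.left c.inv = 𝟙 B := by
    have : D.left c.hom ≫ D.left c.inv = 𝟙 B := by rw [← D.left_comp, c.hom_inv_id, D.left_id]
    rw [h₁] at this
    exact (Category.id_comp _).symm.trans this
  have h₄ : f ≫ D.right c.inv = 𝟙 A := by
    have : D.right c.hom ≫ D.right c.inv = 𝟙 A := by
      rw [← D.right_comp, c.hom_inv_id, D.right_id]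
    rwa [h₂] at this
  have : IsIso (D.unitCell f) := ⟨D.unitCell (inv f), by
    rw [← D.unitCell_comp, IsIso.hom_inv_id, D.unitCell_id], by
    rw [← D.unitCell_comp, IsIso.inv_hom_id, D.unitCell_id]⟩
  refine ⟨
    { loose := m
      unit := D.unitCell f ≫ c.inv
      counit := c.hom
      left_unit := by
        rw [D.left_comp, D.left_unitCell, h₃]; exact Category.comp_id _
      right_unit := by
        rw [D.right_comp, D.right_unitCell, h₄]
      left_counit := h₁
      right_counit := h₂
      unit_counit := by rw [Category.assoc, c.inv_hom_id]; exact Category.comp_id _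
      counit_unit := ?_ }, by
        change IsIso (D.unitCell f ≫ c.inv); infer_instance, c.isIso_hom⟩
  have hc : D.right c.hom = D.left (D.unitCell f ≫ c.inv) := by
    rw [D.left_comp, D.left_unitCell, h₃, h₂]; exact (Category.comp_id _).symm
  rw [← cancel_mono c.hom, Category.assoc, ← D.leftUnitor_naturality c.hom, ← Category.assoc,
    ← D.hcomp_comp c.hom _ hc _ _ (by simp), D.leftUnitor_unit,
    ← D.rightUnitor_naturality c.hom]
  congr 1
  refine D.hcomp_congr ?_ ?_ _
  · rw [h₁]; erw [D.unitCell_id]; exact Category.comp_id _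
  · rw [Category.assoc, c.inv_hom_id, h₂]; exact Category.comp_id _

theorem Conjoint.hasLift {A B : D.Obj} {f : A ⟶ B} [IsIso f] (c : D.Conjoint f) :
    D.HasLift f := by
  have h₁ : D.unitCell (inv f) ≫ D.unitCell f = 𝟙 _ := by
    rw [← D.unitCell_comp, IsIso.inv_hom_id, D.unitCell_id]
  have h₂ : D.unitCell f ≫ D.unitCell (inv f) = 𝟙 _ := by
    rw [← D.unitCell_comp, IsIso.hom_inv_id, D.unitCell_id]
  refine ⟨c.loose, ⟨c.counit, D.unitCell (inv f) ≫ c.unit, ?_, ?_⟩, c.left_counit,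
    c.right_counit⟩
  · have h₃ : D.left (D.unitCell (inv f) ≫ c.unit) = 𝟙 B := by
      rw [D.left_comp, D.left_unitCell, c.left_unit]; exact IsIso.inv_hom_id f
    have key : D.hcomp c.counit c.unit (c.right_counit.trans c.left_unit.symm) =
        D.hcomp c.counit (D.unitCell (D.right c.counit)) (D.left_unitCell _).symm ≫
          D.hcomp (D.unitCell (D.left (D.unitCell (inv f) ≫ c.unit)))
            (D.unitCell (inv f) ≫ c.unit) (D.right_unitCell _) := by
      rw [← D.hcomp_comp]
      refine D.hcomp_congr ?_ ?_ _
      · rw [h₃]; erw [D.unitCell_id]; exact (Category.comp_id _).symm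
      · rw [c.right_counit, ← Category.assoc, h₂]; exact (Category.id_comp _).symm
    have h₄ := c.counit_unit
    rw [key, Category.assoc, D.leftUnitor_naturality (D.unitCell (inv f) ≫ c.unit),
      D.leftUnitor_unit, ← Category.assoc, D.rightUnitor_naturality c.counit,
      Category.assoc] at h₄
    exact (cancel_epi (D.rightUnitor c.loose).hom).1 (h₄.trans (Category.comp_id _).symm)
  · rw [Category.assoc, c.unit_counit, h₁]

theorem isConjointCommuter_of_hasLift {A B C E : D.Obj} {m : D.Loose A B} {n : D.Loose C E}
    (φ : D.arrow m ≅ D.arrow n) (h : D.HasLift (A := A) (B := C) (D.left φ.hom))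
    (h' : D.HasLift (A := B) (B := E) (D.right φ.hom)) : D.IsConjointCommuter φ.hom := by
  have i₁ : IsIso (D.left φ.hom) := ⟨D.left φ.inv, by
    rw [← D.left_comp, φ.hom_inv_id, D.left_id], by
    rw [← D.left_comp, φ.inv_hom_id, D.left_id]⟩
  have i₂ : IsIso (D.right φ.hom) := ⟨D.right φ.inv, by
    rw [← D.right_comp, φ.hom_inv_id, D.right_id], by
    rw [← D.right_comp, φ.inv_hom_id, D.right_id]⟩
  obtain ⟨f, -, hf⟩ := HasLift.exists_conjoint (A := A) (B := C) h
  obtain ⟨g, hg, -⟩ := HasLift.exists_conjoint (A := B) (B := E) h'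
  refine ⟨f, g, ?_⟩
  let e := D.hcompIso (asIso f.counit) φ f.right_counit
  let e' := D.hcompIso e (asIso g.unit) ((D.right_hcomp _ _ _).trans g.left_unit.symm)
  let e'' := D.hcompIso (D.leftUnitor n) (Iso.refl (D.arrow g.loose)) (by simp)
  exact ((D.rightUnitor (D.comp f.loose m)).symm ≪≫ e' ≪≫ e'').isIso_hom

/-- The identity cell on a tight isomorphism. -/
def unitCellIso {A B : D.Obj} (e : A ≅ B) : D.arrow (D.unit A) ≅ D.arrow (D.unit B) where
  hom := D.unitCell e.hom
  inv := D.unitCell e.inv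
  hom_inv_id := by rw [← D.unitCell_comp, e.hom_inv_id, D.unitCell_id]
  inv_hom_id := by rw [← D.unitCell_comp, e.inv_hom_id, D.unitCell_id]

theorem isConjointCommuter_unitCell_iff {A B : D.Obj} (e : A ≅ B) :
    D.IsConjointCommuter (D.unitCell e.hom) ↔ D.HasLift e.hom := by
  constructor
  · rintro ⟨f, -, -⟩
    have : IsIso (D.left (D.unitCell e.hom)) := by
      rw [D.left_unitCell]; exact e.isIso_hom
    have h := Conjoint.hasLift (A := A) (B := B) f
    rwa [D.left_unitCell] at h
  · intro h
    refine isConjointCommuter_of_hasLift (unitCellIso e) ?_ ?_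
    · change D.HasLift (A := A) (B := B) (D.left (D.unitCell e.hom))
      rwa [D.left_unitCell]
    · change D.HasLift (A := A) (B := B) (D.right (D.unitCell e.hom))
      rwa [D.right_unitCell]

theorem hasLift_id (A : D.Obj) : D.HasLift (𝟙 A) :=
  ⟨D.unit A, Iso.refl _, D.left_id _, D.right_id _⟩

theorem HasLift.comp {A B C : D.Obj} {f : A ⟶ B} {g : B ⟶ C} (hf : D.HasLift f)
    (hg : D.HasLift g) (i : IsIso g) : D.HasLift (f ≫ g) := by
  obtain ⟨m, c, h₁, h₂⟩ := hf
  obtain ⟨n, d, h₃, h₄⟩ := hg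
  let u := unitCellIso (asIso g)
  have hu : D.right d.hom = D.left (c.hom ≫ D.unitCell g) := by
    rw [D.left_comp, D.left_unitCell, h₁, h₄]
    exact (Category.id_comp _).symm
  refine ⟨D.comp n m, D.hcompIso d (c ≪≫ u) hu ≪≫ D.leftUnitor (D.unit C), ?_, ?_⟩
  · change D.left (D.hcomp d.hom (c.hom ≫ D.unitCell g) hu ≫ _) = _
    rw [D.left_comp, D.left_hcomp, h₃, D.left_leftUnitor]
    exact Category.comp_id _
  · change D.right (D.hcomp d.hom (c.hom ≫ D.unitCell g) hu ≫ _) = _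
    rw [D.right_comp, D.right_hcomp, D.right_comp, h₂, D.right_unitCell, D.right_leftUnitor]
    exact Category.comp_id _

theorem HasLift.map {D E : DoubleCategory.{v, u}} (F : DoubleFunctor D E) {A B : D.Obj}
    {f : A ⟶ B} (hf : D.HasLift f) : E.HasLift (F.tight.map f) := by
  obtain ⟨m, c, h₁, h₂⟩ := hf
  let k : E.arrow (F.loose m) ≅ E.arrow (F.loose (D.unit B)) :=
    { hom := F.cell c.hom
      inv := F.cell c.inv
      hom_inv_id := by rw [← F.cell_comp, c.hom_inv_id, F.cell_id]
      inv_hom_id := by rw [← F.cell_comp, c.inv_hom_id, F.cell_id] }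
  have h₃ : E.left (F.mapUnit B).inv = 𝟙 (F.tight.obj B) := by
    have : E.left (F.mapUnit B).hom ≫ E.left (F.mapUnit B).inv = 𝟙 _ := by
      rw [← E.left_comp, Iso.hom_inv_id, E.left_id]
    rw [F.left_mapUnit] at this
    exact (Category.id_comp _).symm.trans this
  have h₄ : E.right (F.mapUnit B).inv = 𝟙 (F.tight.obj B) := by
    have : E.right (F.mapUnit B).hom ≫ E.right (F.mapUnit B).inv = 𝟙 _ := by
      rw [← E.right_comp, Iso.hom_inv_id, E.right_id]
    rw [F.right_mapUnit] at this
    exact (Category.id_comp _).symm.trans this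
  refine ⟨F.loose m, k ≪≫ (F.mapUnit B).symm, ?_, ?_⟩
  · change E.left (F.cell c.hom ≫ (F.mapUnit B).inv) = _
    rw [E.left_comp, F.left_cell, h₁, h₃]
    exact (Category.comp_id _).trans (F.tight.map_id _)
  · change E.right (F.cell c.hom ≫ (F.mapUnit B).inv) = _
    rw [E.right_comp, F.right_cell, h₂, h₄]
    exact Category.comp_id _

theorem HasLift.prod {D E : DoubleCategory.{v, u}} {A B : D.Obj} {A' B' : E.Obj} {f : A ⟶ B}
    {g : A' ⟶ B'} (hf : D.HasLift f) (hg : E.HasLift g) :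
    (D.product E).HasLift (A := (A, A')) (B := (B, B')) (f, g) := by
  obtain ⟨m, c, h₁, h₂⟩ := hf
  obtain ⟨n, d, h₃, h₄⟩ := hg
  exact ⟨(m, n),
    { hom := (c.hom, d.hom)
      inv := (c.inv, d.inv)
      hom_inv_id := Prod.ext c.hom_inv_id d.hom_inv_id
      inv_hom_id := Prod.ext c.inv_hom_id d.inv_hom_id }, Prod.ext h₁ h₃, Prod.ext h₂ h₄⟩

end DoubleCategory

/-- A pointed double category: a double category with a chosen object. -/
structure PointedDoubleCategory : Type (max (u + 1) (v + 1)) where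
  double : DoubleCategory.{v, u}
  point : double.Obj

/-- A pseudo double functor preserving the point up to a tight isomorphism whose identity cell is a
conjoint commuter. -/
structure PointedFunctor (D E : PointedDoubleCategory.{v, u}) where
  functor : DoubleFunctor D.double E.double
  pointIso : functor.tight.obj D.point ≅ E.point
  isConjointCommuter : E.double.IsConjointCommuter (E.double.unitCell pointIso.hom)

/-- A tight transformation compatible with the comparison isomorphisms at the point. -/
structure PointedTransformation {D E : PointedDoubleCategory.{v, u}} (F G : PointedFunctor D E) where
  transformation : F.functor ⟶ G.functor
  app_point : transformation.app D.point ≫ G.pointIso.hom = F.pointIso.hom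

namespace PointedFunctor

open DoubleCategory

variable {D E X Y : PointedDoubleCategory.{v, u}}

/-- The identity. -/
abbrev id (D : PointedDoubleCategory.{v, u}) : PointedFunctor D D where
  functor := DoubleFunctor.id D.double
  pointIso := Iso.refl D.point
  isConjointCommuter := (isConjointCommuter_unitCell_iff _).2 (hasLift_id _)

/-- The composite. -/
abbrev comp (F : PointedFunctor D E) (G : PointedFunctor E X) : PointedFunctor D X where
  functor := F.functor.comp G.functor
  pointIso := G.functor.tight.mapIso F.pointIso ≪≫ G.pointIso
  isConjointCommuter := (isConjointCommuter_unitCell_iff _).2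
    ((((isConjointCommuter_unitCell_iff _).1 F.isConjointCommuter).map G.functor).comp
      ((isConjointCommuter_unitCell_iff _).1 G.isConjointCommuter) G.pointIso.isIso_hom)

theorem ext_pointIso {F G : PointedFunctor D E} (h : F.functor = G.functor)
    (h' : HEq F.pointIso G.pointIso) : F = G := by
  cases F; cases G; cases h; cases h'; rfl

theorem id_comp' (F : PointedFunctor D E) : (id D).comp F = F :=
  ext_pointIso (DoubleFunctor.id_comp' _) (heq_of_eq (by
    ext; exact (congrArg (· ≫ _) (F.functor.tight.map_id _)).trans (Category.id_comp _)))

theorem comp_id' (F : PointedFunctor D E) : F.comp (id E) = F :=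
  ext_pointIso (DoubleFunctor.comp_id' _) (heq_of_eq (by ext; exact Category.comp_id _))

theorem comp_assoc' (F : PointedFunctor D E) (G : PointedFunctor E X) (H : PointedFunctor X Y) :
    (F.comp G).comp H = F.comp (G.comp H) :=
  ext_pointIso (DoubleFunctor.comp_assoc' _ _ _) (heq_of_eq (by
    ext
    exact (congrArg (· ≫ _) (H.functor.tight.map_comp _ _)).trans (Category.assoc _ _ _)))

end PointedFunctor

theorem PointedTransformation.ext' {D E : PointedDoubleCategory.{v, u}} {F G : PointedFunctor D E}
    {s t : PointedTransformation F G} (h : s.transformation = t.transformation) : s = t := by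
  cases s; cases t; cases h; rfl

instance PointedFunctor.category (D E : PointedDoubleCategory.{v, u}) :
    Category (PointedFunctor D E) where
  Hom F G := PointedTransformation F G
  id F := ⟨𝟙 F.functor, Category.id_comp _⟩
  comp s t := ⟨s.transformation ≫ t.transformation, by
    rw [← s.app_point, ← t.app_point]; exact Category.assoc _ _ _⟩
  id_comp _ := PointedTransformation.ext' (Category.id_comp _)
  comp_id _ := PointedTransformation.ext' (Category.comp_id _)
  assoc _ _ _ := PointedTransformation.ext' (Category.assoc _ _ _)

namespace PointedTransformation

variable {D E X : PointedDoubleCategory.{v, u}}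

theorem eqToHom_transformation {F G : PointedFunctor D E} (h : F = G) :
    (eqToHom h : F ⟶ G).transformation = eqToHom (congrArg PointedFunctor.functor h) := by
  cases h; rfl

/-- Whiskering by a pointed double functor applied first. -/
def whiskerLeft (F : PointedFunctor D E) {G H : PointedFunctor E X} (t : PointedTransformation G H) :
    PointedTransformation (F.comp G) (F.comp H) where
  transformation := TightTransformation.whiskerLeft F.functor t.transformation
  app_point := by
    change t.transformation.app _ ≫ H.functor.tight.map _ ≫ H.pointIso.hom =
      G.functor.tight.map _ ≫ G.pointIso.hom
    rw [← Category.assoc, ← t.transformation.app_naturality, Category.assoc, t.app_point]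

/-- Whiskering by a pointed double functor applied last. -/
def whiskerRight {F G : PointedFunctor D E} (t : PointedTransformation F G)
    (H : PointedFunctor E X) : PointedTransformation (F.comp H) (G.comp H) where
  transformation := TightTransformation.whiskerRight t.transformation H.functor
  app_point := by
    change H.functor.tight.map _ ≫ H.functor.tight.map _ ≫ H.pointIso.hom =
      H.functor.tight.map _ ≫ H.pointIso.hom
    rw [← Category.assoc, ← Functor.map_comp, t.app_point]

theorem eqToHom_conj {F G F' G' : PointedFunctor D E} (h : F = F') (k : G' = G) (s : F ⟶ G)
    (t : F' ⟶ G') (h₁ : ∀ A, HEq (s.transformation.app A) (t.transformation.app A))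
    (h₂ : ∀ m, HEq (s.transformation.cell m) (t.transformation.cell m)) :
    s = eqToHom h ≫ t ≫ eqToHom k := by
  cases h; cases k
  rw [eqToHom_refl, eqToHom_refl, Category.id_comp, Category.comp_id]
  exact ext' (TightTransformation.ext' (funext fun A => eq_of_heq (h₁ A))
    (funext fun m => eq_of_heq (h₂ m)))

theorem whiskerLeft_eqToHom (F : PointedFunctor D E) {G H : PointedFunctor E X} (h : G = H) :
    whiskerLeft F (eqToHom h) = eqToHom (congrArg F.comp h) := by
  cases h; exact ext' rfl

theorem whiskerRight_eqToHom {F G : PointedFunctor D E} (h : F = G) (H : PointedFunctor E X) :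
    whiskerRight (eqToHom h) H = eqToHom (congrArg (fun K => K.comp H) h) := by
  cases h
  exact ext' (Bicategory.id_whiskerRight (B := DoubleCategory) F.functor H.functor)

end PointedTransformation

namespace PointedDoubleCategory

/-- The strict 2-category of pointed double categories. -/
instance bicategory : Bicategory.{max u v, max u v} PointedDoubleCategory.{v, u} where
  Hom D E := PointedFunctor D E
  id D := PointedFunctor.id D
  comp F G := F.comp G
  homCategory D E := PointedFunctor.category D E
  whiskerLeft F _ _ t := PointedTransformation.whiskerLeft F t
  whiskerRight t H := PointedTransformation.whiskerRight t H
  associator F G H := eqToIso (PointedFunctor.comp_assoc' F G H)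
  leftUnitor F := eqToIso (PointedFunctor.id_comp' F)
  rightUnitor F := eqToIso (PointedFunctor.comp_id' F)
  whiskerLeft_id F G := PointedTransformation.ext'
    (Bicategory.whiskerLeft_id (B := DoubleCategory) F.functor G.functor)
  whiskerLeft_comp F _ _ _ s t := PointedTransformation.ext'
    (Bicategory.whiskerLeft_comp (B := DoubleCategory) F.functor s.transformation t.transformation)
  id_whiskerLeft t :=
    PointedTransformation.eqToHom_conj (PointedFunctor.id_comp' _) ((PointedFunctor.id_comp' _).symm) _ _
      (fun _ => HEq.rfl) (fun _ => HEq.rfl)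
  comp_whiskerLeft F G _ _ t :=
    PointedTransformation.eqToHom_conj (PointedFunctor.comp_assoc' F G _) ((PointedFunctor.comp_assoc' F G _).symm) _ _
      (fun _ => HEq.rfl) (fun _ => HEq.rfl)
  id_whiskerRight F G := PointedTransformation.ext'
    (Bicategory.id_whiskerRight (B := DoubleCategory) F.functor G.functor)
  comp_whiskerRight s t G := PointedTransformation.ext'
    (Bicategory.comp_whiskerRight (B := DoubleCategory) s.transformation t.transformation G.functor)
  whiskerRight_id t :=
    PointedTransformation.eqToHom_conj (PointedFunctor.comp_id' _) ((PointedFunctor.comp_id' _).symm) _ _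
      (fun _ => HEq.rfl) (fun _ => HEq.rfl)
  whiskerRight_comp t G H :=
    PointedTransformation.eqToHom_conj ((PointedFunctor.comp_assoc' _ G H).symm) (PointedFunctor.comp_assoc' _ G H) _ _
      (fun _ => HEq.rfl) (fun _ => HEq.rfl)
  whisker_assoc F _ _ t H :=
    PointedTransformation.eqToHom_conj (PointedFunctor.comp_assoc' F _ H) ((PointedFunctor.comp_assoc' F _ H).symm) _ _
      (fun _ => HEq.rfl) (fun _ => HEq.rfl)
  whisker_exchange s t := PointedTransformation.ext'
    (Bicategory.whisker_exchange (B := DoubleCategory) s.transformation t.transformation)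
  pentagon F G H K := by
    refine Eq.trans (congrArg₂ (fun s t => s ≫
        eqToHom (PointedFunctor.comp_assoc' F (PointedFunctor.comp G H) K) ≫ t)
      (PointedTransformation.whiskerRight_eqToHom (PointedFunctor.comp_assoc' F G H) K)
      (PointedTransformation.whiskerLeft_eqToHom F (PointedFunctor.comp_assoc' G H K))) ?_
    simp
  triangle F G := by
    refine Eq.trans (congrArg (fun t =>
        eqToHom (PointedFunctor.comp_assoc' F (PointedFunctor.id _) G) ≫ t)
      (PointedTransformation.whiskerLeft_eqToHom F (PointedFunctor.id_comp' G))) ?_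
    refine Eq.trans ?_
      (PointedTransformation.whiskerRight_eqToHom (PointedFunctor.comp_id' F) G).symm
    simp

instance strict : Bicategory.Strict PointedDoubleCategory.{v, u} where
  id_comp {D E} F := PointedFunctor.id_comp' (D := D) (E := E) F
  comp_id {D E} F := PointedFunctor.comp_id' (D := D) (E := E) F
  assoc {D E X Y} F G H := PointedFunctor.comp_assoc' (D := D) (E := E) (X := X) (Y := Y) F G H
  leftUnitor_eqToIso _ := rfl
  rightUnitor_eqToIso _ := rfl
  associator_eqToIso _ _ _ := rfl

/-- The terminal pointed double category. -/
abbrev terminal : PointedDoubleCategory.{v, u} := ⟨DoubleCategory.terminal, ⟨⟩⟩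

/-- The product of pointed double categories. -/
abbrev product (D E : PointedDoubleCategory.{v, u}) : PointedDoubleCategory.{v, u} :=
  ⟨D.double.product E.double, (D.point, E.point)⟩

end PointedDoubleCategory

namespace PointedFunctor

open DoubleCategory PointedDoubleCategory

variable {D E X : PointedDoubleCategory.{v, u}}

/-- The pointed double functor to the terminal one. -/
abbrev toTerminal (D : PointedDoubleCategory.{v, u}) : PointedFunctor D terminal where
  functor := DoubleFunctor.toTerminal D.double
  pointIso := Iso.refl _
  isConjointCommuter := (isConjointCommuter_unitCell_iff _).2 (hasLift_id _)

/-- The first projection. -/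
abbrev fst (D E : PointedDoubleCategory.{v, u}) : PointedFunctor (D.product E) D where
  functor := DoubleFunctor.fst D.double E.double
  pointIso := Iso.refl _
  isConjointCommuter := (isConjointCommuter_unitCell_iff _).2 (hasLift_id _)

/-- The second projection. -/
abbrev snd (D E : PointedDoubleCategory.{v, u}) : PointedFunctor (D.product E) E where
  functor := DoubleFunctor.snd D.double E.double
  pointIso := Iso.refl _
  isConjointCommuter := (isConjointCommuter_unitCell_iff _).2 (hasLift_id _)

/-- The isomorphism in a product of categories with given components. -/
abbrev prodIso {D E : DoubleCategory.{v, u}} {A B : D.Obj} {A' B' : E.Obj} (e : A ≅ B)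
    (e' : A' ≅ B') : @Iso (D.product E).Obj _ (A, A') (B, B') where
  hom := (e.hom, e'.hom)
  inv := (e.inv, e'.inv)
  hom_inv_id := Prod.ext e.hom_inv_id e'.hom_inv_id
  inv_hom_id := Prod.ext e.inv_hom_id e'.inv_hom_id

/-- The pointed double functor into a product with given components. -/
abbrev lift (F : PointedFunctor X D) (G : PointedFunctor X E) : PointedFunctor X (D.product E) where
  functor := DoubleFunctor.lift F.functor G.functor
  pointIso := prodIso F.pointIso G.pointIso
  isConjointCommuter := (isConjointCommuter_unitCell_iff _).2
    (((isConjointCommuter_unitCell_iff _).1 F.isConjointCommuter).prod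
      ((isConjointCommuter_unitCell_iff _).1 G.isConjointCommuter))

theorem lift_fst (F : PointedFunctor X D) (G : PointedFunctor X E) :
    (lift F G).comp (fst D E) = F :=
  ext_pointIso (DoubleFunctor.lift_fst _ _) (heq_of_eq (by ext; exact Category.comp_id _))

theorem lift_snd (F : PointedFunctor X D) (G : PointedFunctor X E) :
    (lift F G).comp (snd D E) = G :=
  ext_pointIso (DoubleFunctor.lift_snd _ _) (heq_of_eq (by ext; exact Category.comp_id _))

theorem lift_unique (H : PointedFunctor X (D.product E)) :
    H = lift (H.comp (fst D E)) (H.comp (snd D E)) :=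
  ext_pointIso (DoubleFunctor.lift_unique _) (heq_of_eq (by
    ext; exact Prod.ext (Category.comp_id _).symm (Category.comp_id _).symm))

theorem toTerminal_unique (F : PointedFunctor D terminal) : F = toTerminal D :=
  ext_pointIso rfl HEq.rfl

end PointedFunctor

/-- The cartesian structure of the 2-category of pointed double categories. -/
instance PointedDoubleCategory.cartesian : CartesianTwoCategory PointedDoubleCategory.{v, u} where
  one := PointedDoubleCategory.terminal
  toOne D := PointedFunctor.toTerminal D
  toOne_unique F := PointedFunctor.toTerminal_unique F
  toOne_ext _ _ := PointedTransformation.ext'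
    (TightTransformation.ext' (funext fun _ => rfl) (funext fun _ => rfl))
  prod D E := D.product E
  fst D E := PointedFunctor.fst D E
  snd D E := PointedFunctor.snd D E
  lift F G := PointedFunctor.lift F G
  lift_fst F G := PointedFunctor.lift_fst F G
  lift_snd F G := PointedFunctor.lift_snd F G
  lift_unique H := PointedFunctor.lift_unique H
  lift₂ s t := ⟨DoubleFunctor.lift₂ s.transformation t.transformation,
    Prod.ext s.app_point t.app_point⟩
  lift₂_fst _ _ := PointedTransformation.eqToHom_conj (PointedFunctor.lift_fst _ _)
    (PointedFunctor.lift_fst _ _).symm _ _ (fun _ => HEq.rfl) (fun _ => HEq.rfl)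
  lift₂_snd _ _ := PointedTransformation.eqToHom_conj (PointedFunctor.lift_snd _ _)
    (PointedFunctor.lift_snd _ _).symm _ _ (fun _ => HEq.rfl) (fun _ => HEq.rfl)
  lift_ext s t h h' := PointedTransformation.ext' (CartesianTwoCategory.lift_ext (K := DoubleCategory)
    s.transformation t.transformation (congrArg PointedTransformation.transformation h)
    (congrArg PointedTransformation.transformation h'))

namespace PointedDoubleCategory

/-- The functor on hom-categories that forgets points. -/
def forgetHom (D E : PointedDoubleCategory.{v, u}) : (D ⟶ E) ⥤ (D.double ⟶ E.double) where
  obj F := PointedFunctor.functor F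
  map s := PointedTransformation.transformation s

section Forget

variable {X : PointedDoubleCategory.{v, u}} {mul : prod X X ⟶ X}
  {unit : (one : PointedDoubleCategory.{v, u}) ⟶ X}

theorem forget_assocAt (assoc : mulMap mul (mulMap mul (proj₁ X) (proj₂ X)) (proj₃ X) ≅
      mulMap mul (proj₁ X) (mulMap mul (proj₂ X) (proj₃ X))) {Z : PointedDoubleCategory.{v, u}}
    (f g h : Z ⟶ X) :
    (forgetHom _ _).map (assocAt assoc f g h) =
      assocAt (K := DoubleCategory.{v, u}) (X := X.double) (mul := (forgetHom _ _).obj mul)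
        ((forgetHom _ _).mapIso assoc) ((forgetHom _ _).obj f) ((forgetHom _ _).obj g)
        ((forgetHom _ _).obj h) := by
  rw [assocAt, Functor.map_comp, Functor.map_comp, eqToHom_map, eqToHom_map]
  rfl

theorem forget_leftUnitorAt (leftUnitor : mulMap mul (oneMap unit X) (𝟙 X) ≅ 𝟙 X)
    {Z : PointedDoubleCategory.{v, u}} (f : Z ⟶ X) :
    (forgetHom _ _).map (leftUnitorAt leftUnitor f) =
      leftUnitorAt (K := DoubleCategory.{v, u}) (X := X.double) (mul := (forgetHom _ _).obj mul)
        (unit := (forgetHom _ _).obj unit)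
        ((forgetHom _ _).mapIso leftUnitor) ((forgetHom _ _).obj f) := by
  rw [leftUnitorAt, Functor.map_comp, Functor.map_comp, eqToHom_map, eqToHom_map]
  rfl

theorem forget_rightUnitorAt (rightUnitor : mulMap mul (𝟙 X) (oneMap unit X) ≅ 𝟙 X)
    {Z : PointedDoubleCategory.{v, u}} (f : Z ⟶ X) :
    (forgetHom _ _).map (rightUnitorAt rightUnitor f) =
      rightUnitorAt (K := DoubleCategory.{v, u}) (X := X.double) (mul := (forgetHom _ _).obj mul)
        (unit := (forgetHom _ _).obj unit)
        ((forgetHom _ _).mapIso rightUnitor) ((forgetHom _ _).obj f) := by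
  rw [rightUnitorAt, Functor.map_comp, Functor.map_comp, eqToHom_map, eqToHom_map]
  rfl

theorem forget_braidingAt
    (braiding : mulMap mul (fst X X) (snd X X) ≅ mulMap mul (snd X X) (fst X X))
    {Z : PointedDoubleCategory.{v, u}} (f g : Z ⟶ X) :
    (forgetHom _ _).map (braidingAt braiding f g) =
      braidingAt (K := DoubleCategory.{v, u}) (X := X.double) (mul := (forgetHom _ _).obj mul)
        ((forgetHom _ _).mapIso braiding) ((forgetHom _ _).obj f) ((forgetHom _ _).obj g) := by
  rw [braidingAt, Functor.map_comp, Functor.map_comp, eqToHom_map, eqToHom_map]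
  rfl

theorem forget_mulMap₂ {Z : PointedDoubleCategory.{v, u}} {f f' g g' : Z ⟶ X} (s : f ⟶ f')
    (t : g ⟶ g') :
    (forgetHom _ _).map (mulMap₂ mul s t) =
      mulMap₂ (K := DoubleCategory.{v, u}) (X := X.double) ((forgetHom _ _).obj mul)
        ((forgetHom _ _).map s) ((forgetHom _ _).map t) := rfl

section Adjunction

variable {D E : PointedDoubleCategory.{v, u}}

theorem forget_leftUnitor_hom (f : D ⟶ E) :
    (forgetHom _ _).map (λ_ f).hom =
      (λ_ ((forgetHom _ _).obj f : D.double ⟶ E.double)).hom :=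
  (eqToHom_map (forgetHom D E) (PointedFunctor.id_comp' f) : _)

theorem forget_leftUnitor_inv (f : D ⟶ E) :
    (forgetHom _ _).map (λ_ f).inv =
      (λ_ ((forgetHom _ _).obj f : D.double ⟶ E.double)).inv :=
  (eqToHom_map (forgetHom D E) (PointedFunctor.id_comp' f).symm : _)

theorem forget_rightUnitor_hom (f : D ⟶ E) :
    (forgetHom _ _).map (ρ_ f).hom =
      (ρ_ ((forgetHom _ _).obj f : D.double ⟶ E.double)).hom :=
  (eqToHom_map (forgetHom D E) (PointedFunctor.comp_id' f) : _)

theorem forget_rightUnitor_inv (f : D ⟶ E) :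
    (forgetHom _ _).map (ρ_ f).inv =
      (ρ_ ((forgetHom _ _).obj f : D.double ⟶ E.double)).inv :=
  (eqToHom_map (forgetHom D E) (PointedFunctor.comp_id' f).symm : _)

theorem leftZigzag_eq {K : Type u₁} [Bicategory.{w₁, v₁} K] {a b : K} {f : a ⟶ b} {g : b ⟶ a}
    (η : 𝟙 a ⟶ f ≫ g) (ν : g ≫ f ⟶ 𝟙 b) :
    leftZigzag η ν = η ▷ f ≫ (α_ f g f).hom ≫ f ◁ ν := by
  simp [leftZigzag, bicategoricalComp]

theorem rightZigzag_eq {K : Type u₁} [Bicategory.{w₁, v₁} K] {a b : K} {f : a ⟶ b} {g : b ⟶ a}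
    (η : 𝟙 a ⟶ f ≫ g) (ν : g ≫ f ⟶ 𝟙 b) :
    rightZigzag η ν = g ◁ η ≫ (α_ g f g).inv ≫ ν ▷ g := by
  simp [rightZigzag, bicategoricalComp]

theorem forget_leftZigzag {f : D ⟶ E} {g : E ⟶ D} (η : 𝟙 D ⟶ f ≫ g) (ν : g ≫ f ⟶ 𝟙 E) :
    (forgetHom _ _).map (leftZigzag η ν) =
      leftZigzag (f := ((forgetHom _ _).obj f : D.double ⟶ E.double)) (g := (forgetHom _ _).obj g)
        ((forgetHom _ _).map η) ((forgetHom _ _).map ν) := by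
  refine Eq.trans ?_ (leftZigzag_eq (K := DoubleCategory.{v, u}) (a := D.double) (b := E.double)
    (f := (forgetHom _ _).obj f) (g := (forgetHom _ _).obj g) ((forgetHom D D).map η)
    ((forgetHom E E).map ν)).symm
  rw [leftZigzag_eq, Functor.map_comp, Functor.map_comp]
  exact congrArg (fun t => _ ≫ t ≫ _) (eqToHom_map (forgetHom _ _) (PointedFunctor.comp_assoc' f g f))

theorem forget_rightZigzag {f : D ⟶ E} {g : E ⟶ D} (η : 𝟙 D ⟶ f ≫ g) (ν : g ≫ f ⟶ 𝟙 E) :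
    (forgetHom _ _).map (rightZigzag η ν) =
      rightZigzag (f := ((forgetHom _ _).obj f : D.double ⟶ E.double)) (g := (forgetHom _ _).obj g)
        ((forgetHom _ _).map η) ((forgetHom _ _).map ν) := by
  refine Eq.trans ?_ (rightZigzag_eq (K := DoubleCategory.{v, u}) (a := D.double) (b := E.double)
    (f := (forgetHom _ _).obj f) (g := (forgetHom _ _).obj g) ((forgetHom D D).map η)
    ((forgetHom E E).map ν)).symm
  rw [rightZigzag_eq, Functor.map_comp, Functor.map_comp]
  exact congrArg (fun t => _ ≫ t ≫ _)
    (eqToHom_map (forgetHom _ _) (PointedFunctor.comp_assoc' g f g).symm)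

end Adjunction

end Forget

end PointedDoubleCategory

namespace SymmetricMonoidalObject

open PointedDoubleCategory

set_option maxHeartbeats 1000000 in
/-- The underlying symmetric monoidal double category of a symmetric monoidal object of pointed
double categories. -/
def forget (X : SymmetricMonoidalObject PointedDoubleCategory.{v, u}) :
    SymmetricMonoidalObject DoubleCategory.{v, u} where
  obj := X.obj.double
  mul := PointedFunctor.functor X.mul
  unit := PointedFunctor.functor X.unit
  assoc := (forgetHom _ _).mapIso X.assoc
  leftUnitor := (forgetHom _ _).mapIso X.leftUnitor
  rightUnitor := (forgetHom _ _).mapIso X.rightUnitor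
  braiding := (forgetHom _ _).mapIso X.braiding
  pentagon := by
    have h := congrArg (forgetHom _ _).map X.pentagon
    simp only [Functor.map_comp, forget_assocAt, forget_mulMap₂] at h

    exact h
  triangle := by
    have h := congrArg (forgetHom _ _).map X.triangle
    simp only [Functor.map_comp, forget_assocAt, forget_mulMap₂,
      forget_leftUnitorAt, forget_rightUnitorAt] at h
    exact h
  hexagon := by
    have h := congrArg (forgetHom _ _).map X.hexagon
    simp only [Functor.map_comp, forget_assocAt, forget_mulMap₂,
      forget_braidingAt] at h
    exact h
  symmetry := by
    have h := congrArg (forgetHom _ _).map X.symmetry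
    simp only [Functor.map_comp, forget_braidingAt] at h
    exact h

/-- The monoidal unit of a symmetric monoidal double category. -/
abbrev unitObj (D : SymmetricMonoidalObject DoubleCategory.{v, u}) : D.obj.Obj :=
  (DoubleFunctor.tight D.unit).obj PUnit.unit

/-- The tensor product of two objects of a symmetric monoidal double category. -/
abbrev tensorObj (D : SymmetricMonoidalObject DoubleCategory.{v, u}) (A B : D.obj.Obj) :
    D.obj.Obj :=
  (DoubleFunctor.tight D.mul).obj (A, B)

/-- The canonical tight isomorphism `1 ⊗ 1 ≅ 1`, the component of the left unitor at the unit. -/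
def unitIso (D : SymmetricMonoidalObject DoubleCategory.{v, u}) :
    D.tensorObj D.unitObj D.unitObj ≅ D.unitObj where
  hom := TightTransformation.app D.leftUnitor.hom D.unitObj
  inv := TightTransformation.app D.leftUnitor.inv D.unitObj
  hom_inv_id := congrFun (congrArg TightTransformation.app D.leftUnitor.hom_inv_id) D.unitObj
  inv_hom_id := congrFun (congrArg TightTransformation.app D.leftUnitor.inv_hom_id) D.unitObj

/-- The canonical isomorphism `1 ⊗ 1 ≅ 1`, regarded as the identity cell on it, is a conjoint
commuter. -/
def UnitIsConjointCommuter (D : SymmetricMonoidalObject DoubleCategory.{v, u}) : Prop :=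
  D.obj.IsConjointCommuter (D.obj.unitCell D.unitIso.hom)

/-- The point is the monoidal unit, and the comparison isomorphism from the monoidal unit to the
point is the identity. -/
def PointIsUnit (X : SymmetricMonoidalObject PointedDoubleCategory.{v, u}) : Prop :=
  ∃ h : X.forget.unitObj = X.obj.point, (PointedFunctor.pointIso X.unit).hom = eqToHom h

end SymmetricMonoidalObject

namespace CartesianObject

open PointedDoubleCategory

/-- The underlying cartesian double category of a cartesian object of pointed double categories. -/
def forget (X : CartesianObject PointedDoubleCategory.{v, u}) :
    CartesianObject DoubleCategory.{v, u} where
  obj := X.obj.double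
  mul := PointedFunctor.functor X.mul
  unit := PointedFunctor.functor X.unit
  mulAdj :=
    { unit := (forgetHom _ _).map X.mulAdj.unit
      counit := (forgetHom _ _).map X.mulAdj.counit
      left_triangle := by
        have h := congrArg (forgetHom _ _).map X.mulAdj.left_triangle
        rw [forget_leftZigzag, Functor.map_comp, forget_leftUnitor_hom, forget_rightUnitor_inv] at h
        exact h
      right_triangle := by
        have h := congrArg (forgetHom _ _).map X.mulAdj.right_triangle
        rw [forget_rightZigzag, Functor.map_comp, forget_rightUnitor_hom,
          forget_leftUnitor_inv] at h
        exact h }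
  unitAdj :=
    { unit := (forgetHom _ _).map X.unitAdj.unit
      counit := (forgetHom _ _).map X.unitAdj.counit
      left_triangle := by
        have h := congrArg (forgetHom _ _).map X.unitAdj.left_triangle
        rw [forget_leftZigzag, Functor.map_comp, forget_leftUnitor_hom, forget_rightUnitor_inv] at h
        exact h
      right_triangle := by
        have h := congrArg (forgetHom _ _).map X.unitAdj.right_triangle
        rw [forget_rightZigzag, Functor.map_comp, forget_rightUnitor_hom,
          forget_leftUnitor_inv] at h
        exact h }

/-- The terminal object of a cartesian double category. -/
abbrev unitObj (D : CartesianObject DoubleCategory.{v, u}) : D.obj.Obj :=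
  (DoubleFunctor.tight D.unit).obj PUnit.unit

/-- The product of two objects of a cartesian double category. -/
abbrev tensorObj (D : CartesianObject DoubleCategory.{v, u}) (A B : D.obj.Obj) : D.obj.Obj :=
  (DoubleFunctor.tight D.mul).obj (A, B)

/-- The unique tight arrow from an object to the terminal object. -/
def toUnit (D : CartesianObject DoubleCategory.{v, u}) (A : D.obj.Obj) : A ⟶ D.unitObj :=
  TightTransformation.app D.unitAdj.unit A

/-- The unique isomorphism `1 × 1 ⟶ 1`, regarded as the identity cell on it, is a conjoint
commuter. -/
def UnitIsConjointCommuter (D : CartesianObject DoubleCategory.{v, u}) : Prop :=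
  D.obj.IsConjointCommuter (D.obj.unitCell (D.toUnit (D.tensorObj D.unitObj D.unitObj)))

/-- The point is the terminal object, and the comparison isomorphism from the terminal object to
the point is the identity. -/
def PointIsUnit (X : CartesianObject PointedDoubleCategory.{v, u}) : Prop :=
  ∃ h : X.forget.unitObj = X.obj.point, (PointedFunctor.pointIso X.unit).hom = eqToHom h

end CartesianObject

/-! A tight isomorphism is a conjoint commuter exactly when it has a conjoint, and then the unit and
counit of the conjoint are invertible; this is the criterion `HasLift`, which is stable under
composition, double functors and products. The real work is therefore to see how much freedom the
points leave.

A 2-cell of pointed double categories is a 2-cell of double categories with a property, and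
forgetting points preserves the strict 2-categorical structure and the products. So a symmetric
monoidal object over a symmetric monoidal double category consists of a point p and comparisons 1 →
p and p ⊗ p → p, subject only to the condition that the structure 2-cells respect them. For the left
unitor this condition, combined with naturality, says that λ₁ : 1 ⊗ 1 → 1 corresponds to p ⊗ p → p
along 1 → p (`unitIso_comp_pointIso`). If 1 → p is the identity, the comparison of the
multiplication must be λ₁, so λ₁ is a conjoint commuter and the object is determined by its
underlying double category. Conversely, with λ₁ as comparison the remaining conditions are
identities of monoidal coherence: the associator condition is an instance of Mac Lane's theorem, the
right unitor needs λ₁ = ρ₁, and the braiding needs β₁₁ ≫ λ₁ = λ₁. Hence pointing by the unit inverts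
the forgetful map.

In the cartesian case 1 is terminal, so every compatibility is an equation between arrows into a
terminal object. The unit of the adjunction defining 1, being a pointed 2-cell, makes p terminal as
well, and this again forces the comparison of the multiplication.

For an arbitrary object, all maps from the terminal pointed double category into X are isomorphic to
the constant functor at the point (`pointUnitIso`): the tight component is the inverse comparison
and the cell is obtained from the unit constraint. Transporting the structure along this isomorphism
changes only the unit (`replaceUnit`), makes the comparison 1 → p an identity, and leaves the
underlying identity 1-cell as an equivalence. -/

/-! ### The tight category of a symmetric monoidal double category is symmetric monoidal. -/

open scoped MonoidalCategory in
-- Inverting the forward hexagon for E, A, B gives the reverse one, because symmetry turns each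
-- inverse braiding into a braiding.
theorem hexagon_reverse_of_symmetry {C : Type u} [Category.{v} C] [MonoidalCategory C]
    (b : ∀ A B : C, A ⊗ B ≅ B ⊗ A) (symm : ∀ A B : C, (b A B).hom = (b B A).inv)
    (hex : ∀ A B E : C, (α_ A B E).hom ≫ (b A (B ⊗ E)).hom ≫ (α_ B E A).hom =
      (b A B).hom ▷ E ≫ (α_ B A E).hom ≫ B ◁ (b A E).hom) (A B E : C) :
    (α_ A B E).inv ≫ (b (A ⊗ B) E).hom ≫ (α_ E A B).inv =
      A ◁ (b B E).hom ≫ (α_ A E B).inv ≫ (b A E).hom ▷ B := by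
  have key : α_ E A B ≪≫ b E (A ⊗ B) ≪≫ α_ A B E =
      MonoidalCategory.whiskerRightIso (b E A) B ≪≫ α_ A E B ≪≫
        MonoidalCategory.whiskerLeftIso A (b E B) := Iso.ext (hex E A B)
  simpa [symm] using congrArg Iso.inv key

namespace DoubleCategory

section Components

/-- The component of a 2-cell at an object. -/
def app {D E : DoubleCategory.{v, u}} {F G : D ⟶ E} (s : F ⟶ G) (A : D.Obj) :
    (DoubleFunctor.tight F).obj A ⟶ (DoubleFunctor.tight G).obj A :=
  TightTransformation.app s A

theorem app_congr {D E : DoubleCategory.{v, u}} {F G : D ⟶ E} {s t : F ⟶ G} (h : s = t)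
    (A : D.Obj) : app s A = app t A := by rw [h]

/-- Structure 2-cells at generalized elements are conjugated by `eqToHom`s that express strictness,
and these do not affect components. The equality is heterogeneous for general 1-cells; in the
applications below the two types unfold to the same hom-set, so `eq_of_heq` applies. -/
theorem app_conj {D E : DoubleCategory.{v, u}} {F F' G' G : D ⟶ E} (h : F = F') (s : F' ⟶ G')
    (k : G' = G) (A : D.Obj) : HEq (app (eqToHom h ≫ s ≫ eqToHom k) A) (app s A) := by
  cases h; cases k
  rw [eqToHom_refl, eqToHom_refl, Category.id_comp, Category.comp_id]

variable {X Z : DoubleCategory.{v, u}}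
  {mul : (prod X X : DoubleCategory.{v, u}) ⟶ X} {unit : (one : DoubleCategory.{v, u}) ⟶ X}

theorem app_assocAt (assoc : mulMap mul (mulMap mul (proj₁ X) (proj₂ X)) (proj₃ X) ≅
      mulMap mul (proj₁ X) (mulMap mul (proj₂ X) (proj₃ X))) (f g h : Z ⟶ X) (A : Z.Obj) :
    app (assocAt assoc f g h) A = app assoc.hom ((DoubleFunctor.tight f).obj A,
        (DoubleFunctor.tight g).obj A, (DoubleFunctor.tight h).obj A) :=
  eq_of_heq (app_conj _ _ _ A)

theorem app_leftUnitorAt (leftUnitor : mulMap mul (oneMap unit X) (𝟙 X) ≅ 𝟙 X) (f : Z ⟶ X)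
    (A : Z.Obj) :
    app (leftUnitorAt leftUnitor f) A = app leftUnitor.hom ((DoubleFunctor.tight f).obj A) :=
  eq_of_heq (app_conj _ _ _ A)

theorem app_rightUnitorAt (rightUnitor : mulMap mul (𝟙 X) (oneMap unit X) ≅ 𝟙 X) (f : Z ⟶ X)
    (A : Z.Obj) :
    app (rightUnitorAt rightUnitor f) A = app rightUnitor.hom ((DoubleFunctor.tight f).obj A) :=
  eq_of_heq (app_conj _ _ _ A)

theorem app_braidingAt
    (braiding : mulMap mul (fst X X) (snd X X) ≅ mulMap mul (snd X X) (fst X X))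
    (f g : Z ⟶ X) (A : Z.Obj) :
    app (braidingAt braiding f g) A =
      app braiding.hom ((DoubleFunctor.tight f).obj A, (DoubleFunctor.tight g).obj A) :=
  eq_of_heq (app_conj _ _ _ A)

end Components

/-- The component at an object of an invertible 2-cell. -/
def appIso {D E : DoubleCategory.{v, u}} {F G : D ⟶ E} (e : F ≅ G) (A : D.Obj) :
    (DoubleFunctor.tight F).obj A ≅ (DoubleFunctor.tight G).obj A where
  hom := TightTransformation.app e.hom A
  inv := TightTransformation.app e.inv A
  hom_inv_id := congrFun (congrArg TightTransformation.app e.hom_inv_id) A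
  inv_hom_id := congrFun (congrArg TightTransformation.app e.inv_hom_id) A

end DoubleCategory

namespace SymmetricMonoidalObject

open DoubleCategory

variable (D : SymmetricMonoidalObject DoubleCategory.{v, u})

/-- The tensor product, unit and structure isomorphisms on objects and tight arrows. -/
abbrev tightStruct : MonoidalCategoryStruct D.obj.Obj where
  tensorObj A B := D.tensorObj A B
  tensorHom {A A' B B'} f g :=
    (DoubleFunctor.tight D.mul).map (X := (A, B)) (Y := (A', B')) (f, g)
  whiskerLeft A B B' g :=
    (DoubleFunctor.tight D.mul).map (X := (A, B)) (Y := (A, B')) (𝟙 A, g)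
  whiskerRight {A A'} f B :=
    (DoubleFunctor.tight D.mul).map (X := (A, B)) (Y := (A', B)) (f, 𝟙 B)
  tensorUnit := D.unitObj
  associator A B C := appIso D.assoc (A, B, C)
  leftUnitor A := appIso D.leftUnitor A
  rightUnitor A := appIso D.rightUnitor A

/-- This is the pentagon of 2-cells evaluated at the object (A, B, C, E) of the fourth power, on
which the four projections take the values A, B, C and E by definition. The triangle, hexagon and
symmetry laws below are obtained in the same way. -/
theorem tight_pentagon (A B C E : D.obj.Obj) :
    letI := D.tightStruct
    MonoidalCategoryStruct.tensorHom (MonoidalCategoryStruct.associator A B C).hom (𝟙 E) ≫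
      (MonoidalCategoryStruct.associator A (D.tensorObj B C) E).hom ≫
      MonoidalCategoryStruct.tensorHom (𝟙 A) (MonoidalCategoryStruct.associator B C E).hom =
    (MonoidalCategoryStruct.associator (D.tensorObj A B) C E).hom ≫
      (MonoidalCategoryStruct.associator A B (D.tensorObj C E)).hom := by
  refine Eq.trans ?_ ((app_congr D.pentagon (A, B, C, E)).trans ?_)
  · exact congrArg₂ (· ≫ ·)
      (congrArg (fun t => (DoubleFunctor.tight D.mul).map (X := (_, _)) (Y := (_, _)) (t, 𝟙 E))
        (app_assocAt D.assoc (quad₁ _) (quad₂ _) (quad₃ _) (A, B, C, E)).symm)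
      (congrArg₂ (· ≫ ·)
        (app_assocAt D.assoc (quad₁ _) (mulMap D.mul (quad₂ _) (quad₃ _)) (quad₄ _)
          (A, B, C, E)).symm
        (congrArg (fun t => (DoubleFunctor.tight D.mul).map (X := (_, _)) (Y := (_, _)) (𝟙 A, t))
          (app_assocAt D.assoc (quad₂ _) (quad₃ _) (quad₄ _) (A, B, C, E)).symm))
  · exact congrArg₂ (· ≫ ·)
      (app_assocAt D.assoc (mulMap D.mul (quad₁ _) (quad₂ _)) (quad₃ _) (quad₄ _) (A, B, C, E))
      (app_assocAt D.assoc (quad₁ _) (quad₂ _) (mulMap D.mul (quad₃ _) (quad₄ _)) (A, B, C, E))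

theorem tight_triangle (A B : D.obj.Obj) :
    letI := D.tightStruct
    (MonoidalCategoryStruct.associator A D.unitObj B).hom ≫
      MonoidalCategoryStruct.tensorHom (𝟙 A) (MonoidalCategoryStruct.leftUnitor B).hom =
    MonoidalCategoryStruct.tensorHom (MonoidalCategoryStruct.rightUnitor A).hom (𝟙 B) := by
  refine Eq.trans ?_ ((app_congr D.triangle (A, B)).trans ?_)
  · exact congrArg₂ (· ≫ ·)
      (app_assocAt D.assoc (fst _ _) (oneMap D.unit _) (snd _ _) (A, B)).symm
      (congrArg (fun t => (DoubleFunctor.tight D.mul).map (X := (_, _)) (Y := (_, _)) (𝟙 A, t))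
        (app_leftUnitorAt D.leftUnitor (snd _ _) (A, B)).symm)
  · exact congrArg (fun t => (DoubleFunctor.tight D.mul).map (X := (_, _)) (Y := (_, _)) (t, 𝟙 B))
      (app_rightUnitorAt D.rightUnitor (fst _ _) (A, B))

/-- The tight category of a symmetric monoidal double category is monoidal. -/
abbrev tightMonoidal : MonoidalCategory D.obj.Obj :=
  letI := D.tightStruct
  MonoidalCategory.ofTensorHom
    (id_tensorHom_id := fun A B => (DoubleFunctor.tight D.mul).map_id (A, B))
    (id_tensorHom := fun _ _ _ _ => rfl)
    (tensorHom_id := fun _ _ => rfl)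
    (tensorHom_comp_tensorHom := fun f₁ f₂ g₁ g₂ =>
      ((DoubleFunctor.tight D.mul).map_comp (X := (_, _)) (Y := (_, _)) (Z := (_, _))
        (f₁, f₂) (g₁, g₂)).symm)
    (associator_naturality := fun {A₁ A₂ A₃ B₁ B₂ B₃} f g h =>
      TightTransformation.app_naturality D.assoc.hom (A := (A₁, A₂, A₃)) (B := (B₁, B₂, B₃))
        (f, g, h))
    (leftUnitor_naturality := fun f => by
      refine Eq.trans ?_ (TightTransformation.app_naturality D.leftUnitor.hom f)
      -- Naturality of the 2-cell has, in the unit slot, the image under `D.unit` of the identity of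
      -- the terminal double category; it is an identity only by `map_id`.
      refine congrArg (fun t => (DoubleFunctor.tight D.mul).map (X := (_, _)) (Y := (_, _))
        (t, f) ≫ _) ?_
      exact ((DoubleFunctor.tight D.unit).map_id _).symm)
    (rightUnitor_naturality := fun f => by
      refine Eq.trans ?_ (TightTransformation.app_naturality D.rightUnitor.hom f)
      refine congrArg (fun t => (DoubleFunctor.tight D.mul).map (X := (_, _)) (Y := (_, _))
        (f, t) ≫ _) ?_
      exact ((DoubleFunctor.tight D.unit).map_id _).symm)
    (pentagon := D.tight_pentagon)
    (triangle := D.tight_triangle)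

theorem tight_hexagon (A B C : D.obj.Obj) :
    letI := D.tightMonoidal
    (MonoidalCategoryStruct.associator A B C).hom ≫
      (appIso D.braiding (A, D.tensorObj B C)).hom ≫
      (MonoidalCategoryStruct.associator B C A).hom =
    MonoidalCategoryStruct.whiskerRight (appIso D.braiding (A, B)).hom C ≫
      (MonoidalCategoryStruct.associator B A C).hom ≫
      MonoidalCategoryStruct.whiskerLeft B (appIso D.braiding (A, C)).hom := by
  refine Eq.trans ?_ ((app_congr D.hexagon (A, B, C)).trans ?_)
  · exact congrArg₂ (· ≫ ·)
      (app_assocAt D.assoc (proj₁ _) (proj₂ _) (proj₃ _) (A, B, C)).symm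
      (congrArg₂ (· ≫ ·)
        (app_braidingAt D.braiding (proj₁ _) (mulMap D.mul (proj₂ _) (proj₃ _)) (A, B, C)).symm
        (app_assocAt D.assoc (proj₂ _) (proj₃ _) (proj₁ _) (A, B, C)).symm)
  · exact congrArg₂ (· ≫ ·)
      (congrArg (fun t => (DoubleFunctor.tight D.mul).map (X := (_, _)) (Y := (_, _)) (t, 𝟙 C))
        (app_braidingAt D.braiding (proj₁ _) (proj₂ _) (A, B, C)))
      (congrArg₂ (· ≫ ·)
        (app_assocAt D.assoc (proj₂ _) (proj₁ _) (proj₃ _) (A, B, C))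
        (congrArg (fun t => (DoubleFunctor.tight D.mul).map (X := (_, _)) (Y := (_, _)) (𝟙 B, t))
          (app_braidingAt D.braiding (proj₁ _) (proj₃ _) (A, B, C))))

theorem tight_symmetry (A B : D.obj.Obj) :
    (appIso D.braiding (A, B)).hom ≫ (appIso D.braiding (B, A)).hom = 𝟙 (D.tensorObj A B) := by
  refine Eq.trans ?_ (app_congr D.symmetry (A, B))
  exact congrArg₂ (· ≫ ·) (app_braidingAt D.braiding (fst _ _) (snd _ _) (A, B)).symm
    (app_braidingAt D.braiding (snd _ _) (fst _ _) (A, B)).symm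

/-- The tight category of a symmetric monoidal double category is braided. -/
abbrev tightBraided :
    letI := D.tightMonoidal
    BraidedCategory D.obj.Obj :=
  letI := D.tightMonoidal
  { braiding := fun A B => appIso D.braiding (A, B)
    braiding_naturality_right := fun A {B C} f =>
      TightTransformation.app_naturality D.braiding.hom (A := (A, B)) (B := (A, C)) (𝟙 A, f)
    braiding_naturality_left := fun {A B} f C =>
      TightTransformation.app_naturality D.braiding.hom (A := (A, C)) (B := (B, C)) (f, 𝟙 C)
    hexagon_forward := D.tight_hexagon
    hexagon_reverse := hexagon_reverse_of_symmetry (fun A B => appIso D.braiding (A, B))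
      (fun A B => (Iso.comp_hom_eq_id _).1 (D.tight_symmetry A B)) D.tight_hexagon }

theorem tight_unitors_equal :
    (appIso D.leftUnitor D.unitObj).hom = (appIso D.rightUnitor D.unitObj).hom :=
  letI := D.tightMonoidal
  MonoidalCategory.unitors_equal

/-- In a braided category the braiding carries the left unitor to the right one, and the two agree
at the unit. This is the condition for the braiding to respect the point. -/
theorem tight_braiding_unit :
    (appIso D.braiding (D.unitObj, D.unitObj)).hom ≫ (appIso D.leftUnitor D.unitObj).hom =
      (appIso D.leftUnitor D.unitObj).hom :=
  letI := D.tightMonoidal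
  letI := D.tightBraided
  (braiding_leftUnitor D.unitObj).trans D.tight_unitors_equal.symm

end SymmetricMonoidalObject

/-! ### Pointing a symmetric monoidal double category by its unit. -/

section

open scoped MonoidalCategory

namespace PointedDoubleCategory

open DoubleCategory

/-- An invertible 2-cell of double categories that is compatible with the comparisons at the point
is an invertible 2-cell of pointed double categories. -/
def isoMk {D E : PointedDoubleCategory.{v, u}} {F G : D ⟶ E}
    (e : (forgetHom D E).obj F ≅ (forgetHom D E).obj G)
    (h : (appIso e D.point).hom ≫ (PointedFunctor.pointIso G).hom =
      (PointedFunctor.pointIso F).hom) : F ≅ G where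
  hom := (⟨e.hom, h⟩ : PointedTransformation F G)
  inv := (⟨e.inv, by
    change (appIso e D.point).inv ≫ _ = _
    exact (Iso.inv_comp_eq (appIso e D.point)).2 h.symm⟩ : PointedTransformation G F)
  hom_inv_id := PointedTransformation.ext' e.hom_inv_id
  inv_hom_id := PointedTransformation.ext' e.inv_hom_id

/-- Compatibility with the point is a property of a 2-cell, so an equation between pointed 2-cells
may be checked after forgetting the points. -/
theorem forgetHom_map_injective {D E : PointedDoubleCategory.{v, u}} {F G : D ⟶ E} {s t : F ⟶ G}
    (h : (forgetHom D E).map s = (forgetHom D E).map t) : s = t :=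
  PointedTransformation.ext' h

end PointedDoubleCategory

namespace SymmetricMonoidalObject

open DoubleCategory PointedDoubleCategory

section Pointed

variable (D : SymmetricMonoidalObject DoubleCategory.{v, u}) (h : D.UnitIsConjointCommuter)

/-- A symmetric monoidal double category pointed by its unit. -/
abbrev pointedObj : PointedDoubleCategory.{v, u} := ⟨D.obj, D.unitObj⟩

/-- The multiplication, with the canonical comparison `1 ⊗ 1 ≅ 1`. -/
abbrev pointedMul : (prod D.pointedObj D.pointedObj : PointedDoubleCategory.{v, u}) ⟶ D.pointedObj :=
  (⟨D.mul, D.unitIso, h⟩ : PointedFunctor (D.pointedObj.product D.pointedObj) D.pointedObj)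

/-- The unit, with the identity as comparison. -/
abbrev pointedUnit : (one : PointedDoubleCategory.{v, u}) ⟶ D.pointedObj :=
  (⟨D.unit, Iso.refl _, (isConjointCommuter_unitCell_iff _).2 (hasLift_id _)⟩ :
    PointedFunctor PointedDoubleCategory.terminal D.pointedObj)

/-- The associator as a pointed 2-cell. -/
def pointedAssoc : mulMap (D.pointedMul h) (mulMap (D.pointedMul h) (proj₁ _) (proj₂ _)) (proj₃ _) ≅
    mulMap (D.pointedMul h) (proj₁ _) (mulMap (D.pointedMul h) (proj₂ _) (proj₃ _)) :=
  isoMk D.assoc (by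
    -- Compatibility at the point is an equation between two arrows (1 ⊗ 1) ⊗ 1 → 1 built from the
    -- associator, λ₁ and identities, hence an instance of monoidal coherence. The composites of
    -- identities are the comparisons of the projections, spelled out so that the equation matches
    -- the unfolded goal.
    let := D.tightMonoidal
    exact (by monoidal : (α_ (𝟙_ D.obj.Obj) (𝟙_ D.obj.Obj) (𝟙_ D.obj.Obj)).hom ≫
        (𝟙 (𝟙_ D.obj.Obj) ⊗ₘ (((𝟙 (𝟙_ D.obj.Obj) ≫ 𝟙 (𝟙_ D.obj.Obj)) ⊗ₘ
          (𝟙 (𝟙_ D.obj.Obj) ≫ 𝟙 (𝟙_ D.obj.Obj))) ≫ (λ_ (𝟙_ D.obj.Obj)).hom)) ≫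
          (λ_ (𝟙_ D.obj.Obj)).hom =
      (((𝟙 (𝟙_ D.obj.Obj) ⊗ₘ (𝟙 (𝟙_ D.obj.Obj) ≫ 𝟙 (𝟙_ D.obj.Obj))) ≫
        (λ_ (𝟙_ D.obj.Obj)).hom) ⊗ₘ (𝟙 (𝟙_ D.obj.Obj) ≫ 𝟙 (𝟙_ D.obj.Obj))) ≫
          (λ_ (𝟙_ D.obj.Obj)).hom))

/-- The comparison of a product of generalized elements is the tensor of their comparisons followed
by λ₁. In the unitors and the braiding the tensor factors are identities, so only λ₁ survives. -/
theorem map_comp_unitIso {s t : D.unitObj ⟶ D.unitObj} (hs : s = 𝟙 D.unitObj)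
    (ht : t = 𝟙 D.unitObj) :
    (DoubleFunctor.tight D.mul).map (X := (_, _)) (Y := (_, _)) (s, t) ≫ D.unitIso.hom =
      D.unitIso.hom := by
  subst hs ht
  exact (congrArg (· ≫ _) ((DoubleFunctor.tight D.mul).map_id (_, _))).trans (Category.id_comp _)

theorem unit_map_comp_id :
    (DoubleFunctor.tight D.unit).map (𝟙 _) ≫ 𝟙 D.unitObj = 𝟙 D.unitObj :=
  (Category.comp_id _).trans ((DoubleFunctor.tight D.unit).map_id _)

/-- The left unitor as a pointed 2-cell. -/
def pointedLeftUnitor : mulMap (D.pointedMul h) (oneMap D.pointedUnit _) (𝟙 _) ≅ 𝟙 _ :=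
  isoMk D.leftUnitor
    -- Both sides are λ₁, since `unitIso` is by definition the component of the left unitor at the
    -- unit.
    ((Category.comp_id _).trans (D.map_comp_unitIso D.unit_map_comp_id rfl).symm)

/-- The right unitor as a pointed 2-cell. -/
def pointedRightUnitor : mulMap (D.pointedMul h) (𝟙 _) (oneMap D.pointedUnit _) ≅ 𝟙 _ :=
  -- The left side is ρ₁ while the comparison of the multiplication is λ₁; the two coincide at the
  -- unit.
  isoMk D.rightUnitor ((Category.comp_id _).trans
    (D.tight_unitors_equal.symm.trans (D.map_comp_unitIso rfl D.unit_map_comp_id).symm))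

/-- The braiding as a pointed 2-cell. -/
def pointedBraiding : mulMap (D.pointedMul h) (fst _ _) (snd _ _) ≅
    mulMap (D.pointedMul h) (snd _ _) (fst _ _) :=
  isoMk D.braiding ((congrArg (_ ≫ ·) (D.map_comp_unitIso rfl rfl)).trans
    (D.tight_braiding_unit.trans (D.map_comp_unitIso rfl rfl).symm))

set_option maxHeartbeats 1000000 in
/-- A symmetric monoidal double category whose canonical isomorphism `1 ⊗ 1 ≅ 1` is a conjoint
commuter, as a symmetric monoidal object of pointed double categories. -/
def pointed : SymmetricMonoidalObject PointedDoubleCategory.{v, u} where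
  obj := D.pointedObj
  mul := D.pointedMul h
  unit := D.pointedUnit
  assoc := D.pointedAssoc h
  leftUnitor := D.pointedLeftUnitor h
  rightUnitor := D.pointedRightUnitor h
  braiding := D.pointedBraiding h
  pentagon := by
    -- Forgetting points commutes with the formation of structure 2-cells at generalized elements,
    -- so each law becomes the corresponding law of `D`.
    refine forgetHom_map_injective ?_
    simp only [Functor.map_comp, forget_assocAt, forget_mulMap₂]
    exact D.pentagon
  triangle := by
    refine forgetHom_map_injective ?_
    simp only [Functor.map_comp, forget_assocAt, forget_mulMap₂, forget_leftUnitorAt,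
      forget_rightUnitorAt]
    exact D.triangle
  hexagon := by
    refine forgetHom_map_injective ?_
    simp only [Functor.map_comp, forget_assocAt, forget_mulMap₂, forget_braidingAt]
    exact D.hexagon
  symmetry := by
    refine forgetHom_map_injective ?_
    simp only [Functor.map_comp, forget_braidingAt]
    exact D.symmetry

/-- Definitional, because pointing only attaches comparisons and proofs to the data of `D`. -/
theorem forget_pointed : (D.pointed h).forget = D := rfl

theorem pointed_pointIsUnit : (D.pointed h).PointIsUnit := ⟨rfl, rfl⟩

end Pointed

end SymmetricMonoidalObject

end

/-! ### The point and its comparisons are forced: bijectivity in the symmetric monoidal case. -/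

namespace PointedDoubleCategory

open DoubleCategory

/-- Once p and q are identified, `hij` reads i = j. Both objects are free variables so that the
equality can be eliminated, whereas the unit and the point of an actual object are not variables. -/
theorem isConjointCommuter_of_eqToHom {D : DoubleCategory.{v, u}} {p q : D.Obj} (h : p = q)
    {T : D.Obj × D.Obj ⥤ D.Obj} {i : T.obj (p, p) ⟶ p} {j : T.obj (q, q) ⟶ q}
    (hij : i ≫ eqToHom h = T.map (X := (_, _)) (Y := (_, _)) (eqToHom h, eqToHom h) ≫ j)
    (hj : D.IsConjointCommuter (D.unitCell j)) : D.IsConjointCommuter (D.unitCell i) := by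
  subst h
  obtain rfl : i = j := (Category.comp_id _).symm.trans
    (hij.trans ((congrArg (· ≫ j) (T.map_id _)).trans (Category.id_comp _)))
  exact hj

/-- Over a fixed double functor a pointed functor is determined by its comparison, and `hij`
identifies the comparisons once p = q. Before that the two 1-cells have different sources and
targets, whence the heterogeneous equality. -/
theorem pointedFunctor_heq_of_eqToHom {D : DoubleCategory.{v, u}} {p q : D.Obj} (h : p = q)
    {F : DoubleFunctor (D.product D) D} {i : F.tight.obj (p, p) ≅ p} {j : F.tight.obj (q, q) ≅ q}
    (hij : i.hom ≫ eqToHom h =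
      F.tight.map (X := (_, _)) (Y := (_, _)) (eqToHom h, eqToHom h) ≫ j.hom)
    (hi : D.IsConjointCommuter (D.unitCell i.hom)) (hj : D.IsConjointCommuter (D.unitCell j.hom)) :
    HEq (⟨F, i, hi⟩ : PointedFunctor (product ⟨D, p⟩ ⟨D, p⟩) ⟨D, p⟩)
      (⟨F, j, hj⟩ : PointedFunctor (product ⟨D, q⟩ ⟨D, q⟩) ⟨D, q⟩) := by
  subst h
  obtain rfl : i = j := Iso.ext ((Category.comp_id _).symm.trans
    (hij.trans ((congrArg (· ≫ j.hom) (F.tight.map_id _)).trans (Category.id_comp _))))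
  rfl

theorem pointedUnit_heq_of_eqToHom {D : DoubleCategory.{v, u}} {q : D.Obj}
    {F : DoubleFunctor terminal.double D} (h : F.tight.obj PUnit.unit = q)
    {j : F.tight.obj PUnit.unit ≅ q} (hj' : j.hom = eqToHom h)
    (hi : D.IsConjointCommuter (D.unitCell (𝟙 (F.tight.obj PUnit.unit))))
    (hj : D.IsConjointCommuter (D.unitCell j.hom)) :
    HEq (⟨F, Iso.refl _, hi⟩ : PointedFunctor terminal ⟨D, F.tight.obj PUnit.unit⟩)
      (⟨F, j, hj⟩ : PointedFunctor terminal ⟨D, q⟩) := by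
  subst h
  obtain rfl : j = Iso.refl _ := Iso.ext hj'
  rfl

end PointedDoubleCategory

namespace SymmetricMonoidalObject

open DoubleCategory PointedDoubleCategory

/-- `forget` loses exactly the point and the comparisons of the multiplication and the unit, which
the last three hypotheses restore. What remains are invertible 2-cells, on which forgetting is
injective, and laws, which are propositions. -/
theorem ext_of_forget {X Y : SymmetricMonoidalObject PointedDoubleCategory.{v, u}}
    (h : X.forget = Y.forget) (hobj : X.obj = Y.obj) (hmul : HEq X.mul Y.mul)
    (hunit : HEq X.unit Y.unit) : X = Y := by
  obtain ⟨X, mul, unit, assoc, leftUnitor, rightUnitor, braiding, _, _, _, _⟩ := X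
  obtain ⟨Y, mul', unit', assoc', leftUnitor', rightUnitor', braiding', _, _, _, _⟩ := Y
  obtain rfl : X = Y := hobj
  obtain rfl : mul = mul' := eq_of_heq hmul
  obtain rfl : unit = unit' := eq_of_heq hunit
  have inj : ∀ {D E : PointedDoubleCategory.{v, u}} {F G : D ⟶ E} {s t : F ≅ G},
      (forgetHom D E).mapIso s = (forgetHom D E).mapIso t → s = t := fun h =>
    Iso.ext (forgetHom_map_injective (congrArg Iso.hom h))
  injection h with _ _ _ h₁ h₂ h₃ h₄
  obtain rfl : assoc = assoc' := inj h₁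
  obtain rfl : leftUnitor = leftUnitor' := inj h₂
  obtain rfl : rightUnitor = rightUnitor' := inj h₃
  obtain rfl : braiding = braiding' := inj h₄
  rfl

/-- The comparison of the unit intertwines the canonical isomorphism `1 ⊗ 1 ≅ 1` and the comparison
of the multiplication. -/
theorem unitIso_comp_pointIso (X : SymmetricMonoidalObject PointedDoubleCategory.{v, u}) :
    X.forget.unitIso.hom ≫ (PointedFunctor.pointIso X.unit).hom =
      (DoubleFunctor.tight X.forget.mul).map (X := (_, _)) (Y := (_, _))
          ((PointedFunctor.pointIso X.unit).hom, (PointedFunctor.pointIso X.unit).hom) ≫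
        (PointedFunctor.pointIso X.mul).hom := by
  let e : X.forget.unitObj ⟶ X.obj.point := (PointedFunctor.pointIso X.unit).hom
  let M := DoubleFunctor.tight X.forget.mul
  -- Naturality of the left unitor along the comparison e : 1 → p.
  have e₁ : M.map (X := (_, _)) (Y := (_, _)) ((DoubleFunctor.tight X.forget.unit).map (𝟙 _), e) ≫
      (appIso X.forget.leftUnitor X.obj.point).hom = X.forget.unitIso.hom ≫ e :=
    TightTransformation.app_naturality X.forget.leftUnitor.hom e
  -- The left unitor is a pointed 2-cell. This condition is what determines the comparison of the
  -- multiplication.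
  have e₂ : (appIso X.forget.leftUnitor X.obj.point).hom ≫ 𝟙 X.obj.point =
      M.map (X := (_, _)) (Y := (_, _))
        ((DoubleFunctor.tight X.forget.unit).map (𝟙 _) ≫ e, 𝟙 X.obj.point) ≫
        (PointedFunctor.pointIso X.mul).hom :=
    PointedTransformation.app_point X.leftUnitor.hom
  -- Functoriality of ⊗: applying e first in the second variable and then in the first gives e ⊗ e.
  have e₃ : M.map (X := (_, _)) (Y := (_, _)) ((DoubleFunctor.tight X.forget.unit).map (𝟙 _), e) ≫
      M.map (X := (_, _)) (Y := (_, _))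
        ((DoubleFunctor.tight X.forget.unit).map (𝟙 _) ≫ e, 𝟙 X.obj.point) =
      M.map (X := (_, _)) (Y := (_, _)) (e, e) := by
    refine (M.map_comp (X := (_, _)) (Y := (_, _)) (Z := (_, _)) _ _).symm.trans
      (congrArg M.map (Prod.ext ?_ (Category.comp_id e)))
    have e₄ : (DoubleFunctor.tight X.forget.unit).map (𝟙 _) = 𝟙 X.forget.unitObj :=
      (DoubleFunctor.tight X.forget.unit).map_id _
    exact (congrArg (fun t => t ≫ t ≫ e) e₄).trans
      ((Category.id_comp _).trans (Category.id_comp _))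
  refine e₁.symm.trans ?_
  refine (congrArg (_ ≫ ·) ((Category.comp_id _).symm.trans e₂)).trans ?_
  exact (Category.assoc _ _ _).symm.trans (congrArg (· ≫ _) e₃)

/-- When 1 → p is the identity, `unitIso_comp_pointIso` identifies λ₁ with the comparison of the
multiplication, which is a conjoint commuter because the multiplication is a pointed functor. -/
theorem PointIsUnit.unitIsConjointCommuter
    {X : SymmetricMonoidalObject PointedDoubleCategory.{v, u}} (h : X.PointIsUnit) :
    X.forget.UnitIsConjointCommuter := by
  obtain ⟨h, h'⟩ := h
  have key := X.unitIso_comp_pointIso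
  rw [h'] at key
  exact isConjointCommuter_of_eqToHom h key (PointedFunctor.isConjointCommuter X.mul)

/-- The same identification shows that pointing the underlying double category by its unit recovers
the comparison of `X.mul`; the comparison of `X.unit` is the identity by assumption. -/
theorem PointIsUnit.pointed_forget
    {X : SymmetricMonoidalObject PointedDoubleCategory.{v, u}} (h : X.PointIsUnit) :
    X.forget.pointed h.unitIsConjointCommuter = X := by
  have hc := h.unitIsConjointCommuter
  obtain ⟨h, h'⟩ := h
  have key := X.unitIso_comp_pointIso
  rw [h'] at key
  exact ext_of_forget rfl (congrArg (PointedDoubleCategory.mk X.obj.double) h)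
    (pointedFunctor_heq_of_eqToHom h key hc (PointedFunctor.isConjointCommuter X.mul))
    (pointedUnit_heq_of_eqToHom h h' _ (PointedFunctor.isConjointCommuter X.unit))

/-- The inverse is `pointed`: `PointIsUnit.pointed_forget` gives injectivity and `forget_pointed`
gives surjectivity. -/
theorem forget_bijOn : Set.BijOn SymmetricMonoidalObject.forget.{v, u} {X | X.PointIsUnit}
    {D | D.UnitIsConjointCommuter} :=
  ⟨fun _ h => PointIsUnit.unitIsConjointCommuter h,
    fun X hX Y hY h => by
      rw [← PointIsUnit.pointed_forget hX, ← PointIsUnit.pointed_forget hY]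
      congr 1,
    fun D h => ⟨D.pointed h, D.pointed_pointIsUnit h, D.forget_pointed h⟩⟩

end SymmetricMonoidalObject

/-! ### Pointed 2-cells tested on loose arrows. -/

namespace CartesianTwoCategory

variable {K : Type u₁} [Bicategory.{w₁, v₁} K] [Bicategory.Strict K] [CartesianTwoCategory K]

/-- A 2-cell into a product is determined by its two projections, and these are compatible with
composition up to the `eqToHom`s of `lift₂_fst` and `lift₂_snd`, which cancel. -/
theorem lift₂_comp {Z A B : K} {f f' f'' : Z ⟶ A} {g g' g'' : Z ⟶ B} (s : f ⟶ f') (s' : f' ⟶ f'')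
    (t : g ⟶ g') (t' : g' ⟶ g'') : lift₂ (s ≫ s') (t ≫ t') = lift₂ s t ≫ lift₂ s' t' := by
  apply lift_ext <;> simp [lift₂_fst, lift₂_snd]

theorem lift₂_id {Z A B : K} (f : Z ⟶ A) (g : Z ⟶ B) : lift₂ (𝟙 f) (𝟙 g) = 𝟙 (lift f g) := by
  apply lift_ext <;> simp [lift₂_fst, lift₂_snd]

/-- The product of invertible 2-cells between generalized elements. -/
def mulMapIso {X : K} (mul : prod X X ⟶ X) {Z : K} {f f' g g' : Z ⟶ X} (s : f ≅ f')
    (t : g ≅ g') : mulMap mul f g ≅ mulMap mul f' g' where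
  hom := mulMap₂ mul s.hom t.hom
  inv := mulMap₂ mul s.inv t.inv
  hom_inv_id := by
    rw [mulMap₂, mulMap₂, ← comp_whiskerRight, ← lift₂_comp, s.hom_inv_id, t.hom_inv_id, lift₂_id,
      id_whiskerRight]
  inv_hom_id := by
    rw [mulMap₂, mulMap₂, ← comp_whiskerRight, ← lift₂_comp, s.inv_hom_id, t.inv_hom_id, lift₂_id,
      id_whiskerRight]

end CartesianTwoCategory

namespace PointedDoubleCategory

open DoubleCategory

/-- The component at a loose arrow of a 2-cell of pointed double categories. -/
def cellAt {D E : PointedDoubleCategory.{v, u}} {F G : D ⟶ E} (s : F ⟶ G) (m : D.double.Arrows) :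
    E.double.arrow ((PointedFunctor.functor F).loose m.arr) ⟶
      E.double.arrow ((PointedFunctor.functor G).loose m.arr) :=
  TightTransformation.cell ((forgetHom D E).map s) m

/-- The tight component at A is the left boundary of the cell at the loose identity of A, so the
cells alone determine a 2-cell. -/
theorem hom_ext {D E : PointedDoubleCategory.{v, u}} {F G : D ⟶ E} {s t : F ⟶ G}
    (h : ∀ m, cellAt s m = cellAt t m) : s = t := by
  refine PointedTransformation.ext' (TightTransformation.ext' (funext fun A => ?_) (funext h))
  exact (TightTransformation.left_cell _ (D.double.arrow (D.double.unit A))).symm.trans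
    ((congrArg E.double.left (h _)).trans
      (TightTransformation.left_cell _ (D.double.arrow (D.double.unit A))))

theorem cellAt_congr {D E : PointedDoubleCategory.{v, u}} {F G : D ⟶ E} {s t : F ⟶ G} (h : s = t)
    (m : D.double.Arrows) : cellAt s m = cellAt t m := by rw [h]

/-- The analogue of `app_conj` for cells: conjugation by strictness 2-cells leaves the cells
unchanged, so structure 2-cells at generalized elements can be evaluated on loose arrows. -/
theorem cellAt_conj {D E : PointedDoubleCategory.{v, u}} {F F' G' G : D ⟶ E} (h : F = F')
    (s : F' ⟶ G') (k : G' = G) (m : D.double.Arrows) :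
    HEq (cellAt (eqToHom h ≫ s ≫ eqToHom k) m) (cellAt s m) := by
  cases h; cases k
  rw [eqToHom_refl, eqToHom_refl, Category.id_comp, Category.comp_id]

theorem cellAt_eqToHom {D E : PointedDoubleCategory.{v, u}} {F G : D ⟶ E} (h : F = G)
    (m : D.double.Arrows) :
    HEq (cellAt (eqToHom h) m) (𝟙 (E.double.arrow ((PointedFunctor.functor F).loose m.arr))) := by
  cases h; rfl

section

variable {X Z : PointedDoubleCategory.{v, u}} (mul : (prod X X : PointedDoubleCategory.{v, u}) ⟶ X)

/-- The effect of a multiplication on loose arrows. -/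
abbrev mulArrow (a b : X.double.Arrows) : X.double.Arrows :=
  X.double.arrow ((PointedFunctor.functor mul).loose (A := (a.dom, b.dom)) (B := (a.cod, b.cod))
    (a.arr, b.arr))

/-- The effect of a multiplication on cells. -/
def mulCell {a a' b b' : X.double.Arrows} (s : a ⟶ a') (t : b ⟶ b') :
    mulArrow mul a b ⟶ mulArrow mul a' b' :=
  (PointedFunctor.functor mul).cell
    (m := (X.double.product X.double).arrow (A := (a.dom, b.dom)) (B := (a.cod, b.cod))
      (a.arr, b.arr))
    (n := (X.double.product X.double).arrow (A := (a'.dom, b'.dom)) (B := (a'.cod, b'.cod))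
      (a'.arr, b'.arr)) (s, t)

theorem mulCell_id (a b : X.double.Arrows) : mulCell mul (𝟙 a) (𝟙 b) = 𝟙 (mulArrow mul a b) :=
  (PointedFunctor.functor mul).cell_id ((X.double.product X.double).arrow (A := (a.dom, b.dom))
    (B := (a.cod, b.cod)) (a.arr, b.arr))

theorem mulCell_comp {a a' a'' b b' b'' : X.double.Arrows} (s : a ⟶ a') (s' : a' ⟶ a'')
    (t : b ⟶ b') (t' : b' ⟶ b'') :
    mulCell mul (s ≫ s') (t ≫ t') = mulCell mul s t ≫ mulCell mul s' t' :=
  (PointedFunctor.functor mul).cell_comp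
    (m := (X.double.product X.double).arrow (A := (a.dom, b.dom)) (B := (a.cod, b.cod))
      (a.arr, b.arr))
    (n := (X.double.product X.double).arrow (A := (a'.dom, b'.dom)) (B := (a'.cod, b'.cod))
      (a'.arr, b'.arr))
    (p := (X.double.product X.double).arrow (A := (a''.dom, b''.dom)) (B := (a''.cod, b''.cod))
      (a''.arr, b''.arr)) (s, t) (s', t')

theorem mulCell_id_comp (a : X.double.Arrows) {b b' b'' : X.double.Arrows} (t : b ⟶ b')
    (t' : b' ⟶ b'') :
    mulCell mul (𝟙 a) (t ≫ t') = mulCell mul (𝟙 a) t ≫ mulCell mul (𝟙 a) t' := by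
  rw [← mulCell_comp, Category.comp_id]

theorem mulCell_comp_id {a a' a'' : X.double.Arrows} (s : a ⟶ a') (s' : a' ⟶ a'')
    (b : X.double.Arrows) :
    mulCell mul (s ≫ s') (𝟙 b) = mulCell mul s (𝟙 b) ≫ mulCell mul s' (𝟙 b) := by
  rw [← mulCell_comp, Category.comp_id]

/-- The loose arrow of a product with given components. -/
abbrev pairArrow (a b : X.double.Arrows) :
    (prod X X : PointedDoubleCategory.{v, u}).double.Arrows :=
  (X.double.product X.double).arrow (A := (a.dom, b.dom)) (B := (a.cod, b.cod)) (a.arr, b.arr)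

/-- The loose arrow of a triple product with given components. -/
abbrev tripleArrow (a b c : X.double.Arrows) :
    (prod X (prod X X) : PointedDoubleCategory.{v, u}).double.Arrows :=
  (X.double.product (X.double.product X.double)).arrow (A := (a.dom, b.dom, c.dom))
    (B := (a.cod, b.cod, c.cod)) (a.arr, b.arr, c.arr)

/-- The image of a loose arrow under a generalized element. -/
abbrev looseAt (f : Z ⟶ X) (m : Z.double.Arrows) : X.double.Arrows :=
  X.double.arrow ((PointedFunctor.functor f).loose m.arr)

variable {mul} {unit : (one : PointedDoubleCategory.{v, u}) ⟶ X}

theorem cellAt_assocAt (assoc : mulMap mul (mulMap mul (proj₁ X) (proj₂ X)) (proj₃ X) ≅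
      mulMap mul (proj₁ X) (mulMap mul (proj₂ X) (proj₃ X))) (f g h : Z ⟶ X)
    (m : Z.double.Arrows) :
    cellAt (assocAt assoc f g h) m =
      cellAt assoc.hom (tripleArrow (looseAt f m) (looseAt g m) (looseAt h m)) :=
  eq_of_heq (cellAt_conj _ _ _ m)

theorem cellAt_leftUnitorAt (leftUnitor : mulMap mul (oneMap unit X) (𝟙 X) ≅ 𝟙 X) (f : Z ⟶ X)
    (m : Z.double.Arrows) :
    cellAt (leftUnitorAt leftUnitor f) m = cellAt leftUnitor.hom (looseAt f m) :=
  eq_of_heq (cellAt_conj _ _ _ m)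

theorem cellAt_rightUnitorAt (rightUnitor : mulMap mul (𝟙 X) (oneMap unit X) ≅ 𝟙 X) (f : Z ⟶ X)
    (m : Z.double.Arrows) :
    cellAt (rightUnitorAt rightUnitor f) m = cellAt rightUnitor.hom (looseAt f m) :=
  eq_of_heq (cellAt_conj _ _ _ m)

theorem cellAt_braidingAt
    (braiding : mulMap mul (fst X X) (snd X X) ≅ mulMap mul (snd X X) (fst X X)) (f g : Z ⟶ X)
    (m : Z.double.Arrows) :
    cellAt (braidingAt braiding f g) m =
      cellAt braiding.hom (pairArrow (looseAt f m) (looseAt g m)) :=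
  eq_of_heq (cellAt_conj _ _ _ m)

/-- The loose arrow of the terminal double category. -/
abbrev oneArrow : (one : PointedDoubleCategory.{v, u}).double.Arrows :=
  DoubleCategory.terminal.arrow (A := PUnit.unit) (B := PUnit.unit) PUnit.unit

/-- The middle variable is where the unit stands in the triangle law; this naturality lets an
isomorphism of units pass through the associator. -/
theorem assoc_naturality_middle (assoc : mulMap mul (mulMap mul (proj₁ X) (proj₂ X)) (proj₃ X) ≅
      mulMap mul (proj₁ X) (mulMap mul (proj₂ X) (proj₃ X))) {a b b' c : X.double.Arrows}
    (s : b ⟶ b') :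
    mulCell mul (mulCell mul (𝟙 a) s) (𝟙 c) ≫ cellAt assoc.hom (tripleArrow a b' c) =
      cellAt assoc.hom (tripleArrow a b c) ≫ mulCell mul (𝟙 a) (mulCell mul s (𝟙 c)) :=
  TightTransformation.cell_naturality ((forgetHom _ _).map assoc.hom) (m := tripleArrow a b c)
    (n := tripleArrow a b' c) (𝟙 a, s, 𝟙 c)

end

end PointedDoubleCategory

/-! ### Transporting the structure along an isomorphism of units. -/

namespace SymmetricMonoidalObject

open DoubleCategory PointedDoubleCategory

section ReplaceUnit

variable (X : SymmetricMonoidalObject PointedDoubleCategory.{v, u})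
  {unit : (one : PointedDoubleCategory.{v, u}) ⟶ X.obj} (e : unit ≅ X.unit)

/-- The left unitor of a symmetric monoidal object whose unit is replaced by an isomorphic one. -/
def replaceLeftUnitor : mulMap X.mul (oneMap unit X.obj) (𝟙 X.obj) ≅ 𝟙 X.obj :=
  mulMapIso X.mul (whiskerLeftIso (toOne X.obj) e) (Iso.refl _) ≪≫ X.leftUnitor

/-- The right unitor of a symmetric monoidal object whose unit is replaced by an isomorphic one. -/
def replaceRightUnitor : mulMap X.mul (𝟙 X.obj) (oneMap unit X.obj) ≅ 𝟙 X.obj :=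
  mulMapIso X.mul (Iso.refl _) (whiskerLeftIso (toOne X.obj) e) ≪≫ X.rightUnitor

theorem cell_triangle (a b : X.obj.double.Arrows) :
    cellAt X.assoc.hom (tripleArrow a (looseAt X.unit oneArrow) b) ≫
        mulCell X.mul (𝟙 a) (cellAt X.leftUnitor.hom b) =
      mulCell X.mul (cellAt X.rightUnitor.hom a) (𝟙 b) := by
  let m : (prod X.obj X.obj).double.Arrows := pairArrow a b
  refine Eq.trans ?_ ((cellAt_congr X.triangle m).trans ?_)
  · exact congrArg₂ (· ≫ ·) (cellAt_assocAt X.assoc (fst _ _) (oneMap X.unit _) (snd _ _) m).symm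
      (congrArg (mulCell X.mul (𝟙 a)) (cellAt_leftUnitorAt X.leftUnitor (snd _ _) m).symm)
  · exact congrArg (fun t => mulCell X.mul t (𝟙 b))
      (cellAt_rightUnitorAt X.rightUnitor (fst _ _) m)

/-- Each new unitor is e in the unit slot followed by the old unitor. Functoriality of the
multiplication splits off e on both sides, naturality of the associator in the middle variable
matches the two copies, and the old triangle remains. -/
theorem cell_triangle_replace (a b : X.obj.double.Arrows) :
    cellAt X.assoc.hom (tripleArrow a (looseAt unit oneArrow) b) ≫
        mulCell X.mul (𝟙 a) (cellAt (X.replaceLeftUnitor e).hom b) =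
      mulCell X.mul (cellAt (X.replaceRightUnitor e).hom a) (𝟙 b) := by
  have h₁ : mulCell X.mul (𝟙 a) (cellAt (X.replaceLeftUnitor e).hom b) =
      mulCell X.mul (𝟙 a) (mulCell X.mul (cellAt e.hom oneArrow) (𝟙 b)) ≫
        mulCell X.mul (𝟙 a) (cellAt X.leftUnitor.hom b) :=
    mulCell_id_comp _ _ _ _
  have h₂ : mulCell X.mul (cellAt (X.replaceRightUnitor e).hom a) (𝟙 b) =
      mulCell X.mul (mulCell X.mul (𝟙 a) (cellAt e.hom oneArrow)) (𝟙 b) ≫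
        mulCell X.mul (cellAt X.rightUnitor.hom a) (𝟙 b) :=
    mulCell_comp_id _ _ _ _
  refine (congrArg (_ ≫ ·) h₁).trans (Eq.trans ?_ h₂.symm)
  refine (Category.assoc _ _ _).symm.trans ?_
  refine (congrArg (· ≫ _) (assoc_naturality_middle X.assoc (cellAt e.hom oneArrow)).symm).trans ?_
  refine (Category.assoc _ _ _).trans (congrArg (_ ≫ ·) (X.cell_triangle a b))

/-- The symmetric monoidal object obtained by replacing the unit by an isomorphic one. -/
def replaceUnit : SymmetricMonoidalObject PointedDoubleCategory.{v, u} where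
  obj := X.obj
  mul := X.mul
  unit := unit
  assoc := X.assoc
  leftUnitor := X.replaceLeftUnitor e
  rightUnitor := X.replaceRightUnitor e
  braiding := X.braiding
  pentagon := X.pentagon
  -- This is the only law of the four in which the unit occurs.
  triangle := hom_ext fun m => by
    refine Eq.trans ?_ ((X.cell_triangle_replace e (looseAt (fst _ _) m) (looseAt (snd _ _) m)).trans
      ?_)
    · exact congrArg₂ (· ≫ ·) (cellAt_assocAt X.assoc (fst _ _) (oneMap unit _) (snd _ _) m)
        (congrArg (mulCell X.mul (𝟙 _))
          (cellAt_leftUnitorAt (X.replaceLeftUnitor e) (snd _ _) m))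
    · exact congrArg (fun t => mulCell X.mul t (𝟙 _))
        (cellAt_rightUnitorAt (X.replaceRightUnitor e) (fst _ _) m).symm
  hexagon := X.hexagon
  symmetry := X.symmetry

/-- Whiskering and `lift₂` preserve identities, so nothing changes. This lets `X` itself be treated
as a replacement, and one comparison `replaceHom` serves in both directions. -/
theorem replaceUnit_refl : X.replaceUnit (Iso.refl X.unit) = X := by
  obtain ⟨obj, mul, unit, assoc, leftUnitor, rightUnitor, braiding, _, _, _, _⟩ := X
  have hl : mulMapIso mul (whiskerLeftIso (toOne obj) (Iso.refl unit)) (Iso.refl (𝟙 obj)) ≪≫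
      leftUnitor = leftUnitor := by
    ext
    simp [mulMapIso, mulMap₂, lift₂_id]
  have hr : mulMapIso mul (Iso.refl (𝟙 obj)) (whiskerLeftIso (toOne obj) (Iso.refl unit)) ≪≫
      rightUnitor = rightUnitor := by
    ext
    simp [mulMapIso, mulMap₂, lift₂_id]
  simp only [replaceUnit, replaceLeftUnitor, replaceRightUnitor]
  congr 1

end ReplaceUnit

section

variable (X : SymmetricMonoidalObject PointedDoubleCategory.{v, u})
  {unit₁ unit₂ : (one : PointedDoubleCategory.{v, u}) ⟶ X.obj} (e₁ : unit₁ ≅ X.unit)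
  (e₂ : unit₂ ≅ X.unit)

/-- The identity as a morphism between the objects obtained by replacing the unit. -/
def replaceHom : PreHom (X.replaceUnit e₁) (X.replaceUnit e₂) where
  map := 𝟙 X.obj
  mapMul := (PreHom.id X).mapMul
  -- The comparison of a morphism goes from the unit of the target to the image of the unit of the
  -- source, hence from `unit₂` to `unit₁`.
  mapUnit := e₂ ≪≫ e₁.symm ≪≫ eqToIso (Bicategory.Strict.comp_id unit₁).symm

theorem PreHom.cellAt_mapMulAt {X Y : SymmetricMonoidalObject PointedDoubleCategory.{v, u}}
    (F : PreHom X Y) {Z : PointedDoubleCategory.{v, u}} (a b : Z ⟶ X.obj) (m : Z.double.Arrows) :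
    cellAt (F.mapMulAt a b) m =
      cellAt F.mapMul.hom (pairArrow (looseAt a m) (looseAt b m)) :=
  eq_of_heq (cellAt_conj _ (lift a b ◁ F.mapMul.hom) _ m)

theorem PreHom.cellAt_mapUnitAt {X Y : SymmetricMonoidalObject PointedDoubleCategory.{v, u}}
    (F : PreHom X Y) {Z : PointedDoubleCategory.{v, u}} (m : Z.double.Arrows) :
    cellAt (F.mapUnitAt Z) m = cellAt F.mapUnit.hom oneArrow := by
  -- `mapUnitAt` has a strictness 2-cell only on the right; a trivial one is inserted on the left to
  -- match `cellAt_conj`.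
  have h := cellAt_conj rfl (toOne Z ◁ F.mapUnit.hom)
    (Bicategory.Strict.assoc (toOne Z) X.unit F.map).symm m
  rw [eqToHom_refl, Category.id_comp] at h
  exact eq_of_heq h

theorem cellAt_mapMul (m : (prod X.obj X.obj).double.Arrows) :
    cellAt (X.replaceHom e₁ e₂).mapMul.hom m =
      𝟙 (looseAt X.mul m) :=
  eq_of_heq (cellAt_eqToHom (show mulMap X.mul (fst X.obj X.obj ≫ 𝟙 X.obj)
    (snd X.obj X.obj ≫ 𝟙 X.obj) = X.mul ≫ 𝟙 X.obj by
      rw [Bicategory.Strict.comp_id, Bicategory.Strict.comp_id, Bicategory.Strict.comp_id, mulMap,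
        show lift (fst X.obj X.obj) (snd X.obj X.obj) = 𝟙 _ by
          rw [lift_unique (𝟙 (prod X.obj X.obj)), Bicategory.Strict.id_comp,
            Bicategory.Strict.id_comp], Bicategory.Strict.id_comp]) m)

theorem cellAt_mapUnit :
    cellAt (X.replaceHom e₁ e₂).mapUnit.hom oneArrow =
      cellAt e₂.hom oneArrow ≫ cellAt e₁.inv oneArrow :=
  congrArg (_ ≫ ·) ((congrArg (_ ≫ ·) (eq_of_heq (cellAt_eqToHom
    (Bicategory.Strict.comp_id unit₁).symm oneArrow))).trans (Category.comp_id _))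

/-- The inverse of e₁ cancels against e₁. This is what the unit laws of `replaceHom` come down to,
as the new unitors begin with e₁ and e₂. -/
theorem cellAt_mapUnit_comp :
    cellAt (X.replaceHom e₁ e₂).mapUnit.hom oneArrow ≫ cellAt e₁.hom oneArrow =
      cellAt e₂.hom oneArrow := by
  have h : cellAt e₁.inv oneArrow ≫ cellAt e₁.hom oneArrow = 𝟙 _ :=
    cellAt_congr e₁.inv_hom_id oneArrow
  exact (congrArg (· ≫ _) (X.cellAt_mapUnit e₁ e₂)).trans ((Category.assoc _ _ _).trans
    ((congrArg (_ ≫ ·) h).trans (Category.comp_id _)))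

theorem cellAt_mapUnit_comp_mapUnit :
    cellAt (X.replaceHom e₂ e₁).mapUnit.hom oneArrow ≫
      cellAt (X.replaceHom e₁ e₂).mapUnit.hom oneArrow = 𝟙 (looseAt unit₁ oneArrow) := by
  have h : cellAt e₁.hom oneArrow ≫ cellAt e₁.inv oneArrow = 𝟙 _ :=
    cellAt_congr e₁.hom_inv_id oneArrow
  refine (congrArg (_ ≫ ·) (X.cellAt_mapUnit e₁ e₂)).trans ?_
  refine (Category.assoc _ _ _).symm.trans (Eq.trans ?_ h)
  exact congrArg (· ≫ _) (X.cellAt_mapUnit_comp e₂ e₁)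

end

end SymmetricMonoidalObject

/-! ### The identity 1-cell is a pseudo-morphism between the transported objects. -/

section

variable {C : Type u} [Category.{v} C]

/-- This lemma and the next three cancel morphisms known to be identities only by a proof. They are
stated in an arbitrary category so that they can be matched with cells up to unfolding of
definitions. -/
theorem comp_comp_eq_right_of_eq_id {a b : C} {f g : a ⟶ a}
    {h : a ⟶ b} (hf : f = 𝟙 a) (hg : g = 𝟙 a) : f ≫ g ≫ h = h := by
  rw [hf, hg, Category.id_comp, Category.id_comp]

theorem comp_comp_eq_left_of_eq_id {a b : C} {h : a ⟶ b}
    {f g : b ⟶ b} (hf : f = 𝟙 b) (hg : g = 𝟙 b) : h ≫ f ≫ g = h := by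
  rw [hf, hg, Category.comp_id, Category.comp_id]

theorem comp_comp_eq_of_eq_id {a b c d : C} {f : a ⟶ b} {g : b ⟶ b}
    {h : b ⟶ c} {k : c ⟶ d} {f' : a ⟶ c} (hg : g = 𝟙 b) (hf : f ≫ h = f') :
    f ≫ g ≫ h ≫ k = f' ≫ k := by
  rw [hg, Category.id_comp, ← Category.assoc, hf]

theorem comp_eq_of_three_ids {a b c : C} {f : a ⟶ a} {g : b ⟶ b}
    {h : c ⟶ c} {s : a ⟶ b} {t : b ⟶ c} (hf : f = 𝟙 a) (hg : g = 𝟙 b) (hh : h = 𝟙 c) :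
    f ≫ s ≫ g ≫ t ≫ h = s ≫ t := by
  rw [hf, hg, hh, Category.id_comp, Category.id_comp, Category.comp_id]

end

namespace SymmetricMonoidalObject

open DoubleCategory PointedDoubleCategory

/-- By `hom_ext` each coherence law can be tested on a loose arrow of a power of `X.obj`; the
projections are then replaced by arbitrary loose arrows and the strictness 2-cells disappear. -/
theorem PreHom.isPseudoMorphism_of_cells {X Y : SymmetricMonoidalObject PointedDoubleCategory.{v, u}}
    (F : PreHom X Y)
    (h₁ : ∀ a b c : X.obj.double.Arrows,
      mulCell Y.mul (cellAt F.mapMul.hom (pairArrow a b)) (𝟙 (looseAt F.map c)) ≫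
        cellAt F.mapMul.hom (pairArrow (mulArrow X.mul a b) c) ≫
        (PointedFunctor.functor F.map).cell (cellAt X.assoc.hom (tripleArrow a b c)) =
      cellAt Y.assoc.hom (tripleArrow (looseAt F.map a) (looseAt F.map b) (looseAt F.map c)) ≫
        mulCell Y.mul (𝟙 (looseAt F.map a)) (cellAt F.mapMul.hom (pairArrow b c)) ≫
        cellAt F.mapMul.hom (pairArrow a (mulArrow X.mul b c)))
    (h₂ : ∀ m : X.obj.double.Arrows,
      mulCell Y.mul (cellAt F.mapUnit.hom oneArrow) (𝟙 (looseAt F.map m)) ≫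
        cellAt F.mapMul.hom (pairArrow (looseAt X.unit oneArrow) m) ≫
          (PointedFunctor.functor F.map).cell (cellAt X.leftUnitor.hom m) =
      cellAt Y.leftUnitor.hom (looseAt F.map m))
    (h₃ : ∀ m : X.obj.double.Arrows,
      mulCell Y.mul (𝟙 (looseAt F.map m)) (cellAt F.mapUnit.hom oneArrow) ≫
        cellAt F.mapMul.hom (pairArrow m (looseAt X.unit oneArrow)) ≫
          (PointedFunctor.functor F.map).cell (cellAt X.rightUnitor.hom m) =
      cellAt Y.rightUnitor.hom (looseAt F.map m))
    (h₄ : ∀ a b : X.obj.double.Arrows,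
      cellAt F.mapMul.hom (pairArrow a b) ≫
        (PointedFunctor.functor F.map).cell (cellAt X.braiding.hom (pairArrow a b)) =
      cellAt Y.braiding.hom (pairArrow (looseAt F.map a) (looseAt F.map b)) ≫
        cellAt F.mapMul.hom (pairArrow b a)) :
    F.IsPseudoMorphism where
  map_assoc := hom_ext fun m => by
    let a := looseAt (proj₁ X.obj) m
    let b := looseAt (proj₂ X.obj) m
    let c := looseAt (proj₃ X.obj) m
    refine Eq.trans ?_ ((h₁ a b c).trans ?_)
    · exact congrArg₂ (· ≫ ·) (congrArg (fun t => mulCell Y.mul t (𝟙 (looseAt F.map c)))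
        (F.cellAt_mapMulAt (proj₁ X.obj) (proj₂ X.obj) m))
        (congrArg₂ (· ≫ ·) (F.cellAt_mapMulAt (mulMap X.mul (proj₁ X.obj) (proj₂ X.obj))
          (proj₃ X.obj) m) (congrArg (fun t => (PointedFunctor.functor F.map).cell t)
            (cellAt_assocAt X.assoc (proj₁ X.obj) (proj₂ X.obj) (proj₃ X.obj) m)))
    · exact (congrArg₂ (· ≫ ·) (cellAt_assocAt Y.assoc (proj₁ X.obj ≫ F.map)
        (proj₂ X.obj ≫ F.map) (proj₃ X.obj ≫ F.map) m)
        (congrArg₂ (· ≫ ·) (congrArg (fun t => mulCell Y.mul (𝟙 (looseAt F.map a)) t)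
          (F.cellAt_mapMulAt (proj₂ X.obj) (proj₃ X.obj) m))
          (F.cellAt_mapMulAt (proj₁ X.obj) (mulMap X.mul (proj₂ X.obj) (proj₃ X.obj)) m))).symm
  map_leftUnitor := hom_ext fun m => by
    refine Eq.trans ?_ ((h₂ m).trans
      (cellAt_leftUnitorAt Y.leftUnitor (𝟙 X.obj ≫ F.map) m).symm)
    exact congrArg₂ (· ≫ ·) (congrArg (fun t => mulCell Y.mul t (𝟙 (looseAt F.map m)))
      (F.cellAt_mapUnitAt m)) (congrArg (fun t => t ≫ (PointedFunctor.functor F.map).cell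
        (cellAt X.leftUnitor.hom m)) (F.cellAt_mapMulAt (oneMap X.unit X.obj) (𝟙 X.obj) m))
  map_rightUnitor := hom_ext fun m => by
    refine Eq.trans ?_ ((h₃ m).trans
      (cellAt_rightUnitorAt Y.rightUnitor (𝟙 X.obj ≫ F.map) m).symm)
    exact congrArg₂ (· ≫ ·) (congrArg (fun t => mulCell Y.mul (𝟙 (looseAt F.map m)) t)
      (F.cellAt_mapUnitAt m)) (congrArg (fun t => t ≫ (PointedFunctor.functor F.map).cell
        (cellAt X.rightUnitor.hom m)) (F.cellAt_mapMulAt (𝟙 X.obj) (oneMap X.unit X.obj) m))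
  map_braiding := hom_ext fun m => by
    let a := looseAt (fst X.obj X.obj) m
    let b := looseAt (snd X.obj X.obj) m
    refine Eq.trans ?_ ((h₄ a b).trans ?_)
    · exact congrArg₂ (· ≫ ·) (F.cellAt_mapMulAt (fst X.obj X.obj) (snd X.obj X.obj) m)
        (congrArg (fun t => (PointedFunctor.functor F.map).cell t)
          (cellAt_braidingAt X.braiding (fst X.obj X.obj) (snd X.obj X.obj) m))
    · exact (congrArg₂ (· ≫ ·) (cellAt_braidingAt Y.braiding (fst X.obj X.obj ≫ F.map)
        (snd X.obj X.obj ≫ F.map) m)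
          (F.cellAt_mapMulAt (snd X.obj X.obj) (fst X.obj X.obj) m)).symm

variable (X : SymmetricMonoidalObject PointedDoubleCategory.{v, u})
  {unit₁ unit₂ : (one : PointedDoubleCategory.{v, u}) ⟶ X.obj} (e₁ : unit₁ ≅ X.unit)
  (e₂ : unit₂ ≅ X.unit)

/-- All comparison cells for the multiplication are identities, so both sides reduce to the cell of
the associator. -/
theorem replaceHom_cell_assoc (a b c : X.obj.double.Arrows) :
    mulCell X.mul (cellAt (X.replaceHom e₁ e₂).mapMul.hom (pairArrow a b)) (𝟙 c) ≫
        cellAt (X.replaceHom e₁ e₂).mapMul.hom (pairArrow (mulArrow X.mul a b) c) ≫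
        cellAt X.assoc.hom (tripleArrow a b c) =
      cellAt X.assoc.hom (tripleArrow a b c) ≫
        mulCell X.mul (𝟙 a) (cellAt (X.replaceHom e₁ e₂).mapMul.hom (pairArrow b c)) ≫
        cellAt (X.replaceHom e₁ e₂).mapMul.hom (pairArrow a (mulArrow X.mul b c)) := by
  have h₁ : mulCell X.mul (cellAt (X.replaceHom e₁ e₂).mapMul.hom (pairArrow a b)) (𝟙 c) =
      𝟙 (mulArrow X.mul (mulArrow X.mul a b) c) :=
    (congrArg (fun t => mulCell X.mul t (𝟙 c)) (X.cellAt_mapMul e₁ e₂ (pairArrow a b))).trans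
      (mulCell_id X.mul _ _)
  have h₂ : mulCell X.mul (𝟙 a) (cellAt (X.replaceHom e₁ e₂).mapMul.hom (pairArrow b c)) =
      𝟙 (mulArrow X.mul a (mulArrow X.mul b c)) :=
    (congrArg (fun t => mulCell X.mul (𝟙 a) t) (X.cellAt_mapMul e₁ e₂ (pairArrow b c))).trans
      (mulCell_id X.mul _ _)
  exact (comp_comp_eq_right_of_eq_id h₁
    (X.cellAt_mapMul e₁ e₂ (pairArrow (mulArrow X.mul a b) c))).trans
      (comp_comp_eq_left_of_eq_id h₂
        (X.cellAt_mapMul e₁ e₂ (pairArrow a (mulArrow X.mul b c)))).symm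

/-- The unit comparison followed by the e₁ inside the source's unitor is e₂, which with the old left
unitor is the target's unitor. -/
theorem replaceHom_cell_leftUnitor (m : X.obj.double.Arrows) :
    mulCell X.mul (cellAt (X.replaceHom e₁ e₂).mapUnit.hom oneArrow) (𝟙 m) ≫
        cellAt (X.replaceHom e₁ e₂).mapMul.hom (pairArrow (looseAt unit₁ oneArrow) m) ≫
          cellAt (X.replaceLeftUnitor e₁).hom m =
      cellAt (X.replaceLeftUnitor e₂).hom m := by
  have h : mulCell X.mul (cellAt (X.replaceHom e₁ e₂).mapUnit.hom oneArrow) (𝟙 m) ≫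
      mulCell X.mul (cellAt e₁.hom oneArrow) (𝟙 m) =
        mulCell X.mul (cellAt e₂.hom oneArrow) (𝟙 m) :=
    (mulCell_comp_id _ _ _ _).symm.trans
      (congrArg (fun t => mulCell X.mul t (𝟙 m)) (X.cellAt_mapUnit_comp e₁ e₂))
  exact comp_comp_eq_of_eq_id
    (X.cellAt_mapMul e₁ e₂ (pairArrow (looseAt unit₁ oneArrow) m)) h

theorem replaceHom_cell_rightUnitor (m : X.obj.double.Arrows) :
    mulCell X.mul (𝟙 m) (cellAt (X.replaceHom e₁ e₂).mapUnit.hom oneArrow) ≫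
        cellAt (X.replaceHom e₁ e₂).mapMul.hom (pairArrow m (looseAt unit₁ oneArrow)) ≫
          cellAt (X.replaceRightUnitor e₁).hom m =
      cellAt (X.replaceRightUnitor e₂).hom m := by
  have h : mulCell X.mul (𝟙 m) (cellAt (X.replaceHom e₁ e₂).mapUnit.hom oneArrow) ≫
      mulCell X.mul (𝟙 m) (cellAt e₁.hom oneArrow) =
        mulCell X.mul (𝟙 m) (cellAt e₂.hom oneArrow) :=
    (mulCell_id_comp _ _ _ _).symm.trans
      (congrArg (fun t => mulCell X.mul (𝟙 m) t) (X.cellAt_mapUnit_comp e₁ e₂))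
  exact comp_comp_eq_of_eq_id
    (X.cellAt_mapMul e₁ e₂ (pairArrow m (looseAt unit₁ oneArrow))) h

theorem replaceHom_cell_braiding (a b : X.obj.double.Arrows) :
    cellAt (X.replaceHom e₁ e₂).mapMul.hom (pairArrow a b) ≫
        cellAt X.braiding.hom (pairArrow a b) =
      cellAt X.braiding.hom (pairArrow a b) ≫
        cellAt (X.replaceHom e₁ e₂).mapMul.hom (pairArrow b a) :=
  ((congrArg (fun t => t ≫ cellAt X.braiding.hom (pairArrow a b))
    (X.cellAt_mapMul e₁ e₂ (pairArrow a b))).trans (Category.id_comp _)).trans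
  ((congrArg (fun t => cellAt X.braiding.hom (pairArrow a b) ≫ t)
    (X.cellAt_mapMul e₁ e₂ (pairArrow b a))).trans (Category.comp_id _)).symm

theorem replaceHom_isPseudoMorphism : (X.replaceHom e₁ e₂).IsPseudoMorphism :=
  PreHom.isPseudoMorphism_of_cells _ (X.replaceHom_cell_assoc e₁ e₂)
    (X.replaceHom_cell_leftUnitor e₁ e₂) (X.replaceHom_cell_rightUnitor e₁ e₂)
    (X.replaceHom_cell_braiding e₁ e₂)

end SymmetricMonoidalObject

/-! ### Changing the unit gives an equivalent symmetric monoidal object. -/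

namespace SymmetricMonoidalObject

open DoubleCategory PointedDoubleCategory

namespace PreHom

variable {X Y W : SymmetricMonoidalObject PointedDoubleCategory.{v, u}}

/-- The pasted comparison contains three strictness 2-cells, each with identity cells; removing them
leaves the comparison of G followed by the image under G of that of F. -/
theorem cellAt_comp_mapMul (F : PreHom X Y) (G : PreHom Y W) (a b : X.obj.double.Arrows) :
    cellAt (F.comp G).mapMul.hom (pairArrow a b) =
      cellAt G.mapMul.hom (pairArrow (looseAt F.map a) (looseAt F.map b)) ≫
        (PointedFunctor.functor G.map).cell (cellAt F.mapMul.hom (pairArrow a b)) :=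
  comp_eq_of_three_ids (eq_of_heq (cellAt_eqToHom _ (pairArrow a b)))
    (eq_of_heq (cellAt_eqToHom _ (pairArrow a b))) (eq_of_heq (cellAt_eqToHom _ (pairArrow a b)))

theorem cellAt_comp_mapUnit (F : PreHom X Y) (G : PreHom Y W) :
    cellAt (F.comp G).mapUnit.hom oneArrow =
      cellAt G.mapUnit.hom oneArrow ≫
        (PointedFunctor.functor G.map).cell (cellAt F.mapUnit.hom oneArrow) :=
  congrArg (fun t => cellAt G.mapUnit.hom oneArrow ≫ t)
    ((congrArg (fun t => (PointedFunctor.functor G.map).cell (cellAt F.mapUnit.hom oneArrow) ≫ t)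
      (eq_of_heq (cellAt_eqToHom _ oneArrow))).trans (Category.comp_id _))

theorem isMonoidal_of_cells {F G : PreHom X Y} (s : F.map ⟶ G.map)
    (h₁ : ∀ a b : X.obj.double.Arrows,
      cellAt F.mapMul.hom (pairArrow a b) ≫ cellAt s (mulArrow X.mul a b) =
        mulCell Y.mul (cellAt s a) (cellAt s b) ≫ cellAt G.mapMul.hom (pairArrow a b))
    (h₂ : cellAt F.mapUnit.hom oneArrow ≫ cellAt s (looseAt X.unit oneArrow) =
      cellAt G.mapUnit.hom oneArrow) : IsMonoidal s where
  mul := hom_ext fun m => by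
    let a := looseAt (fst X.obj X.obj) m
    let b := looseAt (snd X.obj X.obj) m
    refine Eq.trans ?_ ((h₁ a b).trans ?_)
    · exact congrArg (fun t => t ≫ cellAt s (mulArrow X.mul a b))
        (F.cellAt_mapMulAt (fst X.obj X.obj) (snd X.obj X.obj) m)
    · exact congrArg (fun t => mulCell Y.mul (cellAt s a) (cellAt s b) ≫ t)
        (G.cellAt_mapMulAt (fst X.obj X.obj) (snd X.obj X.obj) m).symm
  -- The terminal double category has a single loose arrow.
  unit := hom_ext fun _ => h₂

end PreHom

variable (X : SymmetricMonoidalObject PointedDoubleCategory.{v, u})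
  {unit₁ unit₂ : (one : PointedDoubleCategory.{v, u}) ⟶ X.obj} (e₁ : unit₁ ≅ X.unit)
  (e₂ : unit₂ ≅ X.unit)

/-- The identity 2-cell from the composite of the identities to the identity. -/
abbrev idCompId : ((X.replaceHom e₁ e₂).comp (X.replaceHom e₂ e₁)).map ⟶
    (PreHom.id (X.replaceUnit e₁)).map :=
  eqToHom (Bicategory.Strict.comp_id (𝟙 X.obj))

theorem cellAt_idCompId (m : X.obj.double.Arrows) : cellAt (X.idCompId e₁ e₂) m = 𝟙 m :=
  eq_of_heq (cellAt_eqToHom _ m)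

theorem idCompId_mul (a b : X.obj.double.Arrows) :
    cellAt ((X.replaceHom e₁ e₂).comp (X.replaceHom e₂ e₁)).mapMul.hom (pairArrow a b) ≫
        cellAt (X.idCompId e₁ e₂) (mulArrow X.mul a b) =
      mulCell X.mul (cellAt (X.idCompId e₁ e₂) a) (cellAt (X.idCompId e₁ e₂) b) ≫
        cellAt (PreHom.id (X.replaceUnit e₁)).mapMul.hom (pairArrow a b) := by
  have h₁ : cellAt ((X.replaceHom e₁ e₂).comp (X.replaceHom e₂ e₁)).mapMul.hom (pairArrow a b) =
      𝟙 (mulArrow X.mul a b) :=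
    (PreHom.cellAt_comp_mapMul (X.replaceHom e₁ e₂) (X.replaceHom e₂ e₁) a b).trans
      ((congrArg₂ (fun (s t : mulArrow X.mul a b ⟶ mulArrow X.mul a b) => s ≫ t)
        (X.cellAt_mapMul e₂ e₁ (pairArrow a b)) (X.cellAt_mapMul e₁ e₂ (pairArrow a b))).trans
        (Category.id_comp _))
  have h₂ : mulCell X.mul (cellAt (X.idCompId e₁ e₂) a) (cellAt (X.idCompId e₁ e₂) b) =
      𝟙 (mulArrow X.mul a b) :=
    (congrArg₂ (mulCell X.mul) (X.cellAt_idCompId e₁ e₂ a) (X.cellAt_idCompId e₁ e₂ b)).trans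
      (mulCell_id X.mul a b)
  -- The multiplication comparison of `replaceHom` is that of the identity morphism by definition,
  -- so `cellAt_mapMul` applies here too.
  have h₃ : cellAt (PreHom.id (X.replaceUnit e₁)).mapMul.hom (pairArrow a b) =
      𝟙 (mulArrow X.mul a b) :=
    X.cellAt_mapMul e₁ e₂ (pairArrow a b)
  exact (congrArg₂ (fun (s t : mulArrow X.mul a b ⟶ mulArrow X.mul a b) => s ≫ t) h₁
    (X.cellAt_idCompId e₁ e₂ _)).trans
    (congrArg₂ (fun (s t : mulArrow X.mul a b ⟶ mulArrow X.mul a b) => s ≫ t) h₂ h₃).symm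

theorem idCompId_unit :
    cellAt ((X.replaceHom e₁ e₂).comp (X.replaceHom e₂ e₁)).mapUnit.hom oneArrow ≫
        cellAt (X.idCompId e₁ e₂) (looseAt unit₁ oneArrow) =
      cellAt (PreHom.id (X.replaceUnit e₁)).mapUnit.hom oneArrow := by
  have h₁ : cellAt ((X.replaceHom e₁ e₂).comp (X.replaceHom e₂ e₁)).mapUnit.hom oneArrow =
      𝟙 (looseAt unit₁ oneArrow) :=
    (PreHom.cellAt_comp_mapUnit (X.replaceHom e₁ e₂) (X.replaceHom e₂ e₁)).trans
      (X.cellAt_mapUnit_comp_mapUnit e₁ e₂)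
  have h₂ : cellAt (PreHom.id (X.replaceUnit e₁)).mapUnit.hom oneArrow =
      𝟙 (looseAt unit₁ oneArrow) :=
    eq_of_heq (cellAt_eqToHom (Bicategory.Strict.comp_id unit₁).symm oneArrow)
  exact ((congrArg₂ (fun (s t : looseAt unit₁ oneArrow ⟶ looseAt unit₁ oneArrow) => s ≫ t) h₁
    (X.cellAt_idCompId e₁ e₂ _)).trans (Category.id_comp _)).trans h₂.symm

theorem replaceHom_comp_isMonoidal :
    PreHom.IsMonoidal (F := (X.replaceHom e₁ e₂).comp (X.replaceHom e₂ e₁))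
      (G := PreHom.id (X.replaceUnit e₁)) (X.idCompId e₁ e₂) :=
  PreHom.isMonoidal_of_cells _ (X.idCompId_mul e₁ e₂) (X.idCompId_unit e₁ e₂)

/-- `X` is its own replacement along the identity, and the statements about `replaceHom` are
symmetric in e₁ and e₂, so each is used once in each order. -/
theorem equivalent_replaceUnit : X.Equivalent (X.replaceUnit e₂) := by
  have : (X.replaceUnit (Iso.refl X.unit)).Equivalent (X.replaceUnit e₂) :=
    ⟨X.replaceHom _ _, X.replaceHom _ _, eqToIso (Bicategory.Strict.comp_id (𝟙 X.obj)),
      eqToIso (Bicategory.Strict.comp_id (𝟙 X.obj)),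
      X.replaceHom_isPseudoMorphism _ _,
      X.replaceHom_isPseudoMorphism _ _, X.replaceHom_comp_isMonoidal _ _,
      X.replaceHom_comp_isMonoidal _ _⟩
  rwa [replaceUnit_refl] at this

end SymmetricMonoidalObject

/-! ### Double functors out of the terminal double category are constant up to isomorphism. -/

namespace TightTransformation

open DoubleCategory

variable {D E : DoubleCategory.{v, u}}

/-- A tight transformation whose components are invertible is invertible. -/
def isoOfComponents {F G : DoubleFunctor D E} (s : TightTransformation F G)
    (a : ∀ A, F.tight.obj A ≅ G.tight.obj A)
    (c : ∀ m : D.Arrows, E.arrow (F.loose m.arr) ≅ E.arrow (G.loose m.arr))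
    (ha : ∀ A, (a A).hom = s.app A) (hc : ∀ m, (c m).hom = s.cell m) : F ≅ G where
  hom := s
  inv :=
    { app := fun A => (a A).inv
      cell := fun m => (c m).inv
      left_cell := fun m => by
        have h : E.left (c m).hom ≫ E.left (c m).inv = 𝟙 _ := by
          rw [← E.left_comp, (c m).hom_inv_id, E.left_id]
        rw [hc m, s.left_cell] at h
        rw [Iso.eq_inv_comp (a m.dom) |>.2 ((congrArg (· ≫ _) (ha m.dom)).trans h)]
        exact Category.comp_id _
      right_cell := fun m => by
        have h : E.right (c m).hom ≫ E.right (c m).inv = 𝟙 _ := by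
          rw [← E.right_comp, (c m).hom_inv_id, E.right_id]
        rw [hc m, s.right_cell] at h
        rw [Iso.eq_inv_comp (a m.cod) |>.2 ((congrArg (· ≫ _) (ha m.cod)).trans h)]
        exact Category.comp_id _
      app_naturality := fun f => by
        rw [Iso.comp_inv_eq, Category.assoc, Iso.eq_inv_comp, ha, ha, s.app_naturality]
      cell_naturality := fun φ => by
        rw [Iso.comp_inv_eq, Category.assoc, Iso.eq_inv_comp, hc, hc, s.cell_naturality]
      -- The compatibility square is inverted by means of `hcompIso`: the loose composite of the
      -- inverse cells is inverse to that of the cells.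
      cell_comp := fun {A B C} m n => by
        have h : E.right (c (D.arrow m)).hom = E.left (c (D.arrow n)).hom := by
          rw [hc, hc, s.right_cell, s.left_cell]
        have h' : (F.mapComp m n).hom ≫ (c (D.arrow (D.comp m n))).hom =
            E.hcomp (c (D.arrow m)).hom (c (D.arrow n)).hom h ≫ (G.mapComp m n).hom :=
          (congrArg (fun t => (F.mapComp m n).hom ≫ t) (hc _)).trans ((s.cell_comp m n).trans
            (congrArg (fun t => t ≫ (G.mapComp m n).hom)
              (E.hcomp_congr (hc (D.arrow m)).symm (hc (D.arrow n)).symm _)))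
        rw [Iso.comp_inv_eq, Category.assoc, h', ← Category.assoc]
        exact ((congrArg (· ≫ _) (E.hcompIso (c (D.arrow m)) (c (D.arrow n)) h).inv_hom_id).trans
          (Category.id_comp _)).symm
      cell_unit := fun A => by
        have h := s.cell_unit A
        rw [← hc, ← ha] at h
        rw [Iso.comp_inv_eq, Category.assoc, h, ← Category.assoc]
        exact ((congrArg (· ≫ _) (unitCellIso (a A)).inv_hom_id).trans (Category.id_comp _)).symm }
  hom_inv_id := TightTransformation.ext'
    (funext fun A => (congrArg (· ≫ _) (ha A).symm).trans (a A).hom_inv_id)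
    (funext fun m => (congrArg (· ≫ _) (hc m).symm).trans (c m).hom_inv_id)
  inv_hom_id := TightTransformation.ext'
    (funext fun A => (congrArg (_ ≫ ·) (ha A).symm).trans (a A).inv_hom_id)
    (funext fun m => (congrArg (_ ≫ ·) (hc m).symm).trans (c m).inv_hom_id)

end TightTransformation

namespace DoubleFunctor

open DoubleCategory

variable {D : DoubleCategory.{v, u}}

/-- The double functor from the terminal double category that picks out an object. -/
def const (p : D.Obj) : DoubleFunctor DoubleCategory.terminal.{v, u} D where
  tight := { obj := fun _ => p, map := fun _ => 𝟙 p }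
  loose _ := D.unit p
  cell _ := 𝟙 _
  left_cell _ := D.left_id _
  right_cell _ := D.right_id _
  cell_id _ := rfl
  cell_comp _ _ := (Category.comp_id _).symm
  mapComp _ _ := D.leftUnitor (D.unit p)
  mapUnit _ := Iso.refl _
  left_mapComp _ _ := D.left_leftUnitor _
  right_mapComp _ _ := D.right_leftUnitor _
  left_mapUnit _ := D.left_id _
  right_mapUnit _ := D.right_id _
  mapComp_naturality _ _ _ :=
    (congrArg (· ≫ _) (D.hcomp_id (D.unit p) (D.unit p))).trans
      ((Category.id_comp _).trans (Category.comp_id _).symm)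
  mapUnit_naturality _ := congrArg (· ≫ 𝟙 _) (D.unitCell_id p)
  map_assoc _ _ _ := by
    -- With the left unitor of the loose identity as composition constraint, associativity is the
    -- triangle law at (id, id) once the left and right unitors there are identified.
    have h := D.triangle (D.unit p) (D.unit p)
    have h' := D.hcomp_congr (D.leftUnitor_unit p) (rfl : 𝟙 (D.arrow (D.unit p)) = _)
      ((D.right_leftUnitor _).trans (D.left_id (D.arrow (D.unit p))).symm)
    refine (congrArg (_ ≫ ·) (Category.comp_id _)).trans ?_
    refine Eq.trans ?_ (Category.assoc _ _ _)
    exact congrArg (· ≫ (D.leftUnitor (D.unit p)).hom) (h'.trans h.symm)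
  map_leftUnitor _ :=
    (congrArg (· ≫ _) (D.hcomp_id (D.unit p) (D.unit p))).trans
      ((Category.id_comp _).trans (Category.comp_id _))
  map_rightUnitor _ :=
    (congrArg (· ≫ _) (D.hcomp_id (D.unit p) (D.unit p))).trans
      ((Category.id_comp _).trans ((Category.comp_id _).trans (D.leftUnitor_unit p)))

/-- Let u be the unit constraint. By interchange u ⊙ u is id ⊙ u followed by u ⊙ id. The left unit
law of F turns the second factor followed by the composition constraint into a left unitor, because
the unitor of the terminal double category goes to an identity. Naturality of the left unitor along
u then finishes. -/
theorem mapUnit_hcomp_mapUnit (F : DoubleFunctor DoubleCategory.terminal.{v, u} D) :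
    D.hcomp (F.mapUnit PUnit.unit).hom (F.mapUnit PUnit.unit).hom
        ((F.right_mapUnit _).trans (F.left_mapUnit _).symm) ≫
        (F.mapComp (A := PUnit.unit) (B := PUnit.unit) (C := PUnit.unit) PUnit.unit PUnit.unit).hom =
      (D.leftUnitor (D.unit (F.tight.obj PUnit.unit))).hom ≫ (F.mapUnit PUnit.unit).hom := by
  let u : D.arrow (D.unit (F.tight.obj PUnit.unit)) ⟶
    D.arrow (F.loose (A := PUnit.unit) (B := PUnit.unit) PUnit.unit) := (F.mapUnit PUnit.unit).hom
  have hl : D.left u = 𝟙 _ := F.left_mapUnit _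
  have hr : D.right u = 𝟙 _ := F.right_mapUnit _
  have h₁ : D.hcomp u u (hr.trans hl.symm) =
      D.hcomp (D.unitCell (D.left u)) u (D.right_unitCell _) ≫
        D.hcomp u (𝟙 (D.arrow (F.loose (A := PUnit.unit) (B := PUnit.unit) PUnit.unit)))
          (hr.trans (D.left_id (D.arrow (F.loose (A := PUnit.unit) (B := PUnit.unit)
            PUnit.unit))).symm) := by
    rw [← D.hcomp_comp]
    refine D.hcomp_congr ?_ (Category.comp_id _).symm _
    rw [hl]
    exact ((congrArg (· ≫ _) (D.unitCell_id _)).trans (Category.id_comp _)).symm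
  have h₂ := F.map_leftUnitor (A := PUnit.unit) (B := PUnit.unit) PUnit.unit
  have h₃ : F.cell (DoubleCategory.terminal.leftUnitor (A := PUnit.unit) (B := PUnit.unit)
      PUnit.unit).hom = 𝟙 _ :=
    F.cell_id (DoubleCategory.terminal.arrow (A := PUnit.unit) (B := PUnit.unit) PUnit.unit)
  refine (congrArg (· ≫ _) h₁).trans ((Category.assoc _ _ _).trans ?_)
  refine Eq.trans (congrArg (_ ≫ ·) ?_) (D.leftUnitor_naturality u)
  exact ((congrArg (fun t => _ ≫ _ ≫ t) h₃).trans
    (congrArg (_ ≫ ·) (Category.comp_id _))).symm.trans h₂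

/-- This is the compatibility of `constIso` with loose composition: interchange separates the
identity cells on e from the unit constraints, and each layer passes through the left unitor. -/
theorem leftUnitor_comp_mapUnit (F : DoubleFunctor DoubleCategory.terminal.{v, u} D) {p : D.Obj}
    (e : p ⟶ F.tight.obj PUnit.unit)
    (h : D.right (D.unitCell e ≫ (F.mapUnit PUnit.unit).hom) =
      D.left (D.unitCell e ≫ (F.mapUnit PUnit.unit).hom)) :
    (D.leftUnitor (D.unit p)).hom ≫ D.unitCell e ≫ (F.mapUnit PUnit.unit).hom =
      D.hcomp (D.unitCell e ≫ (F.mapUnit PUnit.unit).hom)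
          (D.unitCell e ≫ (F.mapUnit PUnit.unit).hom) h ≫
        (F.mapComp (A := PUnit.unit) (B := PUnit.unit) (C := PUnit.unit) PUnit.unit
          PUnit.unit).hom := by
  have h₁ := D.hcomp_comp (D.unitCell e) (D.unitCell e)
    ((D.right_unitCell e).trans (D.left_unitCell e).symm) (F.mapUnit PUnit.unit).hom
    (F.mapUnit PUnit.unit).hom ((F.right_mapUnit _).trans (F.left_mapUnit _).symm)
  have h₂ : D.hcomp (D.unitCell e) (D.unitCell e)
      ((D.right_unitCell e).trans (D.left_unitCell e).symm) ≫
      (D.leftUnitor (D.unit (F.tight.obj PUnit.unit))).hom =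
        (D.leftUnitor (D.unit p)).hom ≫ D.unitCell e := by
    rw [← D.leftUnitor_naturality (D.unitCell e)]
    exact congrArg (· ≫ _) (D.hcomp_congr (congrArg D.unitCell (D.left_unitCell e).symm) rfl _)
  refine Eq.trans ?_ (congrArg (· ≫ _) h₁).symm
  refine Eq.trans ?_ (Category.assoc _ _ _).symm
  refine Eq.trans ?_ (congrArg (_ ≫ ·) F.mapUnit_hcomp_mapUnit).symm
  exact (Category.assoc _ _ _).symm.trans
    ((congrArg (· ≫ _) h₂.symm).trans (Category.assoc _ _ _))

/-- A double functor from the terminal double category is determined by its value. -/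
def constIso (F : DoubleFunctor DoubleCategory.terminal.{v, u} D) {p : D.Obj}
    (e : p ≅ F.tight.obj PUnit.unit) : const p ≅ F :=
  TightTransformation.isoOfComponents
    { app := fun _ => e.hom
      -- Forced by `cell_unit`, since the unit constraint of the constant functor is the identity.
      cell := fun _ => D.unitCell e.hom ≫ (F.mapUnit PUnit.unit).hom
      left_cell := fun _ => (D.left_comp _ _).trans
        ((congrArg₂ (· ≫ ·) (D.left_unitCell e.hom) (F.left_mapUnit PUnit.unit)).trans
          (Category.comp_id _))
      right_cell := fun _ => (D.right_comp _ _).trans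
        ((congrArg₂ (· ≫ ·) (D.right_unitCell e.hom) (F.right_mapUnit PUnit.unit)).trans
          (Category.comp_id _))
      app_naturality := fun _ => (Category.id_comp _).trans
        ((congrArg (_ ≫ ·) (F.tight.map_id PUnit.unit)).trans (Category.comp_id _)).symm
      cell_naturality := fun _ => (Category.id_comp _).trans
        ((congrArg (_ ≫ ·) (F.cell_id
          (DoubleCategory.terminal.arrow (A := PUnit.unit) (B := PUnit.unit) PUnit.unit))).trans
          (Category.comp_id _)).symm
      cell_comp := fun _ _ => F.leftUnitor_comp_mapUnit e.hom _
      cell_unit := fun _ => Category.id_comp _ }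
    (fun _ => e) (fun _ => unitCellIso e ≪≫ F.mapUnit PUnit.unit) (fun _ => rfl) (fun _ => rfl)

end DoubleFunctor

namespace PointedDoubleCategory

open DoubleCategory

/-- The pointed double functor that picks out the point. -/
def pointUnit (X : PointedDoubleCategory.{v, u}) : (one : PointedDoubleCategory.{v, u}) ⟶ X :=
  (⟨DoubleFunctor.const X.point, Iso.refl _, (isConjointCommuter_unitCell_iff _).2 (hasLift_id _)⟩ :
    PointedFunctor terminal X)

/-- The point is isomorphic to any other map from the terminal pointed double category. -/
def pointUnitIso {X : PointedDoubleCategory.{v, u}}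
    (unit : (one : PointedDoubleCategory.{v, u}) ⟶ X) : X.pointUnit ≅ unit :=
  -- The comparison of `unit` goes from its value to the point, so its inverse is the required tight
  -- component.
  isoMk (DoubleFunctor.constIso (PointedFunctor.functor unit) (PointedFunctor.pointIso unit).symm)
    (PointedFunctor.pointIso unit).inv_hom_id

end PointedDoubleCategory

namespace SymmetricMonoidalObject

open PointedDoubleCategory

/-- The constant functor at the point takes the point as its value, with the identity as comparison,
so it serves as the new unit. -/
theorem exists_pointIsUnit (X : SymmetricMonoidalObject PointedDoubleCategory.{v, u}) :
    ∃ Y : SymmetricMonoidalObject PointedDoubleCategory.{v, u}, Y.PointIsUnit ∧ X.Equivalent Y :=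
  ⟨X.replaceUnit (pointUnitIso X.unit), ⟨rfl, rfl⟩, X.equivalent_replaceUnit _⟩

end SymmetricMonoidalObject

/-! ### Cartesian double categories: components of the adjunctions, terminality and pointing. -/

namespace DoubleCategory

section AdjunctionComponents

variable {D E : DoubleCategory.{v, u}} {f : D ⟶ E} {g : E ⟶ D} (adj : f ⊣ g)

theorem app_eqToHom {F G : D ⟶ E} (h : F = G) (A : D.Obj) :
    HEq (app (eqToHom h) A) (𝟙 ((DoubleFunctor.tight F).obj A)) := by
  cases h; rfl

/-- The associator and unitors of a strict 2-category have identity components, so the right zigzag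
evaluates to the usual triangle identity on objects. -/
theorem app_right_triangle (B : E.Obj) :
    app adj.unit ((DoubleFunctor.tight g).obj B) ≫
        (DoubleFunctor.tight g).map (app adj.counit B) =
      𝟙 ((DoubleFunctor.tight g).obj B) := by
  have h := app_congr ((PointedDoubleCategory.rightZigzag_eq adj.unit adj.counit).symm.trans
    adj.right_triangle) B
  have h₁ : app (α_ g f g).inv B = 𝟙 _ :=
    eq_of_heq (app_eqToHom (Bicategory.Strict.assoc g f g).symm B)
  have h₂ : app (ρ_ g).hom B = 𝟙 _ := eq_of_heq (app_eqToHom (Bicategory.Strict.comp_id g) B)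
  have h₃ : app (λ_ g).inv B = 𝟙 _ :=
    eq_of_heq (app_eqToHom (Bicategory.Strict.id_comp g).symm B)
  refine Eq.trans ?_ (h.trans ?_)
  · exact congrArg (fun t => app adj.unit ((DoubleFunctor.tight g).obj B) ≫ t)
      ((congrArg (fun t => t ≫ (DoubleFunctor.tight g).map (app adj.counit B)) h₁).trans
        (Category.id_comp _)).symm
  · exact (congrArg₂ (fun s t => s ≫ t) h₂ h₃).trans (Category.id_comp _)

end AdjunctionComponents

end DoubleCategory

namespace CartesianObject

open DoubleCategory PointedDoubleCategory

section Terminal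

variable (D : CartesianObject DoubleCategory.{v, u})

/-- This is the right triangle of the unit adjunction at the only object of the terminal double
category, where the counit goes to an identity. -/
theorem toUnit_unitObj : D.toUnit D.unitObj = 𝟙 D.unitObj := by
  have h := app_right_triangle D.unitAdj PUnit.unit
  have h₁ : (DoubleFunctor.tight D.unit).map (app D.unitAdj.counit PUnit.unit) = 𝟙 D.unitObj :=
    (DoubleFunctor.tight D.unit).map_id PUnit.unit
  exact (Category.comp_id _).symm.trans
    ((congrArg (fun t => app D.unitAdj.unit D.unitObj ≫ t) h₁).symm.trans h)

/-- Naturality of the unit of the adjunction along f, together with its triviality at 1, shows that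
1 is terminal in the tight category. -/
theorem eq_toUnit {A : D.obj.Obj} (f : A ⟶ D.unitObj) : f = D.toUnit A := by
  have h : f ≫ app D.unitAdj.unit D.unitObj =
      app D.unitAdj.unit A ≫ (DoubleFunctor.tight D.unit).map (𝟙 _) :=
    TightTransformation.app_naturality D.unitAdj.unit f
  have h₁ : (DoubleFunctor.tight D.unit).map (𝟙 _) = 𝟙 D.unitObj :=
    (DoubleFunctor.tight D.unit).map_id PUnit.unit
  refine (Category.comp_id _).symm.trans
    ((congrArg (fun t => f ≫ t) D.toUnit_unitObj).symm.trans (h.trans ?_))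
  exact (congrArg (fun t => app D.unitAdj.unit A ≫ t) h₁).trans (Category.comp_id _)

theorem hom_unitObj_ext {A : D.obj.Obj} (f g : A ⟶ D.unitObj) : f = g :=
  (D.eq_toUnit f).trans (D.eq_toUnit g).symm

/-- The isomorphism `1 × 1 ≅ 1`. -/
def unitIso : D.tensorObj D.unitObj D.unitObj ≅ D.unitObj where
  hom := D.toUnit _
  inv := app D.mulAdj.unit D.unitObj
  hom_inv_id := by
    -- Naturality moves the diagonal of 1 to the diagonal of 1 × 1 followed by ! × !. By terminality
    -- the pair (!, !) is the counit at (1, 1), so the right triangle gives the identity.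
    have h : D.toUnit _ ≫ app D.mulAdj.unit D.unitObj =
        app D.mulAdj.unit (D.tensorObj D.unitObj D.unitObj) ≫
          (DoubleFunctor.tight D.mul).map (X := (_, _)) (Y := (_, _)) (D.toUnit _, D.toUnit _) :=
      TightTransformation.app_naturality D.mulAdj.unit (D.toUnit (D.tensorObj D.unitObj D.unitObj))
    refine h.trans (Eq.trans ?_ (app_right_triangle D.mulAdj (D.unitObj, D.unitObj)))
    exact congrArg (fun t => app D.mulAdj.unit (D.tensorObj D.unitObj D.unitObj) ≫
      (DoubleFunctor.tight D.mul).map (X := (_, _)) (Y := (_, _)) t)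
      (Prod.ext (D.hom_unitObj_ext _ _) (D.hom_unitObj_ext _ _))
  inv_hom_id := D.hom_unitObj_ext _ _

end Terminal

section Pointed

variable (D : CartesianObject DoubleCategory.{v, u}) (h : D.UnitIsConjointCommuter)

/-- A cartesian double category pointed by its terminal object. -/
abbrev pointedObj : PointedDoubleCategory.{v, u} := ⟨D.obj, D.unitObj⟩

/-- The multiplication, with the comparison `1 × 1 ≅ 1`. -/
abbrev pointedMul : (prod D.pointedObj D.pointedObj : PointedDoubleCategory.{v, u}) ⟶ D.pointedObj :=
  (⟨D.mul, D.unitIso, h⟩ : PointedFunctor (D.pointedObj.product D.pointedObj) D.pointedObj)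

/-- The unit, with the identity as comparison. -/
abbrev pointedUnit : (one : PointedDoubleCategory.{v, u}) ⟶ D.pointedObj :=
  (⟨D.unit, Iso.refl _, (isConjointCommuter_unitCell_iff _).2 (hasLift_id _)⟩ :
    PointedFunctor PointedDoubleCategory.terminal D.pointedObj)

/-- The multiplication is right adjoint to the diagonal among pointed double categories. -/
def pointedMulAdj : lift (𝟙 D.pointedObj) (𝟙 D.pointedObj) ⊣ D.pointedMul h where
  -- Each compatibility with the point is an equation between arrows into the terminal object, in
  -- both components in the case of the counit.
  unit := (⟨D.mulAdj.unit, D.hom_unitObj_ext _ _⟩ : PointedTransformation _ _)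
  counit := (⟨D.mulAdj.counit, Prod.ext (D.hom_unitObj_ext _ _) (D.hom_unitObj_ext _ _)⟩ :
    PointedTransformation _ _)
  left_triangle := forgetHom_map_injective (by
    rw [forget_leftZigzag, Functor.map_comp, forget_leftUnitor_hom, forget_rightUnitor_inv]
    exact D.mulAdj.left_triangle)
  right_triangle := forgetHom_map_injective (by
    rw [forget_rightZigzag, Functor.map_comp, forget_rightUnitor_hom, forget_leftUnitor_inv]
    exact D.mulAdj.right_triangle)

/-- The unit is right adjoint to the map to the terminal pointed double category. -/
def pointedUnitAdj : toOne D.pointedObj ⊣ D.pointedUnit where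
  unit := (⟨D.unitAdj.unit, D.hom_unitObj_ext _ _⟩ : PointedTransformation _ _)
  counit := (⟨D.unitAdj.counit, rfl⟩ : PointedTransformation _ _)
  left_triangle := toOne_ext _ _
  right_triangle := forgetHom_map_injective (by
    rw [forget_rightZigzag, Functor.map_comp, forget_rightUnitor_hom, forget_leftUnitor_inv]
    exact D.unitAdj.right_triangle)

/-- A cartesian double category whose isomorphism `1 × 1 ≅ 1` is a conjoint commuter, as a
cartesian object of pointed double categories. -/
def pointed : CartesianObject PointedDoubleCategory.{v, u} where
  obj := D.pointedObj
  mul := D.pointedMul h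
  unit := D.pointedUnit
  mulAdj := D.pointedMulAdj h
  unitAdj := D.pointedUnitAdj

theorem forget_pointed : (D.pointed h).forget = D := rfl

theorem pointed_pointIsUnit : (D.pointed h).PointIsUnit := ⟨rfl, rfl⟩

end Pointed

/-- An adjunction between fixed 1-cells is determined by its unit and counit, on which forgetting
points is injective. -/
theorem ext_of_forget {X Y : CartesianObject PointedDoubleCategory.{v, u}}
    (h : X.forget = Y.forget) (hobj : X.obj = Y.obj) (hmul : HEq X.mul Y.mul)
    (hunit : HEq X.unit Y.unit) : X = Y := by
  obtain ⟨X, mul, unit, mulAdj, unitAdj⟩ := X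
  obtain ⟨Y, mul', unit', mulAdj', unitAdj'⟩ := Y
  obtain rfl : X = Y := hobj
  obtain rfl : mul = mul' := eq_of_heq hmul
  obtain rfl : unit = unit' := eq_of_heq hunit
  injection h with _ _ _ h₁ h₂
  obtain ⟨a, b, _, _⟩ := mulAdj
  obtain ⟨a', b', _, _⟩ := mulAdj'
  obtain ⟨c, d, _, _⟩ := unitAdj
  obtain ⟨c', d', _, _⟩ := unitAdj'
  injection h₁ with h₃ h₄
  injection h₂ with h₅ h₆
  obtain rfl : a = a' := forgetHom_map_injective h₃
  obtain rfl : b = b' := forgetHom_map_injective h₄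
  obtain rfl : c = c' := forgetHom_map_injective h₅
  obtain rfl : d = d' := forgetHom_map_injective h₆
  rfl

/-- The unit of `X.unitAdj` respects the points, which says that ! : p → 1 followed by the
comparison 1 → p is the identity. Hence p is terminal too, and every arrow into it factors uniquely
through 1. -/
theorem eq_toUnit_comp_pointIso (X : CartesianObject PointedDoubleCategory.{v, u})
    {A : X.obj.double.Obj} (f : A ⟶ X.obj.point) :
    f = X.forget.toUnit A ≫ (PointedFunctor.pointIso X.unit).hom := by
  have h : X.forget.toUnit X.obj.point ≫
      (DoubleFunctor.tight X.forget.unit).map (𝟙 _) ≫ (PointedFunctor.pointIso X.unit).hom =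
        𝟙 X.obj.point :=
    PointedTransformation.app_point X.unitAdj.unit
  have h₁ : (DoubleFunctor.tight X.forget.unit).map (𝟙 _) ≫ (PointedFunctor.pointIso X.unit).hom =
      (PointedFunctor.pointIso X.unit).hom :=
    (congrArg (fun t => t ≫ (PointedFunctor.pointIso X.unit).hom)
      ((DoubleFunctor.tight X.forget.unit).map_id PUnit.unit)).trans (Category.id_comp _)
  refine (Category.comp_id f).symm.trans ((congrArg (fun t => f ≫ t) h).symm.trans ?_)
  refine (congrArg (fun t => f ≫ X.forget.toUnit X.obj.point ≫ t) h₁).trans ?_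
  refine (Category.assoc _ _ _).symm.trans ?_
  exact congrArg (fun t => t ≫ (PointedFunctor.pointIso X.unit).hom) (X.forget.eq_toUnit _)

/-- Both sides are arrows into the point, which is terminal. This plays the part of
`unitIso_comp_pointIso`. -/
theorem toUnit_comp_pointIso (X : CartesianObject PointedDoubleCategory.{v, u}) :
    X.forget.toUnit (X.forget.tensorObj X.forget.unitObj X.forget.unitObj) ≫
        (PointedFunctor.pointIso X.unit).hom =
      (DoubleFunctor.tight X.forget.mul).map (X := (_, _)) (Y := (_, _))
          ((PointedFunctor.pointIso X.unit).hom, (PointedFunctor.pointIso X.unit).hom) ≫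
        (PointedFunctor.pointIso X.mul).hom :=
  (X.eq_toUnit_comp_pointIso _).symm

theorem PointIsUnit.unitIsConjointCommuter
    {X : CartesianObject PointedDoubleCategory.{v, u}} (h : X.PointIsUnit) :
    X.forget.UnitIsConjointCommuter := by
  obtain ⟨h, h'⟩ := h
  have key := X.toUnit_comp_pointIso
  rw [h'] at key
  exact isConjointCommuter_of_eqToHom h key
    (PointedFunctor.isConjointCommuter X.mul)

theorem PointIsUnit.pointed_forget
    {X : CartesianObject PointedDoubleCategory.{v, u}} (h : X.PointIsUnit) :
    X.forget.pointed h.unitIsConjointCommuter = X := by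
  have hc := h.unitIsConjointCommuter
  obtain ⟨h, h'⟩ := h
  have key := X.toUnit_comp_pointIso
  rw [h'] at key
  exact ext_of_forget rfl (congrArg (PointedDoubleCategory.mk X.obj.double) h)
    (pointedFunctor_heq_of_eqToHom h (i := X.forget.unitIso) key hc
      (PointedFunctor.isConjointCommuter X.mul))
    (pointedUnit_heq_of_eqToHom h h' _
      (PointedFunctor.isConjointCommuter X.unit))

theorem forget_bijOn : Set.BijOn CartesianObject.forget.{v, u} {X | X.PointIsUnit}
    {D | D.UnitIsConjointCommuter} :=
  ⟨fun _ h => PointIsUnit.unitIsConjointCommuter h,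
    fun X hX Y hY h => by
      rw [← PointIsUnit.pointed_forget hX, ← PointIsUnit.pointed_forget hY]
      congr 1,
    fun D h => ⟨D.pointed h, D.pointed_pointIsUnit h, D.forget_pointed h⟩⟩

end CartesianObject

/-! ### Changing the unit of a cartesian object. -/

namespace CartesianObject

section

variable {K : Type u₁} [Bicategory.{w₁, v₁} K]

/-- Replace the right adjoint of an adjunction by an isomorphic 1-cell. -/
def replaceRightAdjoint {a b : K} {f : a ⟶ b} {g g' : b ⟶ a} (adj : f ⊣ g) (e : g' ≅ g) :
    f ⊣ g' where
  unit := adj.unit ≫ f ◁ e.inv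
  counit := e.hom ▷ f ≫ adj.counit
  left_triangle := by
    have h := adj.left_triangle
    rw [PointedDoubleCategory.leftZigzag_eq] at h ⊢
    rw [← h, whiskerLeft_comp, comp_whiskerRight, whisker_assoc]
    simp only [Category.assoc, Iso.inv_hom_id_assoc]
    -- The inverse of e from the new unit meets e from the new counit and cancels, leaving the old
    -- zigzag.
    rw [← whiskerLeft_comp_assoc, ← comp_whiskerRight, e.inv_hom_id, id_whiskerRight,
      whiskerLeft_id, Category.id_comp]
  right_triangle := by
    have h := adj.right_triangle
    rw [PointedDoubleCategory.rightZigzag_eq] at h ⊢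
    -- Exchange pulls e out to the left and its inverse out to the right, so that the old right
    -- zigzag is isolated between them and can be replaced by unitors.
    calc g' ◁ (adj.unit ≫ f ◁ e.inv) ≫ (α_ g' f g').inv ≫ (e.hom ▷ f ≫ adj.counit) ▷ g'
      _ = g' ◁ adj.unit ≫ g' ◁ f ◁ e.inv ≫ e.hom ▷ (f ≫ g') ≫ (α_ g f g').inv ≫
          adj.counit ▷ g' := by simp
      _ = g' ◁ adj.unit ≫ e.hom ▷ (f ≫ g) ≫ (g ◁ f ◁ e.inv ≫ (α_ g f g').inv) ≫
          adj.counit ▷ g' := by rw [whisker_exchange_assoc, Category.assoc]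
      _ = (g' ◁ adj.unit ≫ e.hom ▷ (f ≫ g)) ≫ (α_ g f g).inv ≫ (g ≫ f) ◁ e.inv ≫
          adj.counit ▷ g' := by simp
      _ = e.hom ▷ 𝟙 a ≫ (g ◁ adj.unit ≫ (α_ g f g).inv ≫ adj.counit ▷ g) ≫ 𝟙 b ◁ e.inv := by
        rw [whisker_exchange, whisker_exchange]; simp
      _ = (ρ_ g').hom ≫ (λ_ g').inv := by rw [h]; simp

/-- Between identity 1-cells the mate is, up to unitors, a conjugate, and conjugation preserves
invertibility. The identities enter as equations because the action of an identity on a product is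
an identity only by a proof. -/
theorem isIso_mateEquiv_of_eq_id {a b : K} {l₁ l₂ : a ⟶ b} {r₁ r₂ : b ⟶ a}
    (adj₁ : l₁ ⊣ r₁) (adj₂ : l₂ ⊣ r₂) {g : a ⟶ a} {h : b ⟶ b} (hg : g = 𝟙 a) (hh : h = 𝟙 b)
    (k : g ≫ l₂ = l₁ ≫ h) :
    IsIso (mateEquiv adj₁ adj₂ (eqToHom k)) := by
  subst hg hh
  have key : mateEquiv adj₁ adj₂ (eqToHom k) = (ρ_ r₁).hom ≫
      conjugateEquiv adj₁ adj₂ ((λ_ l₂).inv ≫ eqToHom k ≫ (ρ_ l₁).hom) ≫ (λ_ r₂).inv := by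
    rw [conjugateEquiv_apply]
    simp
  rw [key]
  infer_instance

end

variable {K : Type u₁} [Bicategory.{w₁, v₁} K] [Bicategory.Strict K] [CartesianTwoCategory K]
  (X : CartesianObject K) {unit : (one : K) ⟶ X.obj} (e : unit ≅ X.unit)

/-- The cartesian object obtained by replacing the unit by an isomorphic one. -/
def replaceUnit : CartesianObject K where
  obj := X.obj
  mul := X.mul
  unit := unit
  mulAdj := X.mulAdj
  unitAdj := replaceRightAdjoint X.unitAdj e

theorem lift_fst_comp_id_snd_comp_id (A : K) :
    lift (fst A A ≫ 𝟙 A) (snd A A ≫ 𝟙 A) = 𝟙 (prod A A) := by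
  rw [Bicategory.Strict.comp_id, Bicategory.Strict.comp_id, lift_unique (𝟙 (prod A A)),
    Bicategory.Strict.id_comp, Bicategory.Strict.id_comp]

/-- The identity 1-cell works in both directions, since its canonical comparisons are mates of
`eqToHom`s along identities. -/
theorem equivalent_replaceUnit : X.Equivalent (X.replaceUnit e) :=
  ⟨𝟙 X.obj, 𝟙 X.obj,
    ⟨isIso_mateEquiv_of_eq_id _ _ rfl (lift_fst_comp_id_snd_comp_id X.obj) _,
      isIso_mateEquiv_of_eq_id _ _ rfl rfl _⟩,
    ⟨isIso_mateEquiv_of_eq_id _ _ rfl (lift_fst_comp_id_snd_comp_id X.obj) _,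
      isIso_mateEquiv_of_eq_id _ _ rfl rfl _⟩,
    ⟨eqToIso (Bicategory.Strict.comp_id (𝟙 X.obj))⟩,
    ⟨eqToIso (Bicategory.Strict.comp_id (𝟙 X.obj))⟩⟩

end CartesianObject

namespace CartesianObject

open PointedDoubleCategory

theorem exists_pointIsUnit (X : CartesianObject PointedDoubleCategory.{v, u}) :
    ∃ Y : CartesianObject PointedDoubleCategory.{v, u}, Y.PointIsUnit ∧ X.Equivalent Y :=
  ⟨X.replaceUnit (pointUnitIso X.unit), ⟨rfl, rfl⟩, X.equivalent_replaceUnit _⟩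

end CartesianObject

theorem mainTheorem8 :
    (Set.BijOn SymmetricMonoidalObject.forget.{v, u} {X | X.PointIsUnit}
        {D | D.UnitIsConjointCommuter} ∧
      ∀ X : SymmetricMonoidalObject PointedDoubleCategory.{v, u},
        ∃ Y : SymmetricMonoidalObject PointedDoubleCategory.{v, u},
          Y.PointIsUnit ∧ X.Equivalent Y) ∧
    (Set.BijOn CartesianObject.forget.{v, u} {X | X.PointIsUnit}
        {D | D.UnitIsConjointCommuter} ∧
      ∀ X : CartesianObject PointedDoubleCategory.{v, u},
        ∃ Y : CartesianObject PointedDoubleCategory.{v, u},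
          Y.PointIsUnit ∧ X.Equivalent Y) :=
  ⟨⟨SymmetricMonoidalObject.forget_bijOn, SymmetricMonoidalObject.exists_pointIsUnit⟩,
    CartesianObject.forget_bijOn, CartesianObject.exists_pointIsUnit⟩
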